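/- A (multi)graph is called series-parallel if it is a single edge (joining two distinct vertices), a single loop, or can be constructed from a $2$-cycle (two distinct vertices joined by two edges) by a finite sequence of series extensions (subdividing an edge) and parallel extensions (adding a new edge parallel to an existing one). A series-parallel matroid is the cycle matroid of a series-parallel graph, that is, the matroid on the edge set whose independent sets are the sets of edges containing no cycle. A matroid is simple if it has no loops and no pairs of parallel elements. Let $E_{n,k}$ denote the number of simple series-parallel matroids of rank $k$ on the ground set $[n]=\{1,\dots,n\}$, and for odd $n\ge 1$ write $n!!=n(n-2)\cdots 3\cdot 1$. For every integer $k\ge 3$, $$\frac{E_{2k-3,k}}{(2k-3)!!}=\frac12(2k-1)^{k-2}-(2k-2)^{k-2}+\frac12(2k-3)^{k-2}+\frac23(k-2)\left((2k-3)^{k-3}-(2k-2)^{k-3}\right)+\frac19(4k-7)(k-2)(k-3)(2k-3)^{k-5}.$$ -/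

import Mathlib

open scoped Graph

namespace SeriesParallel

variable {α β : Type*}

/-- `H` is obtained from the multigraph `G` by adding a new edge `f` parallel to an edge `e`. -/
def IsParallelExtension (G H : Graph α β) : Prop :=
  ∃ e f : β, e ∈ E(G) ∧ f ∉ E(G) ∧ V(H) = V(G) ∧
    ∀ g x y, H.IsLink g x y ↔ G.IsLink g x y ∨ (g = f ∧ G.IsLink e x y)

/-- `H` is obtained from the multigraph `G` by subdividing an edge `e` with ends `u` and `v`: a new
vertex `w` is added, and `e` is replaced by an edge from `u` to `w` (which keeps the label `e`) and
an edge from `w` to `v` (with a new label `f`). -/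
def IsSeriesExtension (G H : Graph α β) : Prop :=
  ∃ (e f : β) (u v w : α), G.IsLink e u v ∧ f ∉ E(G) ∧ w ∉ V(G) ∧ V(H) = insert w V(G) ∧
    ∀ g x y, H.IsLink g x y ↔
      (g ≠ e ∧ G.IsLink g x y) ∨ (g = e ∧ s(x, y) = s(u, w)) ∨ (g = f ∧ s(x, y) = s(w, v))

/-- The multigraphs that can be constructed from a 2-cycle (two distinct vertices joined by two
distinct edges) by a sequence of series and parallel extensions. -/
inductive FromTwoCycle : Graph α β → Prop
  | twoCycle (u v : α) (e f : β) (huv : u ≠ v) (hef : e ≠ f) :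
      FromTwoCycle (Graph.banana u v {e, f})
  | parallel (G H : Graph α β) (hG : FromTwoCycle G) (h : IsParallelExtension G H) :
      FromTwoCycle H
  | series (G H : Graph α β) (hG : FromTwoCycle G) (h : IsSeriesExtension G H) :
      FromTwoCycle H

/-- A series-parallel graph: a graph constructed from a 2-cycle by series and parallel extensions,
or a single edge, or a single loop. -/
def IsSeriesParallelGraph (G : Graph α β) : Prop :=
  FromTwoCycle G ∨
    (∃ (u v : α) (e : β), u ≠ v ∧ G = Graph.banana u v {e}) ∨
    (∃ (v : α) (e : β), G = Graph.bouquet v {e})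

/-- `C` is the edge set of a cycle of `G`: there are distinct vertices `v 0, …, v m` and distinct
edges `e 0, …, e m` such that `e i` joins `v i` and `v (i + 1)`, indices being read cyclically.
For `m = 0` this is a loop, and for `m = 1` a pair of parallel edges. -/
def IsCycleEdgeSet (G : Graph α β) (C : Set β) : Prop :=
  ∃ (m : ℕ) (v : Fin (m + 1) → α) (e : Fin (m + 1) → β),
    Function.Injective v ∧ Function.Injective e ∧
      (∀ i, G.IsLink (e i) (v i) (v (i + 1))) ∧ C = Set.range e

/-- `M` is the matroid associated with `G` (its cycle matroid): its ground set is the edge set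
of `G`, and a set of edges is independent if and only if it contains no cycle. -/
def IsCycleMatroid (M : Matroid β) (G : Graph α β) : Prop :=
  M.E = E(G) ∧ ∀ I : Set β, M.Indep I ↔ I ⊆ E(G) ∧ ∀ C ⊆ I, ¬ IsCycleEdgeSet G C

/-- A series-parallel matroid is the matroid associated with a series-parallel graph.
Series-parallel graphs are finite, so vertices can be taken in `ℕ`. -/
def IsSeriesParallelMatroid (M : Matroid β) : Prop :=
  ∃ G : Graph ℕ β, IsSeriesParallelGraph G ∧ IsCycleMatroid M G

/-- A matroid is simple if it has no loops (the case `e = f`) and no pairs of parallel elements. -/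
def IsSimpleMatroid (M : Matroid β) : Prop :=
  ∀ e ∈ M.E, ∀ f ∈ M.E, M.Indep {e, f}

/-- The number `E_{n,k}` of simple series-parallel matroids of rank `k` whose ground set is a given
(labelled) set of `n` elements. -/
noncomputable def numSimple (n k : ℕ) : ℕ :=
  Set.ncard {M : Matroid (Fin n) | M.E = Set.univ ∧ IsSeriesParallelMatroid M ∧
    IsSimpleMatroid M ∧ M.eRank = k}

end SeriesParallel

/-! Fix an element e₀ of the ground set. A series-parallel matroid on at least two elements amounts
to a two-terminal series-parallel network on the other elements, closed up by e₀: independent sets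
avoiding e₀ tell which edge sets of the network are acyclic, and those containing e₀ tell which of
these do not join the terminals. The rank is kept, and the matroid is simple exactly when the
network has no parallel edges and no edge joining its terminals (`numSimple_eq`).

Networks are counted by unique factorization: a series or parallel composition determines the
irreducible factor that contains a given edge (`ser_unique`, `par_unique`). A simple network of rank
r has at most 2r - 1 edges, and at most 2r - 2 if no edge joins the terminals (`IsNet.card_le`). Let
x mark edges and t the deficit from these bounds. Let S, U, Q be the exponential generating
functions of the simple networks that are series compositions, that are not, and that have no
terminal edge (with the empty one added). Then S' = U' (U + t S), Q' = S' Q, U + t S = t (Q - 1) + x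
Q by `genS_insert`, `genQ_insert` and `genU_add_genS_eq`. Rank k with 2k - 4 edges is deficit 2, so
the t²-coefficient Q₂ of Q is wanted.

At t = 0 the system reads U₀ = x exp(U₀²/2), and each further order is linear in its new unknowns.
With θ = x d/dx, `eulerOp_second_order` expresses θQ₂ through θ⁰, θ¹ and θ² of combinations of Q₀^b
U₀^(2μ) / (1 - U₀²). The coefficients of these series are single powers, by Lagrange inversion
(`coeff_eq_descFactorial`), and `closed_formula_aux` adds them up. -/

namespace SeriesParallel

/-! ### Power series: the functional equations solved to second order. -/

section PowerSeriesIdentities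

open PowerSeries

/-- The Euler operator `X d/dX` on power series. -/
noncomputable def eulerOp (F : ℚ⟦X⟧) : ℚ⟦X⟧ := X * d⁄dX ℚ F

lemma coeff_eulerOp (F : ℚ⟦X⟧) (n : ℕ) : coeff n (eulerOp F) = n * coeff n F := by
  cases n with
  | zero => simp [eulerOp]
  | succ n => 
    rw [eulerOp, coeff_succ_X_mul, coeff_derivative]; push_cast; ring

lemma eulerOp_add (F G : ℚ⟦X⟧) : eulerOp (F + G) = eulerOp F + eulerOp G := by
  simp [eulerOp, mul_add]

lemma eulerOp_sub (F G : ℚ⟦X⟧) : eulerOp (F - G) = eulerOp F - eulerOp G := by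
  simp [eulerOp, mul_sub]

lemma eulerOp_mul (F G : ℚ⟦X⟧) : eulerOp (F * G) = F * eulerOp G + G * eulerOp F := by
  simp [eulerOp, Derivation.leibniz]; ring

lemma eulerOp_C (c : ℚ) : eulerOp (C c) = 0 := by
  simp [eulerOp]

lemma eulerOp_one : eulerOp 1 = 0 := by
  simp [eulerOp]

lemma eulerOp_pow (F : ℚ⟦X⟧) (n : ℕ) : eulerOp (F ^ n) = n * F ^ (n - 1) * eulerOp F := by
  rw [eulerOp, eulerOp, derivative_pow]; ring

/-- The solution `F` of `F' = a F` with zero constant coefficient is `0`. -/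
lemma eq_zero_of_derivative_eq_mul (F a : ℚ⟦X⟧) (h0 : constantCoeff F = 0)
    (h : d⁄dX ℚ F = a * F) : F = 0 := by
  ext n
  induction n using Nat.strong_induction_on with
  | _ n ih =>
    cases n with
    | zero => simpa using h0
    | succ n =>
      have := congrArg (coeff n) h
      rw [coeff_derivative, coeff_mul] at this
      rw [Finset.sum_eq_zero] at this
      · have h2 : (n : ℚ) + 1 ≠ 0 := by positivity
        simpa [h2] using this
      · intro p hp
        have := Finset.HasAntidiagonal.mem_antidiagonal.1 hp
        rw [ih p.2 (by omega)]; simp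

lemma eq_of_derivative_eq (F G : ℚ⟦X⟧) (h0 : constantCoeff F = constantCoeff G)
    (h : d⁄dX ℚ F = d⁄dX ℚ G) : F = G :=
  derivative.ext h h0

/-- Coefficients of the powers of the solution of `U = X exp (U ^ 2 / 2)`. -/
lemma coeff_pow_of_eulerOp (U : ℚ⟦X⟧) (hX : X ∣ U) (h1 : coeff 1 U = 1)
    (hU : (1 - U ^ 2) * eulerOp U = U) (m j : ℕ) (hm : 1 ≤ m) :
    coeff (m + 2 * j) (U ^ m) =
      (m : ℚ) / (m + 2 * j) * (((m : ℚ) + 2 * j) / 2) ^ j / j.factorial := by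
  induction j generalizing m with
  | zero =>
    obtain ⟨V, rfl⟩ := hX
    have hV : constantCoeff V = 1 := by
      have := h1
      rw [show 1 = 0 + 1 from rfl, coeff_succ_X_mul] at this
      simpa using this
    have hm' : (m : ℚ) ≠ 0 := by positivity
    rw [mul_pow]
    have := coeff_X_pow_mul (V ^ m) m 0
    simp only [zero_add] at this
    simp [this, hV, hm']
  | succ j ih =>
    -- This is θ(U^m) = m U^m + m/(m+2) θ(U^(m+2)) cleared of denominators. It trades `j + 1` for
    -- `j` at the price of raising `m` by 2, so the degree m + 2j is unchanged.
    have key : C ((m : ℚ) + 2) * eulerOp (U ^ m) =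
        C ((m : ℚ) + 2) * (C (m : ℚ) * U ^ m) + C (m : ℚ) * eulerOp (U ^ (m + 2)) := by
      obtain ⟨m, rfl⟩ : ∃ n, m = n + 1 := ⟨m - 1, by omega⟩
      rw [eulerOp_pow, eulerOp_pow]
      have e2 : (C (2 : ℚ) : ℚ⟦X⟧) = 2 := map_ofNat _ 2
      simp only [Nat.add_sub_cancel, show m + 1 + 2 - 1 = m + 2 by omega, map_natCast, map_add, e2]
      push_cast
      linear_combination (((m : ℚ⟦X⟧) + 1 + 2) * (m + 1) * U ^ m) * hU
    have key2 := congrArg (coeff (m + 2 * (j + 1))) key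
    rw [coeff_C_mul, map_add, coeff_C_mul, coeff_C_mul, coeff_C_mul, coeff_eulerOp,
      coeff_eulerOp] at key2
    have ih' := ih (m + 2) (by omega)
    rw [show m + 2 + 2 * j = m + 2 * (j + 1) by ring] at ih'
    rw [ih'] at key2
    have a1 : (m : ℚ) + 2 ≠ 0 := by positivity
    have a2 : (m : ℚ) + 2 + 2 * j ≠ 0 := by positivity
    have a3 : (m : ℚ) + 2 * (j + 1) ≠ 0 := by positivity
    have a4 : (j : ℚ) + 1 ≠ 0 := by positivity
    have a5 : (j.factorial : ℚ) ≠ 0 := by positivity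
    have a6 : (m + 2 * (j + 1) : ℚ) - m ≠ 0 := by
      rw [add_sub_cancel_left]; positivity
    rw [Nat.factorial_succ, pow_succ]
    push_cast at key2 ⊢
    have e2 : (m : ℚ) + 2 + 2 * j = m + 2 * (j + 1) := by ring
    rw [e2] at key2
    generalize coeff (m + 2 * (j + 1)) (U ^ m) = c at key2 ⊢
    generalize (((m : ℚ) + 2 * (j + 1)) / 2) ^ j = t at key2 ⊢
    field_simp at key2 ⊢
    linear_combination key2


/-- Since U = XP and θU = UI, multiplying by X^b turns the series into θ(U^(2μ+b)) / (2μ+b), whose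
coefficients are given by `coeff_pow_of_eulerOp`. The double factorial comes from (2l)! = 2^l l!
(2l-1)!!. For μ > l both sides vanish. -/
lemma coeff_eq_descFactorial (U P I : ℚ⟦X⟧) (hPX : U = X * P) (h1 : coeff 1 U = 1)
    (hU : (1 - U ^ 2) * eulerOp U = U) (hI : (1 - U ^ 2) * I = 1) (l b μ : ℕ) (hb : 1 ≤ b) :
    ((2 * l).factorial : ℚ) * coeff (2 * l) (P ^ b * U ^ (2 * μ) * I) =
      (Nat.doubleFactorial (2 * l - 1) : ℚ) * (2 ^ μ * (l.descFactorial μ : ℚ) *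
        (2 * (l : ℚ) + b) ^ ((l : ℤ) - μ)) := by
  have hUI : eulerOp U = U * I := by
    linear_combination (-eulerOp U) * hI + I * hU
  have hdvd : X ∣ U := ⟨P, hPX⟩
  have hshift : coeff (2 * l) (P ^ b * U ^ (2 * μ) * I) =
      coeff (2 * l + b) (U ^ (2 * μ + b) * I) := by
    rw [← coeff_X_pow_mul (P ^ b * U ^ (2 * μ) * I) b (2 * l)]
    congr 1
    rw [pow_add U (2 * μ) b]
    nth_rewrite 3 [hPX]
    ring
  have hM : (2 * l + b : ℚ) ≠ 0 := by positivity
  have hpow : C ((2 * μ + b : ℕ) : ℚ) * (U ^ (2 * μ + b) * I) = eulerOp (U ^ (2 * μ + b)) := by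
    rw [eulerOp_pow, hUI]
    obtain ⟨c, hc⟩ : ∃ c, 2 * μ + b = c + 1 := ⟨2 * μ + b - 1, by omega⟩
    rw [hc, map_natCast]; simp; ring
  have hc := congrArg (coeff (2 * l + b)) hpow
  rw [coeff_C_mul, coeff_eulerOp] at hc
  rw [hshift]
  have hM2 : ((2 * μ + b : ℕ) : ℚ) ≠ 0 := by positivity
  by_cases h : μ ≤ l
  · obtain ⟨j, rfl⟩ := Nat.exists_eq_add_of_le h
    have e1 : 2 * (μ + j) + b = 2 * μ + b + 2 * j := by ring
    rw [e1] at hc ⊢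
    rw [coeff_pow_of_eulerOp U hdvd h1 hU _ _ (by omega)] at hc
    have e2 : ((2 * (μ + j)).factorial : ℚ) =
        2 ^ (μ + j) * (μ + j).factorial * (Nat.doubleFactorial (2 * (μ + j) - 1) : ℚ) := by
      rcases Nat.eq_zero_or_pos (μ + j) with h0 | h0
      · simp [h0]
      · obtain ⟨t, ht⟩ : ∃ t, μ + j = t + 1 := ⟨μ + j - 1, by omega⟩
        rw [ht, show 2 * (t + 1) = (2 * t + 1) + 1 by ring, Nat.factorial_eq_mul_doubleFactorial,
          show 2 * t + 1 + 1 = 2 * (t + 1) by ring, Nat.doubleFactorial_two_mul]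
        push_cast
        congr 2
    have e3 : ((μ + j).descFactorial μ : ℚ) * j.factorial = (μ + j).factorial := by
      have := Nat.factorial_mul_descFactorial (Nat.le_add_right μ j)
      rw [Nat.add_sub_cancel_left] at this
      rw [mul_comm]; exact_mod_cast this
    have e4 : ((μ + j : ℕ) : ℤ) - μ = (j : ℕ) := by push_cast; ring
    rw [e4, zpow_natCast, e2, ← e3]
    have a5 : (j.factorial : ℚ) ≠ 0 := by positivity
    have e5 : (2 * ((μ + j : ℕ) : ℚ) + b) = ((2 * μ + b : ℕ) : ℚ) + 2 * j := by push_cast; ring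
    rw [e5]
    have a6 : ((2 * μ + b : ℕ) : ℚ) + 2 * j ≠ 0 := by positivity
    rw [div_pow] at hc
    have hc' : coeff (2 * μ + b + 2 * j) (U ^ (2 * μ + b) * I) =
        (((2 * μ + b : ℕ) : ℚ) + 2 * j) ^ j / 2 ^ j / j.factorial := by
      refine mul_left_cancel₀ hM2 ?_
      have e6 : ((2 * μ + b + 2 * j : ℕ) : ℚ) = ((2 * μ + b : ℕ) : ℚ) + 2 * j := by
        push_cast; ring
      rw [hc, e6]
      field_simp
    rw [hc']
    field_simp
    ring
  · have h0 : coeff (2 * l + b) (U ^ (2 * μ + b)) = 0 := by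
      rw [hPX, mul_pow]
      rw [coeff_X_pow_mul', if_neg (by omega)]
    rw [h0, mul_zero] at hc
    rw [(mul_eq_zero.1 hc).resolve_left hM2, Nat.descFactorial_of_lt (by omega)]
    simp


lemma eulerOp_ofNat (n : ℕ) [n.AtLeastTwo] : eulerOp (ofNat(n) : ℚ⟦X⟧) = 0 := by
  have : (ofNat(n) : ℚ⟦X⟧) = C (ofNat(n) : ℚ) := (map_ofNat C n).symm
  rw [this, eulerOp_C]

/-- The second-order term of the Lagrange expansion. -/
lemma eulerOp_second_order (U P I : ℚ⟦X⟧) (hI : (1 - U ^ 2) * I = 1)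
    (dU : eulerOp U = U * I) (dP : eulerOp P = P * U ^ 2 * I) (S₁ U₁ S₂ Q₂ : ℚ⟦X⟧)
    (hS₁ : 3 * S₁ = U * (3 * P - 3 - U ^ 2) * I)
    (hU₁ : 2 * U₁ = 2 * U * S₁ + 2 * P - 2 - U ^ 2)
    (hS₂ : 24 * S₂ = (12 * U ^ 2 * S₁ ^ 2 + 24 * U * S₁ * (P - 1) + 12 * U₁ ^ 2 +
      12 * U ^ 2 * U₁ + U ^ 4) * I)
    (hQ₂ : 2 * Q₂ = P * (2 * S₂ + S₁ ^ 2)) (h : ℚ⟦X⟧) (hh : h = 2 + U ^ 2 - 2 * P) :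
    72 * eulerOp Q₂ = P * (12 * U ^ 4 + 9 * U ^ 6 + U ^ 8) * I +
      eulerOp (P * (9 * U ^ 6 - 18 * U ^ 2 * h + 2 * U ^ 8 - 6 * U ^ 4 * h
        - 12 * U ^ 4 * (1 - P) + 9 * h ^ 2) * I) +
      eulerOp (eulerOp (P * (U ^ 8 - 6 * U ^ 4 * h + 9 * h ^ 2) * I)) := by
  have dI : eulerOp I = 2 * U ^ 2 * I ^ 3 := by
    have := congrArg eulerOp hI
    simp only [eulerOp_mul, eulerOp_sub, eulerOp_one, eulerOp_pow, dU] at this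
    push_cast at this
    linear_combination I * this - (eulerOp I) * hI
  have d1 := congrArg eulerOp hS₁
  have d2 := congrArg eulerOp hU₁
  have d3 := congrArg eulerOp hS₂
  have d4 := congrArg eulerOp hQ₂
  subst hh
  simp only [eulerOp_mul, eulerOp_sub, eulerOp_add, eulerOp_one, eulerOp_pow, eulerOp_ofNat, dU, dP, dI,
    mul_zero, zero_add, add_zero, sub_zero, zero_sub, Nat.cast_ofNat, Nat.reduceSub, pow_one] at d1 d2 d3 d4 ⊢
  generalize eulerOp S₁ = DS₁ at *
  generalize eulerOp S₂ = DS₂ at *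
  generalize eulerOp U₁ = DU₁ at *
  generalize eulerOp Q₂ = DQ₂ at *
  clear dU dP dI
  -- In the fraction field I is the inverse of 1 - U², and every unknown becomes an explicit
  -- rational function of U and P. What remains is an identity of rational functions.
  apply IsFractionRing.injective ℚ⟦X⟧ (FractionRing ℚ⟦X⟧)
  have inj : ∀ {x y : ℚ⟦X⟧}, x = y →
      algebraMap ℚ⟦X⟧ (FractionRing ℚ⟦X⟧) x = algebraMap ℚ⟦X⟧ (FractionRing ℚ⟦X⟧) y :=
    fun h => congrArg _ h
  replace hI := inj hI
  replace hS₁ := inj hS₁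
  replace hS₂ := inj hS₂
  replace hU₁ := inj hU₁
  replace hQ₂ := inj hQ₂
  replace d1 := inj d1
  replace d2 := inj d2
  replace d3 := inj d3
  replace d4 := inj d4
  clear inj
  simp only [map_mul, map_add, map_sub, map_pow, map_one, map_ofNat, map_neg] at *
  generalize (algebraMap ℚ⟦X⟧ (FractionRing ℚ⟦X⟧)) DS₁ = DS₁ at *
  generalize (algebraMap ℚ⟦X⟧ (FractionRing ℚ⟦X⟧)) DS₂ = DS₂ at *
  generalize (algebraMap ℚ⟦X⟧ (FractionRing ℚ⟦X⟧)) DU₁ = DU₁ at *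
  generalize (algebraMap ℚ⟦X⟧ (FractionRing ℚ⟦X⟧)) DQ₂ = DQ₂ at *
  generalize (algebraMap ℚ⟦X⟧ (FractionRing ℚ⟦X⟧)) U = U at *
  generalize (algebraMap ℚ⟦X⟧ (FractionRing ℚ⟦X⟧)) P = P at *
  generalize (algebraMap ℚ⟦X⟧ (FractionRing ℚ⟦X⟧)) I = I at *
  generalize (algebraMap ℚ⟦X⟧ (FractionRing ℚ⟦X⟧)) S₁ = S₁ at *
  generalize (algebraMap ℚ⟦X⟧ (FractionRing ℚ⟦X⟧)) U₁ = U₁ at *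
  generalize (algebraMap ℚ⟦X⟧ (FractionRing ℚ⟦X⟧)) S₂ = S₂ at *
  generalize (algebraMap ℚ⟦X⟧ (FractionRing ℚ⟦X⟧)) Q₂ = Q₂ at *
  have : CharZero (FractionRing ℚ⟦X⟧) := algebraRat.charZero _
  have h : (1 - U ^ 2) ≠ 0 := left_ne_zero_of_mul_eq_one hI
  obtain rfl : I = (1 - U ^ 2)⁻¹ := eq_inv_of_mul_eq_one_right hI
  have cancel {a b c : FractionRing ℚ⟦X⟧} (ha : a ≠ 0) (h : a * b = c) : b = c / a := by
    rw [← h, mul_div_cancel_left₀ _ ha]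
  obtain rfl := cancel (by norm_num) hS₁
  obtain rfl := cancel (by norm_num) hU₁
  obtain rfl := cancel (by norm_num) hS₂
  obtain rfl := cancel (by norm_num) d1
  obtain rfl := cancel (by norm_num) d2
  obtain rfl := cancel (by norm_num) d3
  rw [cancel (by norm_num) d4]
  obtain hQ := cancel (by norm_num) hQ₂
  clear hS₁ hU₁ hS₂ hQ₂ d1 d2 d3 d4
  field_simp
  ring

/-- The numerical simplification behind the closed formula. -/
lemma closed_formula_aux (l : ℕ) (hl : 1 ≤ l) (E : ℚ) (T : ℕ → ℕ → ℚ)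
    (hT : ∀ b μ, T b μ = 2 ^ μ * (l.descFactorial μ : ℚ) * (2 * (l : ℚ) + b) ^ ((l : ℤ) - μ))
    (hE : 72 * (2 * l) * E = (Nat.doubleFactorial (2 * l - 1) : ℚ) *
      (12 * T 1 2 + 9 * T 1 3 + T 1 4 +
      (2 * l) * (2 * T 1 4 + 3 * T 1 3 - 33 * T 1 2 + 36 * T 1 0 + 24 * T 2 2 - 72 * T 2 0 +
        36 * T 3 0) +
      (2 * l) ^ 2 * (T 1 4 - 6 * T 1 3 - 3 * T 1 2 + 36 * T 1 1 + 36 * T 1 0 + 12 * T 2 2 -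
        36 * T 2 1 - 72 * T 2 0 + 36 * T 3 0))) (k : ℚ) (hk : k = l + 2) :
    E / (Nat.doubleFactorial (2 * l + 1) : ℚ) =
      (1 / 2) * (2 * k - 1) ^ (l : ℤ) - (2 * k - 2) ^ (l : ℤ)
        + (1 / 2) * (2 * k - 3) ^ (l : ℤ)
        + (2 / 3) * (k - 2) * ((2 * k - 3) ^ ((l : ℤ) - 1) - (2 * k - 2) ^ ((l : ℤ) - 1))
        + (1 / 9) * (4 * k - 7) * (k - 2) * (k - 3) * (2 * k - 3) ^ ((l : ℤ) - 3) := by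
  have hl0 : (l : ℚ) ≠ 0 := by positivity
  have h1 : (2 * l + 1 : ℚ) ≠ 0 := by positivity
  have h2 : (2 * l + 2 : ℚ) ≠ 0 := by positivity
  have hd : (Nat.doubleFactorial (2 * l + 1) : ℚ) =
      (2 * l + 1) * (Nat.doubleFactorial (2 * l - 1) : ℚ) := by
    obtain ⟨m, rfl⟩ : ∃ m, l = m + 1 := ⟨l - 1, by omega⟩
    rw [show 2 * (m + 1) + 1 = (2 * m + 1) + 2 by ring, Nat.doubleFactorial_add_two]
    push_cast
    rw [show 2 * (m + 1) - 1 = 2 * m + 1 by omega]; ring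
  have hd0 : (Nat.doubleFactorial (2 * l - 1) : ℚ) ≠ 0 := by
    exact_mod_cast (Nat.doubleFactorial_pos _).ne'
  have fs (m : ℕ) : (l.descFactorial (m + 1) : ℚ) = (l - m) * l.descFactorial m := by
    rw [Nat.descFactorial_succ]
    rcases le_or_gt m l with h | h
    · push_cast [Nat.cast_sub h]; ring
    · simp [Nat.descFactorial_of_lt h]
  have f1 : (l.descFactorial 1 : ℚ) = l := by simp
  have f2 : (l.descFactorial 2 : ℚ) = l * (l - 1) := by
    rw [Nat.cast_descFactorial_two]
  have f3 : (l.descFactorial 3 : ℚ) = l * (l - 1) * (l - 2) := by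
    rw [fs 2, f2]; push_cast; ring
  have f4 : (l.descFactorial 4 : ℚ) = l * (l - 1) * (l - 2) * (l - 3) := by
    rw [fs 3, f3]; push_cast; ring
  -- With integer exponents every power of 2l + 1 is a polynomial multiple of the (l-4)-th, even for
  -- l < 4, and every power of 2l + 2 of the (l-2)-th. The claim is then linear in `A`, `B`, `Z`
  -- with coefficients rational in l.
  have e1 (μ : ℕ) (hμ : μ ≤ 4) :
      (2 * l + 1 : ℚ) ^ ((l : ℤ) - μ) = (2 * l + 1) ^ ((l : ℤ) - 4) * (2 * l + 1) ^ (4 - μ) := by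
    rw [← zpow_natCast, ← zpow_add₀ h1]; congr 1; omega
  have e2 (μ : ℕ) (hμ : μ ≤ 2) :
      (2 * l + 2 : ℚ) ^ ((l : ℤ) - μ) = (2 * l + 2) ^ ((l : ℤ) - 2) * (2 * l + 2) ^ (2 - μ) := by
    rw [← zpow_natCast, ← zpow_add₀ h2]; congr 1; omega
  have e10 := e1 0 (by norm_num)
  have e11 := e1 1 (by norm_num)
  have e12 := e1 2 (by norm_num)
  have e13 := e1 3 (by norm_num)
  have e20 := e2 0 (by norm_num)
  have e21 := e2 1 (by norm_num)
  have E' : E = (Nat.doubleFactorial (2 * l - 1) : ℚ) *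
      (12 * T 1 2 + 9 * T 1 3 + T 1 4 +
      (2 * l) * (2 * T 1 4 + 3 * T 1 3 - 33 * T 1 2 + 36 * T 1 0 + 24 * T 2 2 - 72 * T 2 0 +
        36 * T 3 0) +
      (2 * l) ^ 2 * (T 1 4 - 6 * T 1 3 - 3 * T 1 2 + 36 * T 1 1 + 36 * T 1 0 + 12 * T 2 2 -
        36 * T 2 1 - 72 * T 2 0 + 36 * T 3 0)) / (72 * (2 * l)) := by
    rw [← hE]; field_simp
  rw [E', hd, hk]
  have g1 : (2 * ((l : ℚ) + 2) - 3) = 2 * l + 1 := by ring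
  have g2 : (2 * ((l : ℚ) + 2) - 2) = 2 * l + 2 := by ring
  have g3 : (2 * ((l : ℚ) + 2) - 1) = 2 * l + 3 := by ring
  rw [g1, g2, g3]
  simp only [hT, f1, f2, f3, f4, Nat.descFactorial_zero]
  push_cast at e10 e11 e12 e13 e20 e21 ⊢
  rw [sub_zero] at e10 e20
  simp only [sub_zero, e10, e11, e12, e13, e20, e21]
  generalize (2 * l + 1 : ℚ) ^ ((l : ℤ) - 4) = A
  generalize (2 * l + 2 : ℚ) ^ ((l : ℤ) - 2) = B
  generalize (2 * l + 3 : ℚ) ^ (l : ℤ) = Z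
  field_simp
  ring

/-- Extraction of the coefficients of `Q₂` from the graded functional equations. -/
theorem coeff_of_graded_equations (S₀ S₁ S₂ U₀ U₁ U₂ Q₀ Q₁ Q₂ : ℚ⟦X⟧)
    (cS₀ : constantCoeff S₀ = 0) (cS₁ : constantCoeff S₁ = 0) (cS₂ : constantCoeff S₂ = 0)
    (cU₁ : constantCoeff U₁ = 0)
    (cQ₀ : constantCoeff Q₀ = 1) (cQ₁ : constantCoeff Q₁ = 0) (cQ₂ : constantCoeff Q₂ = 0)
    (hS₀ : d⁄dX ℚ S₀ = d⁄dX ℚ U₀ * U₀)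
    (hS₁ : d⁄dX ℚ S₁ = d⁄dX ℚ U₀ * U₁ + d⁄dX ℚ U₁ * U₀ + d⁄dX ℚ U₀ * S₀)
    (hS₂ : d⁄dX ℚ S₂ = d⁄dX ℚ U₀ * U₂ + d⁄dX ℚ U₁ * U₁ + d⁄dX ℚ U₂ * U₀ +
      d⁄dX ℚ U₀ * S₁ + d⁄dX ℚ U₁ * S₀)
    (hQ₀ : d⁄dX ℚ Q₀ = d⁄dX ℚ S₀ * Q₀)
    (hQ₁ : d⁄dX ℚ Q₁ = d⁄dX ℚ S₀ * Q₁ + d⁄dX ℚ S₁ * Q₀)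
    (hQ₂ : d⁄dX ℚ Q₂ = d⁄dX ℚ S₀ * Q₂ + d⁄dX ℚ S₁ * Q₁ + d⁄dX ℚ S₂ * Q₀)
    (hU₀ : U₀ = X * Q₀) (hU₁ : U₁ + S₀ = X * Q₁ + (Q₀ - 1)) (hU₂ : U₂ + S₁ = X * Q₂ + Q₁)
    (l : ℕ) (hl : 1 ≤ l) (k : ℚ) (hk : k = l + 2) :
    ((2 * l).factorial * coeff (2 * l) Q₂) / (Nat.doubleFactorial (2 * l + 1) : ℚ) =
      (1 / 2) * (2 * k - 1) ^ (l : ℤ) - (2 * k - 2) ^ (l : ℤ)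
        + (1 / 2) * (2 * k - 3) ^ (l : ℤ)
        + (2 / 3) * (k - 2) * ((2 * k - 3) ^ ((l : ℤ) - 1) - (2 * k - 2) ^ ((l : ℤ) - 1))
        + (1 / 9) * (4 * k - 7) * (k - 2) * (k - 3) * (2 * k - 3) ^ ((l : ℤ) - 3) := by
  have cU₀ : constantCoeff U₀ = 0 := by simp [hU₀]
  have dpow (F : ℚ⟦X⟧) (n : ℕ) : d⁄dX ℚ (F ^ n) = n * F ^ (n - 1) * d⁄dX ℚ F :=
    derivative_pow F n
  have dnum (n : ℕ) [n.AtLeastTwo] : d⁄dX ℚ (ofNat(n) : ℚ⟦X⟧) = 0 := by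
    rw [show (ofNat(n) : ℚ⟦X⟧) = C (ofNat(n) : ℚ) from (map_ofNat C n).symm, derivative_C]
  -- The equations for S₀, S₁, S₂ integrate in closed form, each using the previous one. `j₁` and
  -- `j₂` are the terms of order t and t² of Q = exp S.
  have i₀ : 2 * S₀ = U₀ ^ 2 := by
    refine eq_of_derivative_eq _ _ (by simp [cS₀, cU₀]) ?_
    simp only [Derivation.leibniz, smul_eq_mul, dnum, dpow, hS₀]; push_cast; ring
  have i₁ : 6 * S₁ = 6 * U₀ * U₁ + U₀ ^ 3 := by
    refine eq_of_derivative_eq _ _ (by simp [cS₁, cU₀]) ?_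
    simp only [Derivation.leibniz, smul_eq_mul, dnum, dpow, hS₁, map_add]; push_cast
    linear_combination 3 * d⁄dX ℚ U₀ * i₀
  have i₂ : 24 * S₂ = 24 * U₀ * U₂ + 12 * U₁ ^ 2 + 12 * U₀ ^ 2 * U₁ + U₀ ^ 4 := by
    refine eq_of_derivative_eq _ _ (by simp [cS₂, cU₀, cU₁]) ?_
    simp only [Derivation.leibniz, smul_eq_mul, dnum, dpow, hS₂, map_add]; push_cast
    linear_combination 12 * d⁄dX ℚ U₁ * i₀ + 4 * d⁄dX ℚ U₀ * i₁
  have j₁ : Q₁ = S₁ * Q₀ := by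
    refine sub_eq_zero.1 (eq_zero_of_derivative_eq_mul _ (d⁄dX ℚ S₀) (by simp [cQ₁, cS₁]) ?_)
    simp only [map_sub, Derivation.leibniz, smul_eq_mul, hQ₁, hQ₀]; ring
  have j₂ : 2 * Q₂ = Q₀ * (2 * S₂ + S₁ ^ 2) := by
    refine sub_eq_zero.1 (eq_zero_of_derivative_eq_mul _ (d⁄dX ℚ S₀) (by simp [cQ₂, cS₂, cS₁]) ?_)
    simp only [map_sub, map_add, Derivation.leibniz, smul_eq_mul, dnum, dpow, hQ₂, hQ₀]; push_cast
    linear_combination 2 * d⁄dX ℚ S₁ * j₁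
  obtain ⟨I, hI⟩ : ∃ I, (1 - U₀ ^ 2) * I = 1 := by
    have : IsUnit (1 - U₀ ^ 2) := by
      rw [PowerSeries.isUnit_iff_constantCoeff]; simp [cU₀]
    exact this.exists_right_inv
  have hθ : (1 - U₀ ^ 2) * eulerOp U₀ = U₀ := by
    have : d⁄dX ℚ U₀ = Q₀ + X * (d⁄dX ℚ U₀ * U₀ * Q₀) := by
      nth_rewrite 1 [hU₀]
      rw [Derivation.leibniz, hQ₀, hS₀]; simp; ring
    rw [eulerOp]
    linear_combination X * this - (1 + X * U₀ * d⁄dX ℚ U₀) * hU₀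
  have dU : eulerOp U₀ = U₀ * I := by
    linear_combination (-eulerOp U₀) * hI + I * hθ
  have dP : eulerOp Q₀ = Q₀ * U₀ ^ 2 * I := by
    have : eulerOp Q₀ = Q₀ * U₀ * eulerOp U₀ := by
      rw [eulerOp, eulerOp, hQ₀, hS₀]; ring
    rw [this, dU]; ring
  have hU₁' : 2 * U₁ = 2 * U₀ * S₁ + 2 * Q₀ - 2 - U₀ ^ 2 := by
    linear_combination 2 * hU₁ - i₀ + 2 * X * j₁ - 2 * S₁ * hU₀
  -- Eliminating U₁ leaves a linear equation for S₁ with coefficient 1 - U₀², the inverse of `I`.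
  -- The same happens for S₂ after eliminating U₂ and Q₂.
  have hS₁' : 3 * S₁ = U₀ * (3 * Q₀ - 3 - U₀ ^ 2) * I := by
    have : 6 * ((1 - U₀ ^ 2) * S₁) = 2 * (U₀ * (3 * Q₀ - 3 - U₀ ^ 2)) := by
      linear_combination i₁ + 3 * U₀ * hU₁'
    have h2 : (2 : ℚ⟦X⟧) ≠ 0 := fun h => by
      have := congrArg constantCoeff h
      rw [map_ofNat] at this
      norm_num at this
    refine mul_left_cancel₀ h2 ?_
    linear_combination I * this - 6 * S₁ * hI
  have hS₂' : 24 * S₂ = (12 * U₀ ^ 2 * S₁ ^ 2 + 24 * U₀ * S₁ * (Q₀ - 1) + 12 * U₁ ^ 2 +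
      12 * U₀ ^ 2 * U₁ + U₀ ^ 4) * I := by
    linear_combination (-24 * S₂) * hI + I * i₂ + I * 24 * U₀ * (hU₂ + j₁) +
      12 * I * U₀ * X * j₂ - 12 * I * U₀ * (2 * S₂ + S₁ ^ 2) * hU₀
  have h1 : coeff 1 U₀ = 1 := by
    rw [hU₀, show 1 = 0 + 1 from rfl, coeff_succ_X_mul]; simpa using cQ₀
  have key := eulerOp_second_order U₀ Q₀ I hI dU dP S₁ U₁ S₂ Q₂ hS₁' hU₁' hS₂' j₂ _ rfl
  set T : ℕ → ℕ → ℚ := fun b μ =>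
    2 ^ μ * (l.descFactorial μ : ℚ) * (2 * (l : ℚ) + b) ^ ((l : ℤ) - μ) with hT
  have hc (b μ : ℕ) (hb : 1 ≤ b) := coeff_eq_descFactorial U₀ Q₀ I hU₀ h1 hθ hI l b μ hb
  refine closed_formula_aux l hl _ T (fun _ _ => rfl) ?_ k hk
  -- Expanded into the monomials covered by `coeff_eq_descFactorial`. On the coefficient of degree
  -- 2l each θ is multiplication by 2l.
  have key2 : 72 * eulerOp Q₂ =
      12 * (Q₀ ^ 1 * U₀ ^ (2 * 2) * I) + 9 * (Q₀ ^ 1 * U₀ ^ (2 * 3) * I) +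
        Q₀ ^ 1 * U₀ ^ (2 * 4) * I +
      eulerOp (2 * (Q₀ ^ 1 * U₀ ^ (2 * 4) * I) + 3 * (Q₀ ^ 1 * U₀ ^ (2 * 3) * I)
        - 33 * (Q₀ ^ 1 * U₀ ^ (2 * 2) * I) + 36 * (Q₀ ^ 1 * U₀ ^ (2 * 0) * I)
        + 24 * (Q₀ ^ 2 * U₀ ^ (2 * 2) * I) - 72 * (Q₀ ^ 2 * U₀ ^ (2 * 0) * I)
        + 36 * (Q₀ ^ 3 * U₀ ^ (2 * 0) * I)) +
      eulerOp (eulerOp (Q₀ ^ 1 * U₀ ^ (2 * 4) * I - 6 * (Q₀ ^ 1 * U₀ ^ (2 * 3) * I)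
        - 3 * (Q₀ ^ 1 * U₀ ^ (2 * 2) * I) + 36 * (Q₀ ^ 1 * U₀ ^ (2 * 1) * I)
        + 36 * (Q₀ ^ 1 * U₀ ^ (2 * 0) * I) + 12 * (Q₀ ^ 2 * U₀ ^ (2 * 2) * I)
        - 36 * (Q₀ ^ 2 * U₀ ^ (2 * 1) * I) - 72 * (Q₀ ^ 2 * U₀ ^ (2 * 0) * I)
        + 36 * (Q₀ ^ 3 * U₀ ^ (2 * 0) * I))) := by
    rw [key]
    congr 2
    · ring
    · congr 1; ring
    · congr 2; ring
  have hnum (n : ℕ) [n.AtLeastTwo] (F : ℚ⟦X⟧) (m : ℕ) :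
      coeff m (ofNat(n) * F) = (ofNat(n) : ℚ) * coeff m F := by
    rw [show (ofNat(n) : ℚ⟦X⟧) = C (ofNat(n) : ℚ) from (map_ofNat C n).symm, coeff_C_mul]
  have key3 := congrArg (coeff (2 * l)) key2
  simp only [map_add, map_sub, hnum, coeff_eulerOp] at key3
  have c1 (μ : ℕ) := hc 1 μ le_rfl
  have c2 (μ : ℕ) := hc 2 μ (by norm_num)
  have c30 := hc 3 0 (by norm_num)
  have c10 := c1 0
  have c11 := c1 1
  have c12 := c1 2
  have c13 := c1 3
  have c14 := c1 4
  have c20 := c2 0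
  have c21 := c2 1
  have c22 := c2 2
  simp only [hT]
  push_cast at key3
  linear_combination ((2 * l).factorial : ℚ) * key3 + 12 * c12 + 9 * c13 + c14 +
    (2 * l) * (2 * c14 + 3 * c13 - 33 * c12 + 36 * c10 + 24 * c22 - 72 * c20 + 36 * c30) +
    (2 * l) ^ 2 * (c14 - 6 * c13 - 3 * c12 + 36 * c11 + 36 * c10 + 12 * c22 - 36 * c21
      - 72 * c20 + 36 * c30)

end PowerSeriesIdentities

end SeriesParallel

/-! ### Two-terminal networks as combinatorial data. -/

namespace SeriesParallel

/-- The combinatorial data of a two-terminal network with edge set `supp`: the edge sets of the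
paths joining the terminals, the acyclic sets of edges, and the rank. -/
structure Net (β : Type*) where
  supp : Finset β
  path : Finset β → Prop
  ind : Finset β → Prop
  rank : ℕ

namespace Net

variable {β : Type*}

lemma ext' {D E : Net β} (hs : D.supp = E.supp) (hp : ∀ I, D.path I ↔ E.path I)
    (hi : ∀ I, D.ind I ↔ E.ind I) (hr : D.rank = E.rank) : D = E := by
  cases D; cases E
  simp only at hs hp hi hr
  simp only [mk.injEq]
  exact ⟨hs, funext fun I => propext (hp I), funext fun I => propext (hi I), hr⟩

/-- A set of edges connects the terminals. -/
def con (D : Net β) (I : Finset β) : Prop := ∃ P, D.path P ∧ P ⊆ I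

lemma con_mono {D : Net β} {I J : Finset β} (h : D.con I) (hIJ : I ⊆ J) : D.con J := by
  obtain ⟨P, hP, hPI⟩ := h
  exact ⟨P, hP, hPI.trans hIJ⟩

/-- A single edge. -/
def leaf (a : β) : Net β := ⟨{a}, fun P => P = {a}, fun I => I ⊆ {a}, 1⟩

variable [DecidableEq β]

/-- Composition in series. -/
def ser (D E : Net β) : Net β where
  supp := D.supp ∪ E.supp
  path P := P ⊆ D.supp ∪ E.supp ∧ D.path (P ∩ D.supp) ∧ E.path (P ∩ E.supp)
  ind I := I ⊆ D.supp ∪ E.supp ∧ D.ind (I ∩ D.supp) ∧ E.ind (I ∩ E.supp)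
  rank := D.rank + E.rank

/-- Composition in parallel. -/
def par (D E : Net β) : Net β where
  supp := D.supp ∪ E.supp
  path P := D.path P ∨ E.path P
  ind I := I ⊆ D.supp ∪ E.supp ∧ D.ind (I ∩ D.supp) ∧ E.ind (I ∩ E.supp) ∧
    ¬ (D.con (I ∩ D.supp) ∧ E.con (I ∩ E.supp))
  rank := D.rank + E.rank - 1

lemma con_par {D E : Net β} {I : Finset β} :
    (par D E).con I ↔ D.con I ∨ E.con I := by
  constructor
  · rintro ⟨P, hP | hP, hPI⟩
    exacts [Or.inl ⟨P, hP, hPI⟩, Or.inr ⟨P, hP, hPI⟩]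
  · rintro (⟨P, hP, hPI⟩ | ⟨P, hP, hPI⟩)
    exacts [⟨P, Or.inl hP, hPI⟩, ⟨P, Or.inr hP, hPI⟩]

end Net

open Net

/-- Series-parallel networks. -/
inductive IsNet {β : Type*} [DecidableEq β] : Net β → Prop
  | leaf (a : β) : IsNet (Net.leaf a)
  | ser (D E : Net β) (hD : IsNet D) (hE : IsNet E) (h : Disjoint D.supp E.supp) :
      IsNet (Net.ser D E)
  | par (D E : Net β) (hD : IsNet D) (hE : IsNet E) (h : Disjoint D.supp E.supp) :
      IsNet (Net.par D E)

namespace IsNet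

variable {β : Type*} [DecidableEq β] {D E : Net β} {I J P Q : Finset β}

lemma supp_nonempty (hD : IsNet D) : D.supp.Nonempty := by
  induction hD with
  | leaf a => exact Finset.singleton_nonempty a
  | ser D E _ _ _ h _ => exact h.mono Finset.subset_union_left
  | par D E _ _ _ h _ => exact h.mono Finset.subset_union_left

lemma rank_pos (hD : IsNet D) : 1 ≤ D.rank := by
  induction hD with
  | leaf a => exact le_rfl
  | ser D E _ _ _ h1 h2 => simp only [Net.ser]; omega
  | par D E _ _ _ h1 h2 => simp only [Net.par]; omega

lemma path_subset (hD : IsNet D) (hP : D.path P) : P ⊆ D.supp := by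
  induction hD with
  | leaf a => exact (show P = {a} from hP).subset
  | ser D E _ _ _ h1 h2 => exact hP.1
  | par D E _ _ _ h1 h2 =>
    exact hP.elim (fun h => (h1 h).trans Finset.subset_union_left)
      (fun h => (h2 h).trans Finset.subset_union_right)

lemma ind_subset (hD : IsNet D) (hI : D.ind I) : I ⊆ D.supp := by
  cases hD with
  | leaf a => exact hI
  | ser D E => exact hI.1
  | par D E => exact hI.1

lemma con_inter (hD : IsNet D) : D.con (I ∩ D.supp) ↔ D.con I := by
  refine ⟨fun h => con_mono h Finset.inter_subset_left, ?_⟩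
  rintro ⟨P, hP, hPI⟩
  exact ⟨P, hP, Finset.subset_inter hPI (hD.path_subset hP)⟩

lemma con_inter_of_subset (hD : IsNet D) {S : Finset β} (hS : D.supp ⊆ S) :
    D.con (I ∩ S) ↔ D.con I := by
  rw [← hD.con_inter, Finset.inter_assoc, Finset.inter_eq_right.2 hS, hD.con_inter]

lemma ind_mono (hD : IsNet D) (hI : D.ind I) (hJ : J ⊆ I) : D.ind J := by
  induction hD generalizing I J with
  | leaf a => exact hJ.trans hI
  | ser D E _ _ _ h1 h2 =>
    exact ⟨hJ.trans hI.1, h1 hI.2.1 (Finset.inter_subset_inter_right hJ),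
      h2 hI.2.2 (Finset.inter_subset_inter_right hJ)⟩
  | par D E _ _ _ h1 h2 =>
    exact ⟨hJ.trans hI.1, h1 hI.2.1 (Finset.inter_subset_inter_right hJ),
      h2 hI.2.2.1 (Finset.inter_subset_inter_right hJ),
      fun h => hI.2.2.2 ⟨con_mono h.1 (Finset.inter_subset_inter_right hJ),
        con_mono h.2 (Finset.inter_subset_inter_right hJ)⟩⟩

lemma union_inter_left {A B : Finset β} (h : Disjoint A B) (hP : P ⊆ A) (hQ : Q ⊆ B) :
    (P ∪ Q) ∩ A = P := by
  rw [Finset.disjoint_left] at h; ext x; grind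

lemma union_inter_right {A B : Finset β} (h : Disjoint A B) (hP : P ⊆ A) (hQ : Q ⊆ B) :
    (P ∪ Q) ∩ B = Q := by
  rw [Finset.disjoint_left] at h; ext x; grind

lemma ser_path_union (h : Disjoint D.supp E.supp) (hP : P ⊆ D.supp)
    (hQ : Q ⊆ E.supp) : (Net.ser D E).path (P ∪ Q) ↔ D.path P ∧ E.path Q := by
  simp only [Net.ser, union_inter_left h hP hQ, union_inter_right h hP hQ,
    and_iff_right_iff_imp]
  exact fun _ => Finset.union_subset_union hP hQ

/-- No edge is dangling: a path through it in one series factor is completed by any path of the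
other. Hence conditions on paths control whole supports. -/
lemma exists_path_mem (hD : IsNet D) {a : β} (ha : a ∈ D.supp) : ∃ P, D.path P ∧ a ∈ P := by
  induction hD generalizing a with
  | leaf b => exact ⟨{b}, rfl, ha⟩
  | ser D E hD hE h h1 h2 =>
    rcases Finset.mem_union.1 ha with ha | ha
    · obtain ⟨P, hP, haP⟩ := h1 ha
      obtain ⟨b, hb⟩ := hE.supp_nonempty
      obtain ⟨Q, hQ, -⟩ := h2 hb
      exact ⟨P ∪ Q, (ser_path_union h (hD.path_subset hP) (hE.path_subset hQ)).2 ⟨hP, hQ⟩,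
        Finset.mem_union_left _ haP⟩
    · obtain ⟨P, hP, haP⟩ := h2 ha
      obtain ⟨b, hb⟩ := hD.supp_nonempty
      obtain ⟨Q, hQ, -⟩ := h1 hb
      exact ⟨Q ∪ P, (ser_path_union h (hD.path_subset hQ) (hE.path_subset hP)).2 ⟨hQ, hP⟩,
        Finset.mem_union_right _ haP⟩
  | par D E hD hE h h1 h2 =>
    rcases Finset.mem_union.1 ha with ha | ha
    · obtain ⟨P, hP, haP⟩ := h1 ha
      exact ⟨P, Or.inl hP, haP⟩
    · obtain ⟨P, hP, haP⟩ := h2 ha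
      exact ⟨P, Or.inr hP, haP⟩

lemma exists_path (hD : IsNet D) : ∃ P, D.path P := by
  obtain ⟨a, ha⟩ := hD.supp_nonempty
  obtain ⟨P, hP, -⟩ := hD.exists_path_mem ha
  exact ⟨P, hP⟩

lemma path_nonempty (hD : IsNet D) (hP : D.path P) : P.Nonempty := by
  induction hD generalizing P with
  | leaf a => rw [show P = {a} from hP]; exact Finset.singleton_nonempty a
  | ser D E _ _ _ h1 h2 => exact (h1 hP.2.1).mono Finset.inter_subset_left
  | par D E _ _ _ h1 h2 => exact hP.elim h1 h2

lemma not_con_empty (hD : IsNet D) : ¬ D.con ∅ := by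
  rintro ⟨P, hP, h⟩
  exact (hD.path_nonempty hP).ne_empty (Finset.subset_empty.1 h)

lemma con_ser (hD : IsNet D) (hE : IsNet E) (h : Disjoint D.supp E.supp) :
    (Net.ser D E).con I ↔ D.con I ∧ E.con I := by
  constructor
  · rintro ⟨P, hP, hPI⟩
    exact ⟨⟨_, hP.2.1, Finset.inter_subset_left.trans hPI⟩,
      ⟨_, hP.2.2, Finset.inter_subset_left.trans hPI⟩⟩
  · rintro ⟨⟨P, hP, hPI⟩, ⟨Q, hQ, hQI⟩⟩
    exact ⟨P ∪ Q, (ser_path_union h (hD.path_subset hP) (hE.path_subset hQ)).2 ⟨hP, hQ⟩,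
      Finset.union_subset hPI hQI⟩

lemma ind_empty (hD : IsNet D) : D.ind ∅ := by
  induction hD with
  | leaf a => exact Finset.empty_subset _
  | ser D E _ _ _ h1 h2 => exact ⟨Finset.empty_subset _, by simpa, by simpa⟩
  | par D E hD _ _ h1 h2 =>
    exact ⟨Finset.empty_subset _, by simpa, by simpa, by simp [hD.not_con_empty]⟩

lemma ind_ser_iff (hE : IsNet E) (h : Disjoint D.supp E.supp) (hI : I ⊆ D.supp) :
    (Net.ser D E).ind I ↔ D.ind I := by
  have h1 : I ∩ D.supp = I := Finset.inter_eq_left.2 hI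
  have h2 : I ∩ E.supp = ∅ := Finset.disjoint_iff_inter_eq_empty.1 (h.mono_left hI)
  simp only [Net.ser, h1, h2, hE.ind_empty, and_true, and_iff_right_iff_imp]
  exact fun _ => hI.trans Finset.subset_union_left

lemma ind_par_iff (hE : IsNet E) (h : Disjoint D.supp E.supp) (hI : I ⊆ D.supp) :
    (Net.par D E).ind I ↔ D.ind I := by
  have h1 : I ∩ D.supp = I := Finset.inter_eq_left.2 hI
  have h2 : I ∩ E.supp = ∅ := Finset.disjoint_iff_inter_eq_empty.1 (h.mono_left hI)
  simp only [Net.par, h1, h2, hE.ind_empty, hE.not_con_empty, and_true, and_false, not_false_iff,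
    and_iff_right_iff_imp]
  exact fun _ => hI.trans Finset.subset_union_left

lemma ind_of_path (hD : IsNet D) (hP : D.path P) : D.ind P := by
  induction hD generalizing P with
  | leaf a => exact (show P = {a} from hP).subset
  | ser D E _ _ _ h1 h2 => exact ⟨hP.1, h1 hP.2.1, h2 hP.2.2⟩
  | par D E hD hE h h1 h2 =>
    rcases hP with hP | hP
    · exact (ind_par_iff hE h (hD.path_subset hP)).2 (h1 hP)
    · have h3 : P ∩ E.supp = P := Finset.inter_eq_left.2 (hE.path_subset hP)
      have h4 : P ∩ D.supp = ∅ := Finset.disjoint_iff_inter_eq_empty.1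
        (h.symm.mono_left (hE.path_subset hP))
      refine ⟨(hE.path_subset hP).trans Finset.subset_union_right, ?_, ?_, ?_⟩
      · rw [h4]; exact hD.ind_empty
      · rw [h3]; exact h2 hP
      · rw [h4]; exact fun h => hD.not_con_empty h.1

/-- Paths are thus the minimal connecting sets, which is how `IsNet.eq_of_ind_con` recovers them. -/
lemma path_antichain (hD : IsNet D) (hP : D.path P) (hQ : D.path Q) (h : P ⊆ Q) : P = Q := by
  induction hD generalizing P Q with
  | leaf a => exact (show P = {a} from hP).trans (show Q = {a} from hQ).symm
  | ser D E _ _ _ h1 h2 =>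
    have e1 := h1 hP.2.1 hQ.2.1 (Finset.inter_subset_inter_right h)
    have e2 := h2 hP.2.2 hQ.2.2 (Finset.inter_subset_inter_right h)
    rw [← Finset.inter_eq_left.2 hP.1, ← Finset.inter_eq_left.2 hQ.1, Finset.inter_union_distrib_left,
      Finset.inter_union_distrib_left, e1, e2]
  | par D E hD hE hd h1 h2 =>
    rcases hP with hP | hP <;> rcases hQ with hQ | hQ
    · exact h1 hP hQ h
    · obtain ⟨x, hx⟩ := hD.path_nonempty hP
      exact absurd (hE.path_subset hQ (h hx)) (Finset.disjoint_left.1 hd (hD.path_subset hP hx))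
    · obtain ⟨x, hx⟩ := hE.path_nonempty hP
      exact absurd (hE.path_subset hP hx) (Finset.disjoint_left.1 hd (hD.path_subset hQ (h hx)))
    · exact h2 hP hQ h

end IsNet

namespace Net

variable {β : Type*} [DecidableEq β]

lemma ser_comm (D E : Net β) : ser D E = ser E D := by
  apply ext'
  · exact Finset.union_comm _ _
  · intro I; simp only [ser, Finset.union_comm D.supp]; tauto
  · intro I; simp only [ser, Finset.union_comm D.supp]; tauto
  · exact Nat.add_comm _ _

lemma par_comm (D E : Net β) : par D E = par E D := by
  apply ext'
  · exact Finset.union_comm _ _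
  · intro I; simp only [par]; tauto
  · intro I; simp only [par, Finset.union_comm D.supp]; tauto
  · simp only [par, Nat.add_comm]

lemma ser_assoc (A B C : Net β) : ser (ser A B) C = ser A (ser B C) := by
  have e1 (I : Finset β) : I ∩ (A.supp ∪ B.supp) ∩ A.supp = I ∩ A.supp := by ext; grind
  have e2 (I : Finset β) : I ∩ (A.supp ∪ B.supp) ∩ B.supp = I ∩ B.supp := by ext; grind
  have e3 (I : Finset β) : I ∩ (B.supp ∪ C.supp) ∩ B.supp = I ∩ B.supp := by ext; grind
  have e4 (I : Finset β) : I ∩ (B.supp ∪ C.supp) ∩ C.supp = I ∩ C.supp := by ext; grind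
  apply ext'
  · exact Finset.union_assoc _ _ _
  · intro I
    simp only [ser, e1, e2, e3, e4, Finset.inter_subset_right, true_and, Finset.union_assoc,
      and_assoc]
  · intro I
    simp only [ser, e1, e2, e3, e4, Finset.inter_subset_right, true_and, Finset.union_assoc,
      and_assoc]
  · exact Nat.add_assoc _ _ _

/-- Unlike `ser_assoc` this needs genuine networks: ranks must be positive for the truncated
subtraction in `par`, and paths must stay inside the supports. -/
lemma par_assoc {A B C : Net β} (hA : IsNet A) (hB : IsNet B) (hC : IsNet C) :
    par (par A B) C = par A (par B C) := by
  have e1 (I : Finset β) : I ∩ (A.supp ∪ B.supp) ∩ A.supp = I ∩ A.supp := by ext; grind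
  have e2 (I : Finset β) : I ∩ (A.supp ∪ B.supp) ∩ B.supp = I ∩ B.supp := by ext; grind
  have e3 (I : Finset β) : I ∩ (B.supp ∪ C.supp) ∩ B.supp = I ∩ B.supp := by ext; grind
  have e4 (I : Finset β) : I ∩ (B.supp ∪ C.supp) ∩ C.supp = I ∩ C.supp := by ext; grind
  have c1 (I : Finset β) := hA.con_inter_of_subset (I := I) (Finset.subset_union_left (s₂ := B.supp))
  have c2 (I : Finset β) := hB.con_inter_of_subset (I := I) (Finset.subset_union_right (s₁ := A.supp))
  have c3 (I : Finset β) := hB.con_inter_of_subset (I := I) (Finset.subset_union_left (s₂ := C.supp))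
  have c4 (I : Finset β) := hC.con_inter_of_subset (I := I) (Finset.subset_union_right (s₁ := B.supp))
  apply ext'
  · exact Finset.union_assoc _ _ _
  · intro I
    simp only [par, or_assoc]
  · intro I
    have u1 : (par (par A B) C).ind I ↔ I ⊆ A.supp ∪ B.supp ∪ C.supp ∧
        (par A B).ind (I ∩ (A.supp ∪ B.supp)) ∧ C.ind (I ∩ C.supp) ∧
        ¬ ((par A B).con (I ∩ (A.supp ∪ B.supp)) ∧ C.con (I ∩ C.supp)) := Iff.rfl
    have u2 : (par A (par B C)).ind I ↔ I ⊆ A.supp ∪ (B.supp ∪ C.supp) ∧ A.ind (I ∩ A.supp) ∧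
        (par B C).ind (I ∩ (B.supp ∪ C.supp)) ∧
        ¬ (A.con (I ∩ A.supp) ∧ (par B C).con (I ∩ (B.supp ∪ C.supp))) := Iff.rfl
    have u3 : (par A B).ind (I ∩ (A.supp ∪ B.supp)) ↔ A.ind (I ∩ A.supp) ∧ B.ind (I ∩ B.supp) ∧
        ¬ (A.con I ∧ B.con I) := by
      simp only [par, e1, e2, Finset.inter_subset_right, true_and, hA.con_inter, hB.con_inter, c1, c2]
    have u4 : (par B C).ind (I ∩ (B.supp ∪ C.supp)) ↔ B.ind (I ∩ B.supp) ∧ C.ind (I ∩ C.supp) ∧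
        ¬ (B.con I ∧ C.con I) := by
      simp only [par, e3, e4, Finset.inter_subset_right, true_and, hB.con_inter, hC.con_inter, c3, c4]
    rw [u1, u2, u3, u4, con_par, con_par, hA.con_inter, hC.con_inter, c1, c2, c3, c4,
      Finset.union_assoc]
    constructor
    · rintro ⟨h, ⟨a, b, nab⟩, c, nabc⟩
      exact ⟨h, a, ⟨b, c, fun ⟨x, y⟩ => nabc ⟨Or.inr x, y⟩⟩, fun ⟨x, y⟩ =>
        y.elim (fun y => nab ⟨x, y⟩) (fun y => nabc ⟨Or.inl x, y⟩)⟩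
    · rintro ⟨h, a, ⟨b, c, nbc⟩, nabc⟩
      exact ⟨h, ⟨a, b, fun ⟨x, y⟩ => nabc ⟨x, Or.inl y⟩⟩, c, fun ⟨x, y⟩ =>
        x.elim (fun x => nabc ⟨x, Or.inr y⟩) (fun x => nbc ⟨x, y⟩)⟩
  · have := hA.rank_pos; have := hB.rank_pos; have := hC.rank_pos
    simp only [par]; omega

end Net

end SeriesParallel

/-! ### Unique factorization of networks. -/

namespace SeriesParallel

variable {β : Type*} [DecidableEq β]

open Net

/-- Networks that are a composition in series. -/
def IsSer (D : Net β) : Prop :=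
  ∃ A B, IsNet A ∧ IsNet B ∧ Disjoint A.supp B.supp ∧ D = Net.ser A B

/-- Networks that are a composition in parallel. -/
def IsPar (D : Net β) : Prop :=
  ∃ A B, IsNet A ∧ IsNet B ∧ Disjoint A.supp B.supp ∧ D = Net.par A B

lemma IsNet.cases' {D : Net β} (hD : IsNet D) : (∃ a, D = Net.leaf a) ∨ IsSer D ∨ IsPar D := by
  cases hD with
  | leaf a => exact Or.inl ⟨a, rfl⟩
  | ser A B hA hB h => exact Or.inr (Or.inl ⟨A, B, hA, hB, h, rfl⟩)
  | par A B hA hB h => exact Or.inr (Or.inr ⟨A, B, hA, hB, h, rfl⟩)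

lemma two_le_card_union {A B : Net β} (hA : IsNet A) (hB : IsNet B) (h : Disjoint A.supp B.supp) :
    2 ≤ (A.supp ∪ B.supp).card := by
  rw [Finset.card_union_of_disjoint h]
  have := hA.supp_nonempty.card_pos
  have := hB.supp_nonempty.card_pos
  omega

lemma IsSer.two_le_card {D : Net β} (h : IsSer D) : 2 ≤ D.supp.card := by
  obtain ⟨A, B, hA, hB, h, rfl⟩ := h
  exact two_le_card_union hA hB h

lemma IsPar.two_le_card {D : Net β} (h : IsPar D) : 2 ≤ D.supp.card := by
  obtain ⟨A, B, hA, hB, h, rfl⟩ := h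
  exact two_le_card_union hA hB h

lemma not_isSer_leaf (a : β) : ¬ IsSer (Net.leaf a) := fun h => by
  have := h.two_le_card; simp [Net.leaf] at this

lemma not_isPar_leaf (a : β) : ¬ IsPar (Net.leaf a) := fun h => by
  have := h.two_le_card; simp [Net.leaf] at this

/-- A parallel composition whose path family is closed under mixing along `S` does not cross
`S`. -/
lemma subset_or_disjoint_of_mixing {D : Net β} (hD : IsPar D) (S : Finset β)
    (hmix : ∀ P Q, D.path P → D.path Q → D.path (P ∩ S ∪ Q \ S)) :
    D.supp ⊆ S ∨ Disjoint D.supp S := by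
  obtain ⟨A, B, hA, hB, hd, rfl⟩ := hD
  rw [Finset.disjoint_left] at hd
  -- The mix of `P` and `Q` is again a path, hence lies wholly in `A` or wholly in `B`. This rules
  -- out either `Q \ S` or `P ∩ S`, and exchanging the roles of `P` and `Q` gives the rest.
  have key : ∀ P Q, A.path P → B.path Q →
      (P ⊆ S ∧ Q ⊆ S) ∨ (P ∩ S = ∅ ∧ Q ∩ S = ∅) := by
    intro P Q hP hQ
    obtain ⟨x, hx⟩ := hA.path_nonempty hP
    obtain ⟨y, hy⟩ := hB.path_nonempty hQ
    have hPA := hA.path_subset hP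
    have hQB := hB.path_subset hQ
    have m1 : Q ⊆ S ∨ P ∩ S = ∅ := by
      rcases hmix P Q (Or.inl hP) (Or.inr hQ) with h | h
      · left; have := hA.path_subset h; clear hmix; intro z hz; have := hQB hz; grind
      · right; have := hB.path_subset h; clear hmix; ext z; grind
    have m2 : P ⊆ S ∨ Q ∩ S = ∅ := by
      rcases hmix Q P (Or.inr hQ) (Or.inl hP) with h | h
      · right; have := hA.path_subset h; clear hmix; ext z; grind
      · left; have := hB.path_subset h; clear hmix; intro z hz; have := hPA hz; grind
    rcases m1 with m1 | m1 <;> rcases m2 with m2 | m2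
    · exact Or.inl ⟨m2, m1⟩
    · have : y ∈ Q ∩ S := Finset.mem_inter.2 ⟨hy, m1 hy⟩
      simp [m2] at this
    · have : x ∈ P ∩ S := Finset.mem_inter.2 ⟨hx, m2 hx⟩
      simp [m1] at this
    · exact Or.inr ⟨m1, m2⟩
  obtain ⟨P₀, hP₀⟩ := hA.exists_path
  obtain ⟨Q₀, hQ₀⟩ := hB.exists_path
  obtain ⟨x, hx⟩ := hA.path_nonempty hP₀
  obtain ⟨y, hy⟩ := hB.path_nonempty hQ₀
  rcases key P₀ Q₀ hP₀ hQ₀ with ⟨h1, h2⟩ | ⟨h1, h2⟩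
  · left
    intro z hz
    rcases Finset.mem_union.1 hz with hz | hz
    · obtain ⟨P, hP, hzP⟩ := hA.exists_path_mem hz
      rcases key P Q₀ hP hQ₀ with ⟨h3, -⟩ | ⟨-, h3⟩
      · exact h3 hzP
      · have : y ∈ Q₀ ∩ S := Finset.mem_inter.2 ⟨hy, h2 hy⟩
        simp [h3] at this
    · obtain ⟨P, hP, hzP⟩ := hB.exists_path_mem hz
      rcases key P₀ P hP₀ hP with ⟨-, h3⟩ | ⟨h3, -⟩
      · exact h3 hzP
      · have : x ∈ P₀ ∩ S := Finset.mem_inter.2 ⟨hx, h1 hx⟩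
        simp [h3] at this
  · right
    rw [Finset.disjoint_left]
    intro z hz hzS
    rcases Finset.mem_union.1 hz with hz | hz
    · obtain ⟨P, hP, hzP⟩ := hA.exists_path_mem hz
      rcases key P Q₀ hP hQ₀ with ⟨-, h3⟩ | ⟨h3, -⟩
      · have : y ∈ Q₀ ∩ S := Finset.mem_inter.2 ⟨hy, h3 hy⟩
        simp [h2] at this
      · have : z ∈ P ∩ S := Finset.mem_inter.2 ⟨hzP, hzS⟩
        simp [h3] at this
    · obtain ⟨P, hP, hzP⟩ := hB.exists_path_mem hz
      rcases key P₀ P hP₀ hP with ⟨h3, -⟩ | ⟨-, h3⟩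
      · have : x ∈ P₀ ∩ S := Finset.mem_inter.2 ⟨hx, h3 hx⟩
        simp [h1] at this
      · have : z ∈ P ∩ S := Finset.mem_inter.2 ⟨hzP, hzS⟩
        simp [h3] at this

/-- A series composition none of whose paths crosses `S` does not cross `S`. -/
lemma subset_or_disjoint_of_paths {D : Net β} (hD : IsSer D) (S : Finset β)
    (h : ∀ P, D.path P → P ⊆ S ∨ Disjoint P S) : D.supp ⊆ S ∨ Disjoint D.supp S := by
  obtain ⟨A, B, hA, hB, hd, rfl⟩ := hD
  have key : ∀ P Q, A.path P → B.path Q → P ∪ Q ⊆ S ∨ Disjoint (P ∪ Q) S := fun P Q hP hQ =>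
    h _ ((IsNet.ser_path_union hd (hA.path_subset hP) (hB.path_subset hQ)).2 ⟨hP, hQ⟩)
  obtain ⟨P₀, hP₀⟩ := hA.exists_path
  obtain ⟨Q₀, hQ₀⟩ := hB.exists_path
  obtain ⟨x, hx⟩ := hA.path_nonempty hP₀
  obtain ⟨y, hy⟩ := hB.path_nonempty hQ₀
  have k0 := key P₀ Q₀ hP₀ hQ₀
  simp only [Finset.disjoint_left, Finset.subset_iff] at *
  -- Replacing the `A`-half of a path while keeping `Q₀` cannot change the side of `S` on which the
  -- path lies, since `y ∈ Q₀` stays in it.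
  have h1 : ∀ z ∈ A.supp, (z ∈ S ↔ y ∈ S) := by
    intro z hz
    obtain ⟨P, hP, hzP⟩ := hA.exists_path_mem hz
    have := key P Q₀ hP hQ₀
    grind
  have h2 : ∀ z ∈ B.supp, (z ∈ S ↔ x ∈ S) := by
    intro z hz
    obtain ⟨P, hP, hzP⟩ := hB.exists_path_mem hz
    have := key P₀ P hP₀ hP
    grind
  have h3 := hA.path_subset hP₀ hx
  have h4 := h1 x h3
  simp only [Net.ser, Finset.mem_union]
  by_cases hy : y ∈ S
  · left; rintro z (hz | hz)
    · exact (h1 z hz).2 hy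
    · exact (h2 z hz).2 (h4.2 hy)
  · right; rintro z (hz | hz)
    · exact fun h => hy ((h1 z hz).1 h)
    · exact fun h => hy (h4.1 ((h2 z hz).1 h))

/-- The rank of a network is determined by the independent sets. -/
lemma IsNet.rank_spec {D : Net β} (hD : IsNet D) :
    (∃ I, D.ind I ∧ D.con I ∧ I.card = D.rank) ∧
    (∃ I, D.ind I ∧ ¬ D.con I ∧ I.card + 1 = D.rank) ∧
    (∀ I, D.ind I → I.card ≤ D.rank) ∧ (∀ I, D.ind I → ¬ D.con I → I.card + 1 ≤ D.rank) := by
  induction hD with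
  | leaf a =>
    refine ⟨⟨{a}, subset_rfl, ⟨{a}, rfl, subset_rfl⟩, by simp [Net.leaf]⟩,
      ⟨∅, Finset.empty_subset _, (IsNet.leaf a).not_con_empty, by simp [Net.leaf]⟩, ?_, ?_⟩
    · intro I hI; simpa [Net.leaf] using Finset.card_le_card (show I ⊆ {a} from hI)
    · intro I hI hc
      rcases Finset.subset_singleton_iff.1 (show I ⊆ {a} from hI) with rfl | rfl
      · simp [Net.leaf]
      · exact absurd ⟨{a}, rfl, subset_rfl⟩ hc
  | ser A B hA hB hd h1 h2 =>
    obtain ⟨⟨I₁, i1, c1, r1⟩, ⟨J₁, j1, d1, s1⟩, m1, n1⟩ := h1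
    obtain ⟨⟨I₂, i2, c2, r2⟩, ⟨J₂, j2, d2, s2⟩, m2, n2⟩ := h2
    have build (I J : Finset β) (hI : A.ind I) (hJ : B.ind J) : (Net.ser A B).ind (I ∪ J) ∧
        ((Net.ser A B).con (I ∪ J) ↔ A.con I ∧ B.con J) ∧ (I ∪ J).card = I.card + J.card := by
      have hI' := hA.ind_subset hI
      have hJ' := hB.ind_subset hJ
      have e1 := IsNet.union_inter_left hd hI' hJ'
      have e2 := IsNet.union_inter_right hd hI' hJ'
      refine ⟨⟨Finset.union_subset_union hI' hJ', by rwa [e1], by rwa [e2]⟩, ?_,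
        Finset.card_union_of_disjoint (Finset.disjoint_of_subset_left hI'
          (Finset.disjoint_of_subset_right hJ' hd))⟩
      rw [hA.con_ser hB hd, ← hA.con_inter, ← hB.con_inter, e1, e2]
    have split (I : Finset β) (hI : (Net.ser A B).ind I) :
        I.card = (I ∩ A.supp).card + (I ∩ B.supp).card := by
      rw [← Finset.card_union_of_disjoint (Finset.disjoint_of_subset_left Finset.inter_subset_right
          (Finset.disjoint_of_subset_right Finset.inter_subset_right hd)),
        ← Finset.inter_union_distrib_left, Finset.inter_eq_left.2 hI.1]
    refine ⟨?_, ?_, ?_, ?_⟩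
    · obtain ⟨b1, b2, b3⟩ := build I₁ I₂ i1 i2
      exact ⟨_, b1, b2.2 ⟨c1, c2⟩, by rw [b3, r1, r2]; rfl⟩
    · obtain ⟨b1, b2, b3⟩ := build I₁ J₂ i1 j2
      exact ⟨_, b1, fun h => d2 (b2.1 h).2, by rw [b3, r1, add_assoc, s2]; rfl⟩
    · intro I hI
      rw [split I hI]
      exact add_le_add (m1 _ hI.2.1) (m2 _ hI.2.2)
    · intro I hI hc
      rw [split I hI]
      rw [hA.con_ser hB hd, ← hA.con_inter, ← hB.con_inter, not_and_or] at hc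
      have := m1 _ hI.2.1
      have := m2 _ hI.2.2
      change _ ≤ A.rank + B.rank
      rcases hc with hc | hc
      · have := n1 _ hI.2.1 hc; omega
      · have := n2 _ hI.2.2 hc; omega
  | par A B hA hB hd h1 h2 =>
    obtain ⟨⟨I₁, i1, c1, r1⟩, ⟨J₁, j1, d1, s1⟩, m1, n1⟩ := h1
    obtain ⟨⟨I₂, i2, c2, r2⟩, ⟨J₂, j2, d2, s2⟩, m2, n2⟩ := h2
    have build (I J : Finset β) (hI : A.ind I) (hJ : B.ind J) (hn : ¬ B.con J) :
        (Net.par A B).ind (I ∪ J) ∧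
        ((Net.par A B).con (I ∪ J) ↔ A.con I) ∧ (I ∪ J).card = I.card + J.card := by
      have hI' := hA.ind_subset hI
      have hJ' := hB.ind_subset hJ
      have e1 := IsNet.union_inter_left hd hI' hJ'
      have e2 := IsNet.union_inter_right hd hI' hJ'
      refine ⟨⟨Finset.union_subset_union hI' hJ', by rwa [e1], by rwa [e2], ?_⟩, ?_,
        Finset.card_union_of_disjoint (Finset.disjoint_of_subset_left hI'
          (Finset.disjoint_of_subset_right hJ' hd))⟩
      · rw [e2]; exact fun h => hn h.2
      · rw [con_par, ← hA.con_inter, ← hB.con_inter, e1, e2]; simp [hn]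
    have split (I : Finset β) (hI : (Net.par A B).ind I) :
        I.card = (I ∩ A.supp).card + (I ∩ B.supp).card := by
      rw [← Finset.card_union_of_disjoint (Finset.disjoint_of_subset_left Finset.inter_subset_right
          (Finset.disjoint_of_subset_right Finset.inter_subset_right hd)),
        ← Finset.inter_union_distrib_left, Finset.inter_eq_left.2 hI.1]
    -- At most one factor may join the terminals, so the other contributes one element less than its
    -- rank. This accounts for the -1.
    have e : (Net.par A B).rank = A.rank + B.rank - 1 := rfl
    have := hA.rank_pos
    have := hB.rank_pos
    refine ⟨?_, ?_, ?_, ?_⟩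
    · obtain ⟨b1, b2, b3⟩ := build I₁ J₂ i1 j2 d2
      exact ⟨_, b1, b2.2 c1, by omega⟩
    · obtain ⟨b1, b2, b3⟩ := build J₁ J₂ j1 j2 d2
      exact ⟨_, b1, fun h => d1 (b2.1 h), by omega⟩
    · intro I hI
      rw [split I hI]
      have := m1 _ hI.2.1
      have := m2 _ hI.2.2.1
      rcases not_and_or.1 hI.2.2.2 with hc | hc
      · have := n1 _ hI.2.1 hc; omega
      · have := n2 _ hI.2.2.1 hc; omega
    · intro I hI hc
      rw [split I hI]
      rw [con_par, ← hA.con_inter, ← hB.con_inter, not_or] at hc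
      have := n1 _ hI.2.1 hc.1
      have := n2 _ hI.2.2.1 hc.2
      omega

lemma IsNet.rank_eq {D E : Net β} (hD : IsNet D) (hE : IsNet E) (h : ∀ I, D.ind I ↔ E.ind I) :
    D.rank = E.rank := by
  obtain ⟨⟨I, hI, -, rI⟩, -, mD, -⟩ := hD.rank_spec
  obtain ⟨⟨J, hJ, -, rJ⟩, -, mE, -⟩ := hE.rank_spec
  exact le_antisymm (rI ▸ mE I ((h I).1 hI)) (rJ ▸ mD J ((h J).2 hJ))

/-- A network is determined by its independent sets and by which of them connect the
terminals. -/
lemma IsNet.eq_of_ind_con {D E : Net β} (hD : IsNet D) (hE : IsNet E) (hs : D.supp = E.supp)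
    (h : ∀ I, D.ind I ↔ E.ind I) (hc : ∀ I, D.ind I → (D.con I ↔ E.con I)) : D = E := by
  -- Below a path P of D lies a path Q of E, and below Q a path R of D. The antichain property gives
  -- R = P, hence Q = P.
  have aux {D E : Net β} (hD : IsNet D) (hE : IsNet E) (h : ∀ I, D.ind I ↔ E.ind I)
      (hc : ∀ I, D.ind I → (D.con I ↔ E.con I)) (P : Finset β) (hP : D.path P) : E.path P := by
    have hPi := hD.ind_of_path hP
    obtain ⟨Q, hQ, hQP⟩ := (hc P hPi).1 ⟨P, hP, subset_rfl⟩
    obtain ⟨R, hR, hRQ⟩ := (hc Q (hD.ind_mono hPi hQP)).2 ⟨Q, hQ, subset_rfl⟩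
    have := hD.path_antichain hR hP (hRQ.trans hQP)
    subst this
    rwa [hRQ.antisymm hQP]
  refine ext' hs (fun P => ⟨aux hD hE h hc P, aux hE hD (fun I => (h I).symm) (fun I hI => ?_) P⟩) h
    (hD.rank_eq hE h)
  exact (hc I ((h I).2 hI)).symm

lemma supp_right_eq {A B A' B' : Finset β} (hd : Disjoint A B) (hd' : Disjoint A' B')
    (h : A ∪ B = A' ∪ B') (hA : A = A') : B = B' := by
  subst hA
  rw [Finset.disjoint_left] at hd hd'
  ext x
  have := Finset.ext_iff.1 h x
  grind

/-- Cancellation in a series composition. -/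
lemma ser_left_cancel {A B A' B' : Net β} (hA : IsNet A) (hB : IsNet B) (hA' : IsNet A')
    (hB' : IsNet B') (hd : Disjoint A.supp B.supp) (hd' : Disjoint A'.supp B'.supp)
    (h : Net.ser A B = Net.ser A' B') (hs : A.supp = A'.supp) : A = A' ∧ B = B' := by
  have aux {A B A' B' : Net β} (hA : IsNet A) (hB : IsNet B) (hA' : IsNet A')
      (hB' : IsNet B') (hd : Disjoint A.supp B.supp) (hd' : Disjoint A'.supp B'.supp)
      (h : Net.ser A B = Net.ser A' B') (hs : A.supp = A'.supp) : A = A' := by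
    have hs2 : B.supp = B'.supp := supp_right_eq hd hd' (congrArg Net.supp h) hs
    obtain ⟨R, hR⟩ := hB.exists_path
    have hi : ∀ I, A.ind I ↔ A'.ind I := by
      intro I
      by_cases hI : I ⊆ A.supp
      · rw [← hB.ind_ser_iff hd hI, h, hB'.ind_ser_iff hd' (hs ▸ hI)]
      · exact ⟨fun h => absurd (hA.ind_subset h) hI,
          fun h => absurd (hs ▸ hA'.ind_subset h) hI⟩
    obtain ⟨P₀, hP₀⟩ := hA.exists_path
    have hR' : B'.path R := by
      have : (Net.ser A B).path (P₀ ∪ R) := (IsNet.ser_path_union hd (hA.path_subset hP₀)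
        (hB.path_subset hR)).2 ⟨hP₀, hR⟩
      rw [h] at this
      exact ((IsNet.ser_path_union hd' (hs ▸ hA.path_subset hP₀)
        (hs2 ▸ hB.path_subset hR)).1 this).2
    refine ext' hs (fun P => ?_) hi (hA.rank_eq hA' hi)
    -- With the path `R` of the second factor fixed, P is a path of the first factor exactly when P
    -- ∪ R is a path of the composite.
    by_cases hP : P ⊆ A.supp
    · have e1 := IsNet.ser_path_union hd hP (hB.path_subset hR)
      have e2 := IsNet.ser_path_union hd' (hs ▸ hP) (hB'.path_subset hR')
      rw [h, e2] at e1
      tauto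
    · exact ⟨fun h => absurd (hA.path_subset h) hP,
          fun h => absurd (hs ▸ hA'.path_subset h) hP⟩
  refine ⟨aux hA hB hA' hB' hd hd' h hs, aux hB hA hB' hA' hd.symm hd'.symm ?_ ?_⟩
  · rwa [ser_comm, ser_comm B']
  · exact supp_right_eq hd hd' (congrArg Net.supp h) hs

/-- Cancellation in a parallel composition. -/
lemma par_left_cancel {A B A' B' : Net β} (hA : IsNet A) (hB : IsNet B) (hA' : IsNet A')
    (hB' : IsNet B') (hd : Disjoint A.supp B.supp) (hd' : Disjoint A'.supp B'.supp)
    (h : Net.par A B = Net.par A' B') (hs : A.supp = A'.supp) : A = A' ∧ B = B' := by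
  have aux {A B A' B' : Net β} (hA : IsNet A) (hB : IsNet B) (hA' : IsNet A')
      (hB' : IsNet B') (hd : Disjoint A.supp B.supp) (hd' : Disjoint A'.supp B'.supp)
      (h : Net.par A B = Net.par A' B') (hs : A.supp = A'.supp) : A = A' := by
    have hi : ∀ I, A.ind I ↔ A'.ind I := by
      intro I
      by_cases hI : I ⊆ A.supp
      · rw [← hB.ind_par_iff hd hI, h, hB'.ind_par_iff hd' (hs ▸ hI)]
      · exact ⟨fun h => absurd (hA.ind_subset h) hI,
          fun h => absurd (hs ▸ hA'.ind_subset h) hI⟩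
    have hp {A B : Net β} (hA : IsNet A) (hB : IsNet B) (hd : Disjoint A.supp B.supp)
        (P : Finset β) : A.path P ↔ (Net.par A B).path P ∧ P ⊆ A.supp := by
      refine ⟨fun h => ⟨Or.inl h, hA.path_subset h⟩, ?_⟩
      rintro ⟨h | h, hP⟩
      · exact h
      · obtain ⟨x, hx⟩ := hB.path_nonempty h
        exact absurd (hB.path_subset h hx) (Finset.disjoint_left.1 hd (hP hx))
    refine ext' hs (fun P => ?_) hi (hA.rank_eq hA' hi)
    rw [hp hA hB hd, hp hA' hB' hd', h, hs]
  refine ⟨aux hA hB hA' hB' hd hd' h hs, aux hB hA hB' hA' hd.symm hd'.symm ?_ ?_⟩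
  · rwa [par_comm, par_comm B']
  · exact supp_right_eq hd hd' (congrArg Net.supp h) hs

/-- Exchanging the `B'`-parts of two paths `P ∪ R` and `Q ∪ R` looks on `A` like mixing `P` and `Q`
along `A'`. This produces the hypothesis of `subset_or_disjoint_of_mixing` in `ser_unique`. -/
lemma mix_inter {P Q R A B A' B' : Finset β} (hP : P ⊆ A) (hQ : Q ⊆ A) (hR : R ⊆ B)
    (hd : Disjoint A B) (hd' : Disjoint A' B') (hu : A ∪ B = A' ∪ B') :
    ((P ∪ R) ∩ A' ∪ (Q ∪ R) ∩ B') ∩ A = P ∩ A' ∪ Q \ A' := by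
  rw [Finset.disjoint_left] at hd hd'
  ext x
  have h1 := @hP x
  have h2 := @hQ x
  have h3 := @hR x
  have h4 := @hd x
  have h5 := @hd' x
  have h6 := Finset.ext_iff.1 hu x
  clear hP hQ hR hd hd' hu
  grind

/-- Uniqueness of the series-irreducible factor containing a given element. -/
lemma ser_unique {A B A' B' : Net β} (hA : IsNet A) (hB : IsNet B) (hA' : IsNet A')
    (hB' : IsNet B') (hd : Disjoint A.supp B.supp) (hd' : Disjoint A'.supp B'.supp)
    (h : Net.ser A B = Net.ser A' B') (iA : ¬ IsSer A) (iA' : ¬ IsSer A') {a : β} (ha : a ∈ A.supp)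
    (ha' : a ∈ A'.supp) : A = A' ∧ B = B' := by
  have aux {A B A' B' : Net β} (hA : IsNet A) (hB : IsNet B)
      (hd : Disjoint A.supp B.supp) (hd' : Disjoint A'.supp B'.supp)
      (h : Net.ser A B = Net.ser A' B') (iA : ¬ IsSer A) (ha : a ∈ A.supp)
      (ha' : a ∈ A'.supp) : A.supp ⊆ A'.supp := by
    rcases hA.cases' with ⟨b, rfl⟩ | hs | hp
    · rw [Net.leaf, Finset.mem_singleton] at ha
      subst ha
      simpa [Net.leaf] using ha'
    · exact absurd hs iA
    · refine (subset_or_disjoint_of_mixing hp A'.supp ?_).resolve_right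
        fun hh => Finset.disjoint_left.1 hh ha ha'
      intro P Q hP hQ
      obtain ⟨R, hR⟩ := hB.exists_path
      have hPA := hA.path_subset hP
      have hQA := hA.path_subset hQ
      have hRB := hB.path_subset hR
      have h1 : (Net.ser A' B').path (P ∪ R) := h ▸ (IsNet.ser_path_union hd hPA hRB).2 ⟨hP, hR⟩
      have h2 : (Net.ser A' B').path (Q ∪ R) := h ▸ (IsNet.ser_path_union hd hQA hRB).2 ⟨hQ, hR⟩
      -- In the second factorization the two halves of a path are chosen independently, so the first
      -- half of one path and the second half of the other form a path again.
      have h3 : (Net.ser A' B').path ((P ∪ R) ∩ A'.supp ∪ (Q ∪ R) ∩ B'.supp) :=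
        (IsNet.ser_path_union hd' Finset.inter_subset_right Finset.inter_subset_right).2
          ⟨h1.2.1, h2.2.2⟩
      rw [← h] at h3
      have h4 := h3.2.1
      have hu : A.supp ∪ B.supp = A'.supp ∪ B'.supp := congrArg Net.supp h
      have : ((P ∪ R) ∩ A'.supp ∪ (Q ∪ R) ∩ B'.supp) ∩ A.supp = P ∩ A'.supp ∪ Q \ A'.supp :=
        mix_inter hPA hQA hRB hd hd' hu
      rwa [this] at h4
  exact ser_left_cancel hA hB hA' hB' hd hd' h
    ((aux hA hB hd hd' h iA ha ha').antisymm (aux hA' hB' hd' hd h.symm iA' ha' ha))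

/-- Uniqueness of the parallel-irreducible factor containing a given element. -/
lemma par_unique {A B A' B' : Net β} (hA : IsNet A) (hB : IsNet B) (hA' : IsNet A')
    (hB' : IsNet B') (hd : Disjoint A.supp B.supp) (hd' : Disjoint A'.supp B'.supp)
    (h : Net.par A B = Net.par A' B') (iA : ¬ IsPar A) (iA' : ¬ IsPar A') {a : β} (ha : a ∈ A.supp)
    (ha' : a ∈ A'.supp) : A = A' ∧ B = B' := by
  have aux {A B A' B' : Net β} (hA : IsNet A) (hA' : IsNet A') (hB' : IsNet B')
      (hd' : Disjoint A'.supp B'.supp)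
      (h : Net.par A B = Net.par A' B') (iA : ¬ IsPar A) (ha : a ∈ A.supp)
      (ha' : a ∈ A'.supp) : A.supp ⊆ A'.supp := by
    rcases hA.cases' with ⟨b, rfl⟩ | hs | hp
    · rw [Net.leaf, Finset.mem_singleton] at ha
      subst ha
      simpa [Net.leaf] using ha'
    -- Every path of `A` is a path of `A'` or of `B'`, so none crosses the support of `A'`, and a
    -- series composition then does not cross it either.
    · refine (subset_or_disjoint_of_paths hs A'.supp ?_).resolve_right
        fun hh => Finset.disjoint_left.1 hh ha ha'
      intro P hP
      have : (Net.par A B).path P := Or.inl hP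
      rw [h] at this
      rcases this with h1 | h1
      · exact Or.inl (hA'.path_subset h1)
      · exact Or.inr (hd'.symm.mono_left (hB'.path_subset h1))
    · exact absurd hp iA
  exact par_left_cancel hA hB hA' hB' hd hd' h
    ((aux hA hA' hB' hd' h iA ha ha').antisymm (aux hA' hA hB hd h.symm iA' ha' ha))

/-- The paths of a series composition are closed under mixing along the support of its first factor,
whereas a parallel composition with this closure lies entirely on one side of that support. -/
lemma IsSer.not_isPar {D : Net β} (hs : IsSer D) : ¬ IsPar D := by
  intro hp
  obtain ⟨A, B, hA, hB, hd, rfl⟩ := hs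
  rcases subset_or_disjoint_of_mixing hp A.supp (fun P Q hP hQ => by
    have h1 : Q \ A.supp ⊆ B.supp := by
      intro x hx
      rw [Finset.mem_sdiff] at hx
      exact (Finset.mem_union.1 (hQ.1 hx.1)).resolve_left hx.2
    have h2 : Q \ A.supp = Q ∩ B.supp := by
      rw [Finset.disjoint_left] at hd
      ext x
      have := @h1 x
      have := @hd x
      simp only [Finset.mem_inter, Finset.mem_sdiff] at *
      tauto
    rw [h2]
    exact (IsNet.ser_path_union hd Finset.inter_subset_right Finset.inter_subset_right).2
      ⟨hP.2.1, hQ.2.2⟩) with h | h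
  · obtain ⟨b, hb⟩ := hB.supp_nonempty
    exact Finset.disjoint_left.1 hd (h (Finset.mem_union_right _ hb)) hb
  · obtain ⟨a, ha⟩ := hA.supp_nonempty
    exact Finset.disjoint_left.1 h (Finset.mem_union_left _ ha) ha

/-- Reassociation brings the irreducible factor containing `a` to the front. With `ser_unique` this
makes the factorization canonical once `a` is marked. -/
lemma IsNet.exists_ser_factor {D : Net β} (hD : IsNet D) {a : β} (ha : a ∈ D.supp) :
    ∃ A, IsNet A ∧ ¬ IsSer A ∧ a ∈ A.supp ∧
      (D = A ∨ ∃ B, IsNet B ∧ Disjoint A.supp B.supp ∧ D = Net.ser A B) := by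
  induction hD generalizing a with
  | leaf b => exact ⟨_, .leaf b, not_isSer_leaf b, ha, Or.inl rfl⟩
  | par A B hA hB hd _ _ =>
    exact ⟨_, .par A B hA hB hd, fun h => h.not_isPar ⟨A, B, hA, hB, hd, rfl⟩, ha, Or.inl rfl⟩
  | ser A B hA hB hd h1 h2 =>
    have main {A B : Net β} (hB : IsNet B) (hd : Disjoint A.supp B.supp)
        (h1 : ∃ C, IsNet C ∧ ¬ IsSer C ∧ a ∈ C.supp ∧
          (A = C ∨ ∃ B, IsNet B ∧ Disjoint C.supp B.supp ∧ A = Net.ser C B)) :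
        ∃ C, IsNet C ∧ ¬ IsSer C ∧ a ∈ C.supp ∧
          (Net.ser A B = C ∨ ∃ B', IsNet B' ∧ Disjoint C.supp B'.supp ∧ Net.ser A B = Net.ser C B') := by
      obtain ⟨C, hC, iC, haC, rfl | ⟨E, hE, hCE, rfl⟩⟩ := h1
      · exact ⟨_, hC, iC, haC, Or.inr ⟨B, hB, hd, rfl⟩⟩
      · have hd' := Finset.disjoint_union_left.1 hd
        exact ⟨C, hC, iC, haC, Or.inr ⟨Net.ser E B, .ser E B hE hB hd'.2,
          Finset.disjoint_union_right.2 ⟨hCE, hd'.1⟩, ser_assoc _ _ _⟩⟩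
    rcases Finset.mem_union.1 ha with ha | ha
    · exact main hB hd (h1 ha)
    · rw [ser_comm]
      exact main hA hd.symm (h2 ha)

lemma IsNet.exists_par_factor {D : Net β} (hD : IsNet D) {a : β} (ha : a ∈ D.supp) :
    ∃ A, IsNet A ∧ ¬ IsPar A ∧ a ∈ A.supp ∧
      (D = A ∨ ∃ B, IsNet B ∧ Disjoint A.supp B.supp ∧ D = Net.par A B) := by
  induction hD generalizing a with
  | leaf b => exact ⟨_, .leaf b, not_isPar_leaf b, ha, Or.inl rfl⟩
  | ser A B hA hB hd _ _ =>
    exact ⟨_, .ser A B hA hB hd, IsSer.not_isPar ⟨A, B, hA, hB, hd, rfl⟩, ha, Or.inl rfl⟩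
  | par A B hA hB hd h1 h2 =>
    have main {A B : Net β} (hB : IsNet B) (hd : Disjoint A.supp B.supp)
        (h1 : ∃ C, IsNet C ∧ ¬ IsPar C ∧ a ∈ C.supp ∧
          (A = C ∨ ∃ B, IsNet B ∧ Disjoint C.supp B.supp ∧ A = Net.par C B)) :
        ∃ C, IsNet C ∧ ¬ IsPar C ∧ a ∈ C.supp ∧
          (Net.par A B = C ∨ ∃ B', IsNet B' ∧ Disjoint C.supp B'.supp ∧ Net.par A B = Net.par C B') := by
      obtain ⟨C, hC, iC, haC, rfl | ⟨E, hE, hCE, rfl⟩⟩ := h1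
      · exact ⟨_, hC, iC, haC, Or.inr ⟨B, hB, hd, rfl⟩⟩
      · have hd' := Finset.disjoint_union_left.1 hd
        exact ⟨C, hC, iC, haC, Or.inr ⟨Net.par E B, .par E B hE hB hd'.2,
          Finset.disjoint_union_right.2 ⟨hCE, hd'.1⟩, par_assoc hC hE hB⟩⟩
    rcases Finset.mem_union.1 ha with ha | ha
    · exact main hB hd (h1 ha)
    · rw [par_comm]
      exact main hA hd.symm (h2 ha)

end SeriesParallel

/-! ### Simple networks and recursions for their generating polynomials. -/

namespace SeriesParallel

variable {β : Type*}

open Net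

/-- The network has an edge joining its terminals. -/
def HasEdge (D : Net β) : Prop := ∃ a, D.path {a}

lemma hasEdge_leaf (a : β) : HasEdge (Net.leaf a) := ⟨a, rfl⟩

variable [DecidableEq β]

/-- No two edges of the network are parallel. -/
def IsSimpleNet (D : Net β) : Prop := ∀ e ∈ D.supp, ∀ f ∈ D.supp, D.ind {e, f}

lemma IsSimpleNet.ind_of_subset {D : Net β} (hD : IsNet D) (h : IsSimpleNet D) {J : Finset β}
    (hJ : J ⊆ D.supp) {e f : β} (hef : J ⊆ {e, f}) : D.ind J := by
  by_cases he : e ∈ J <;> by_cases hf : f ∈ J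
  · exact hD.ind_mono (h e (hJ he) f (hJ hf)) hef
  · exact hD.ind_mono (h e (hJ he) e (hJ he)) (fun x hx => by have := hef hx; grind)
  · exact hD.ind_mono (h f (hJ hf) f (hJ hf)) (fun x hx => by have := hef hx; grind)
  · have : J = ∅ := Finset.eq_empty_of_forall_notMem fun x hx => by have := hef hx; grind
    exact this ▸ hD.ind_empty

lemma isSimpleNet_leaf (a : β) : IsSimpleNet (Net.leaf a) := by
  intro e he f hf
  simp only [Net.leaf, Finset.mem_singleton] at he hf
  subst he hf
  simp [Net.leaf]

lemma isSimpleNet_ser {A B : Net β} (hA : IsNet A) (hB : IsNet B) (hd : Disjoint A.supp B.supp) :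
    IsSimpleNet (Net.ser A B) ↔ IsSimpleNet A ∧ IsSimpleNet B := by
  constructor
  · refine fun h => ⟨fun e he f hf => ?_, fun e he f hf => ?_⟩
    · exact (hB.ind_ser_iff hd (by grind)).1
        (h e (Finset.mem_union_left _ he) f (Finset.mem_union_left _ hf))
    · refine (hA.ind_ser_iff hd.symm (by grind)).1 ?_
      rw [ser_comm]
      exact h e (Finset.mem_union_right _ he) f (Finset.mem_union_right _ hf)
  · rintro ⟨h1, h2⟩ e he f hf
    refine ⟨?_, h1.ind_of_subset hA Finset.inter_subset_right Finset.inter_subset_left,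
      h2.ind_of_subset hB Finset.inter_subset_right Finset.inter_subset_left⟩
    exact Finset.insert_subset he (Finset.singleton_subset_iff.2 hf)

/-- A dependent pair not already dependent in one factor contains a path of each factor, so both
paths are single edges joining the terminals. -/
lemma isSimpleNet_par {A B : Net β} (hA : IsNet A) (hB : IsNet B) (hd : Disjoint A.supp B.supp) :
    IsSimpleNet (Net.par A B) ↔ IsSimpleNet A ∧ IsSimpleNet B ∧ ¬ (HasEdge A ∧ HasEdge B) := by
  constructor
  · refine fun h => ⟨fun e he f hf => ?_, fun e he f hf => ?_, ?_⟩
    · exact (hB.ind_par_iff hd (by grind)).1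
        (h e (Finset.mem_union_left _ he) f (Finset.mem_union_left _ hf))
    · refine (hA.ind_par_iff hd.symm (by grind)).1 ?_
      rw [par_comm]
      exact h e (Finset.mem_union_right _ he) f (Finset.mem_union_right _ hf)
    · rintro ⟨⟨a, ha⟩, ⟨b, hb⟩⟩
      have ha' := hA.path_subset ha (Finset.mem_singleton_self a)
      have hb' := hB.path_subset hb (Finset.mem_singleton_self b)
      exact (h a (Finset.mem_union_left _ ha') b (Finset.mem_union_right _ hb')).2.2.2
        ⟨⟨{a}, ha, by grind⟩, ⟨{b}, hb, by grind⟩⟩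
  · rintro ⟨h1, h2, h3⟩ e he f hf
    refine ⟨?_, h1.ind_of_subset hA Finset.inter_subset_right Finset.inter_subset_left,
      h2.ind_of_subset hB Finset.inter_subset_right Finset.inter_subset_left, ?_⟩
    · exact Finset.insert_subset he (Finset.singleton_subset_iff.2 hf)
    · rintro ⟨⟨P, hP, hPe⟩, ⟨Q, hQ, hQe⟩⟩
      have c1 := (hA.path_nonempty hP).card_pos
      have c2 := (hB.path_nonempty hQ).card_pos
      have hPQ : Disjoint P Q := Finset.disjoint_of_subset_left (hA.path_subset hP)
        (Finset.disjoint_of_subset_right (hB.path_subset hQ) hd)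
      have c3 : (P ∪ Q).card ≤ ({e, f} : Finset β).card := Finset.card_le_card
        (Finset.union_subset (hPe.trans Finset.inter_subset_left)
          (hQe.trans Finset.inter_subset_left))
      rw [Finset.card_union_of_disjoint hPQ] at c3
      have c4 := Finset.card_le_two (a := e) (b := f)
      obtain ⟨a, rfl⟩ := Finset.card_eq_one.1 (show P.card = 1 by omega)
      obtain ⟨b, rfl⟩ := Finset.card_eq_one.1 (show Q.card = 1 by omega)
      exact h3 ⟨⟨a, hP⟩, ⟨b, hQ⟩⟩

lemma not_hasEdge_ser {A B : Net β} (hA : IsNet A) (hB : IsNet B) (hd : Disjoint A.supp B.supp) :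
    ¬ HasEdge (Net.ser A B) := by
  rintro ⟨a, h⟩
  obtain ⟨x, hx⟩ := hA.path_nonempty h.2.1
  obtain ⟨y, hy⟩ := hB.path_nonempty h.2.2
  rw [Finset.disjoint_left] at hd
  grind

lemma IsSer.not_hasEdge {D : Net β} (h : IsSer D) : ¬ HasEdge D := by
  obtain ⟨A, B, hA, hB, hd, rfl⟩ := h
  exact not_hasEdge_ser hA hB hd

lemma hasEdge_par {A B : Net β} : HasEdge (Net.par A B) ↔ HasEdge A ∨ HasEdge B :=
  exists_or

lemma IsNet.eq_leaf_of_path {A : Net β} (hA : IsNet A) (iA : ¬ IsPar A) (h : HasEdge A) :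
    ∃ b, A = Net.leaf b := by
  rcases hA.cases' with h1 | h1 | h1
  · exact h1
  · exact absurd h h1.not_hasEdge
  · exact absurd h1 iA

/-- The deficits from these bounds are the exponents in `genS`, `genU` and `genQ`; the bounds make
the truncated subtractions there exact. In the parallel case at most one factor has a terminal edge,
so one of the two stronger bounds is available. -/
lemma IsNet.card_le {D : Net β} (hD : IsNet D) (h : IsSimpleNet D) :
    D.supp.card + 1 ≤ 2 * D.rank ∧ (¬ HasEdge D → D.supp.card + 2 ≤ 2 * D.rank) := by
  induction hD with
  | leaf a => exact ⟨by simp [Net.leaf], fun h => absurd (hasEdge_leaf a) h⟩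
  | ser A B hA hB hd h1 h2 =>
    rw [isSimpleNet_ser hA hB hd] at h
    have := (h1 h.1).1
    have := (h2 h.2).1
    have e : (Net.ser A B).supp.card = A.supp.card + B.supp.card := Finset.card_union_of_disjoint hd
    have e2 : (Net.ser A B).rank = A.rank + B.rank := rfl
    constructor
    · omega
    · intro; omega
  | par A B hA hB hd h1 h2 =>
    rw [isSimpleNet_par hA hB hd] at h
    have h3 := h1 h.1
    have h4 := h2 h.2.1
    have e : (Net.par A B).supp.card = A.supp.card + B.supp.card := Finset.card_union_of_disjoint hd
    have e2 : (Net.par A B).rank = A.rank + B.rank - 1 := rfl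
    have := hA.rank_pos
    have := hB.rank_pos
    rw [hasEdge_par]
    by_cases hA : HasEdge A <;> by_cases hB : HasEdge B <;>
      simp only [hA, hB, not_true, not_false_iff, true_implies, false_implies, and_true,
        or_true, or_false, and_self, and_false, or_self] at h h3 h4 ⊢
    all_goals omega

lemma finite_isNet (S : Finset β) : {D : Net β | IsNet D ∧ D.supp = S}.Finite := by
  classical
  refine Set.Finite.of_injOn
    (f := fun D : Net β => (S.powerset.filter D.path, S.powerset.filter D.ind))
    (t := (S.powerset.powerset ×ˢ S.powerset.powerset : Finset _)) ?_ ?_ (Finset.finite_toSet _)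
  · intro D _
    simp only [Finset.coe_product, Set.mem_prod, Finset.mem_coe, Finset.mem_powerset]
    exact ⟨Finset.filter_subset _ _, Finset.filter_subset _ _⟩
  · rintro D ⟨hD, hDS⟩ E ⟨hE, hES⟩ h
    simp only [Prod.mk.injEq, Finset.ext_iff, Finset.mem_filter, Finset.mem_powerset] at h
    have hp : ∀ I, D.path I ↔ E.path I := fun I => by
      have h1 := h.1 I
      have h2 := @IsNet.path_subset _ _ D I hD
      have h3 := @IsNet.path_subset _ _ E I hE
      rw [hDS] at h2; rw [hES] at h3
      tauto
    have hi : ∀ I, D.ind I ↔ E.ind I := fun I => by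
      have h1 := h.2 I
      have h2 := @IsNet.ind_subset _ _ D I hD
      have h3 := @IsNet.ind_subset _ _ E I hE
      rw [hDS] at h2; rw [hES] at h3
      tauto
    exact ext' (hDS.trans hES.symm) hp hi (hD.rank_eq hE hi)

/-- The simple networks on `S` with a property. -/
noncomputable def nets (p : Net β → Prop) (S : Finset β) : Finset (Net β) :=
  ((finite_isNet S).subset (t := {D | (IsNet D ∧ D.supp = S) ∧ IsSimpleNet D ∧ p D})
    fun _ h => h.1).toFinset

lemma mem_nets {p : Net β → Prop} {S : Finset β} {D : Net β} :
    D ∈ nets p S ↔ IsNet D ∧ D.supp = S ∧ IsSimpleNet D ∧ p D := by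
  simp [nets, and_assoc]

lemma nets_empty (p : Net β → Prop) : nets p ∅ = ∅ := by
  refine Finset.eq_empty_of_forall_notMem fun D hD => ?_
  rw [mem_nets] at hD
  exact hD.1.supp_nonempty.ne_empty hD.2.1

lemma sum_nets_split {M : Type*} [AddCommMonoid M] (p q : Net β → Prop) (S : Finset β)
    (f : Net β → M) :
    ∑ D ∈ nets p S, f D = ∑ D ∈ nets (fun D => p D ∧ q D) S, f D +
      ∑ D ∈ nets (fun D => p D ∧ ¬ q D) S, f D := by
  classical
  rw [← Finset.sum_filter_add_sum_filter_not (nets p S) q]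
  congr 1 <;> refine Finset.sum_congr ?_ fun _ _ => rfl <;> ext D <;>
    simp only [Finset.mem_filter, mem_nets] <;> tauto

lemma nets_congr {p q : Net β → Prop} (h : ∀ D, IsNet D → (p D ↔ q D)) (S : Finset β) :
    nets p S = nets q S := by
  ext D
  simp only [mem_nets]
  have := h D
  tauto

/-- The product rule for labelled structures with a marked element: a composite on `insert a S` is
given by the set `B` of companions of `a` in its factor and by two networks on complementary sets.
For exponential generating functions it reads H' = F' G. -/
lemma sum_nets_compose {R : Type*} [CommSemiring R] (op : Net β → Net β → Net β)
    (p q r : Net β → Prop) (f g h : Net β → R) {a : β} {S : Finset β} (ha : a ∉ S)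
    (hop : ∀ A B, IsNet A → IsNet B → Disjoint A.supp B.supp → (op A B).supp = A.supp ∪ B.supp)
    (hmap : ∀ A B, IsNet A → IsNet B → Disjoint A.supp B.supp → IsSimpleNet A → IsSimpleNet B →
      p A → q B → IsNet (op A B) ∧ IsSimpleNet (op A B) ∧ r (op A B) ∧ h (op A B) = f A * g B)
    (hinj : ∀ A B A' B', IsNet A → IsNet B → IsNet A' → IsNet B' → Disjoint A.supp B.supp →
      Disjoint A'.supp B'.supp → p A → p A' → a ∈ A.supp → a ∈ A'.supp → op A B = op A' B' →
      A = A' ∧ B = B')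
    (hsurj : ∀ D, IsNet D → IsSimpleNet D → r D → a ∈ D.supp → ∃ A B, IsNet A ∧ IsNet B ∧
      Disjoint A.supp B.supp ∧ IsSimpleNet A ∧ IsSimpleNet B ∧ p A ∧ q B ∧ a ∈ A.supp ∧
      D = op A B) :
    ∑ D ∈ nets r (insert a S), h D =
      ∑ B ∈ S.powerset, (∑ A ∈ nets p (insert a B), f A) * ∑ C ∈ nets q (S \ B), g C := by
  have hdis {B : Finset β} (hB : B ⊆ S) : Disjoint (insert a B) (S \ B) := by
    rw [Finset.disjoint_left]; grind
  simp only [Finset.sum_mul_sum, ← Finset.sum_product', Finset.sum_sigma']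
  symm
  refine Finset.sum_nbij (fun x => op x.2.1 x.2.2) ?_ ?_ ?_ ?_
  · rintro ⟨B, A, C⟩ hx
    simp only [Finset.mem_sigma, Finset.mem_powerset, Finset.mem_product, mem_nets] at hx ⊢
    obtain ⟨hB, ⟨hA, hAs, sA, pA⟩, hC, hCs, sC, qC⟩ := hx
    have hd : Disjoint A.supp C.supp := by rw [hAs, hCs]; exact hdis hB
    obtain ⟨h1, h2, h3, -⟩ := hmap A C hA hC hd sA sC pA qC
    refine ⟨h1, ?_, h2, h3⟩
    rw [hop A C hA hC hd, hAs, hCs, Finset.insert_union, Finset.union_sdiff_of_subset hB]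
  · rintro ⟨B, A, C⟩ hx ⟨B', A', C'⟩ hx' he
    simp only [Finset.mem_coe, Finset.mem_sigma, Finset.mem_powerset, Finset.mem_product,
      mem_nets] at hx hx'
    obtain ⟨hB, ⟨hA, hAs, sA, pA⟩, hC, hCs, sC, qC⟩ := hx
    obtain ⟨hB', ⟨hA', hAs', sA', pA'⟩, hC', hCs', sC', qC'⟩ := hx'
    obtain ⟨rfl, rfl⟩ := hinj A C A' C' hA hC hA' hC' (by rw [hAs, hCs]; exact hdis hB)
      (by rw [hAs', hCs']; exact hdis hB') pA pA' (by rw [hAs]; exact Finset.mem_insert_self _ _)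
      (by rw [hAs']; exact Finset.mem_insert_self _ _) he
    have : B = B' := by
      rw [← Finset.erase_insert (fun h => ha (hB h)), ← hAs, hAs',
        Finset.erase_insert (fun h => ha (hB' h))]
    rw [this]
  · intro D hD
    simp only [Finset.mem_coe, mem_nets] at hD
    obtain ⟨hD, hs, sD, rD⟩ := hD
    obtain ⟨A, C, hA, hC, hd, sA, sC, pA, qC, haA, rfl⟩ :=
      hsurj D hD sD rD (by rw [hs]; exact Finset.mem_insert_self _ _)
    rw [hop A C hA hC hd] at hs
    rw [Finset.disjoint_left] at hd
    refine ⟨⟨A.supp.erase a, A, C⟩, ?_, rfl⟩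
    simp only [Finset.mem_coe, Finset.mem_sigma, Finset.mem_powerset, Finset.mem_product, mem_nets]
    have hs' : ∀ x, (x ∈ A.supp ∨ x ∈ C.supp) ↔ (x = a ∨ x ∈ S) := fun x => by
      rw [← Finset.mem_union, hs, Finset.mem_insert]
    clear hop hmap hinj hsurj
    refine ⟨fun x hx => ?_, ⟨hA, (Finset.insert_erase haA).symm, sA, pA⟩, hC, ?_, sC, qC⟩
    · have := hs' x; grind
    · ext x; have := hs' x; have := @hd x; grind
  · rintro ⟨B, A, C⟩ hx
    simp only [Finset.mem_sigma, Finset.mem_powerset, Finset.mem_product, mem_nets] at hx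
    obtain ⟨hB, ⟨hA, hAs, sA, pA⟩, hC, hCs, sC, qC⟩ := hx
    exact (hmap A C hA hC (by rw [hAs, hCs]; exact hdis hB) sA sC pA qC).2.2.2.symm

open Polynomial

/-- Generating polynomial of the simple series networks on `S`, by deficiency. -/
noncomputable def genS (S : Finset β) : ℚ[X] :=
  ∑ D ∈ nets IsSer S, X ^ (2 * D.rank - 2 - D.supp.card)

/-- Generating polynomial of the simple networks on `S` that are not a series composition. -/
noncomputable def genU (S : Finset β) : ℚ[X] :=
  ∑ D ∈ nets (fun D => ¬ IsSer D) S, X ^ (2 * D.rank - 1 - D.supp.card)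

/-- Generating polynomial of the simple networks on `S` without an edge joining the terminals,
including the empty one. -/
noncomputable def genQ (S : Finset β) : ℚ[X] :=
  (∑ D ∈ nets (fun D => ¬ HasEdge D) S, X ^ (2 * D.rank - 2 - D.supp.card)) +
    if S = ∅ then 1 else 0

lemma genS_empty : genS (∅ : Finset β) = 0 := by simp [genS, nets_empty]

lemma genU_empty : genU (∅ : Finset β) = 0 := by simp [genU, nets_empty]

lemma genQ_empty : genQ (∅ : Finset β) = 1 := by simp [genQ, nets_empty]

/-- The exponents in `genS` are measured from 2r - 2 instead of 2r - 1; the factor X makes up the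
difference. -/
lemma genU_add_genS (S : Finset β) : genU S + X * genS S =
    ∑ D ∈ nets (fun _ => True) S, X ^ (2 * D.rank - 1 - D.supp.card) := by
  rw [sum_nets_split (fun _ => True) IsSer, add_comm, genU, genS, Finset.mul_sum]
  simp only [true_and]
  congr 1
  refine Finset.sum_congr rfl fun D hD => ?_
  rw [mem_nets] at hD
  have := (hD.1.card_le hD.2.2.1).2 hD.2.2.2.not_hasEdge
  rw [← pow_succ']
  congr 1; omega

/-- The series-irreducible factor containing `a` is split off and the rest is arbitrary. Deficits
add because (2r - 1 - c) + (2r' - 1 - c') = 2(r + r') - 2 - (c + c'). -/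
lemma genS_insert {a : β} {S : Finset β} (ha : a ∉ S) : genS (insert a S) =
    ∑ B ∈ S.powerset, genU (insert a B) * (genU (S \ B) + X * genS (S \ B)) := by
  simp only [genU_add_genS]
  refine sum_nets_compose Net.ser _ _ _ _ _ _ ha (fun _ _ _ _ _ => rfl) ?_ ?_ ?_
  · intro A B hA hB hd sA sB iA _
    refine ⟨.ser A B hA hB hd, (isSimpleNet_ser hA hB hd).2 ⟨sA, sB⟩, ⟨A, B, hA, hB, hd, rfl⟩, ?_⟩
    have := (hA.card_le sA).1
    have := (hB.card_le sB).1
    have e : (Net.ser A B).supp.card = A.supp.card + B.supp.card := Finset.card_union_of_disjoint hd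
    have e2 : (Net.ser A B).rank = A.rank + B.rank := rfl
    rw [← pow_add]
    congr 1; omega
  · intro A B A' B' hA hB hA' hB' hd hd' iA iA' haA haA' h
    exact ser_unique hA hB hA' hB' hd hd' h iA iA' haA haA'
  · intro D hD sD rD haD
    obtain ⟨A, hA, iA, haA, rfl | ⟨B, hB, hd, rfl⟩⟩ := hD.exists_ser_factor haD
    · exact absurd rD iA
    · have := (isSimpleNet_ser hA hB hd).1 sD
      exact ⟨A, B, hA, hB, hd, this.1, this.2, iA, trivial, haA, rfl⟩

/-- Without a terminal edge the parallel-irreducible factor containing `a` cannot be a leaf, so it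
is a series composition. The rest is a network of the same kind or nothing. -/
lemma genQ_insert {a : β} {S : Finset β} (ha : a ∉ S) : genQ (insert a S) =
    ∑ B ∈ S.powerset, genS (insert a B) * genQ (S \ B) := by
  simp only [genQ, mul_add, Finset.sum_add_distrib, Finset.insert_ne_empty, if_false, add_zero]
  rw [sum_nets_split (fun D => ¬ HasEdge D) IsPar]
  congr 1
  · refine sum_nets_compose Net.par _ _ _ _ _ _ ha (fun _ _ _ _ _ => rfl) ?_ ?_ ?_
    · intro A B hA hB hd sA sB iA qB
      have hE : ¬ HasEdge (Net.par A B) := by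
        rw [hasEdge_par]; exact not_or.2 ⟨iA.not_hasEdge, qB⟩
      refine ⟨.par A B hA hB hd, (isSimpleNet_par hA hB hd).2 ⟨sA, sB, fun h => qB h.2⟩,
        ⟨hE, ⟨A, B, hA, hB, hd, rfl⟩⟩, ?_⟩
      have := (hA.card_le sA).2 iA.not_hasEdge
      have := (hB.card_le sB).2 qB
      have e : (Net.par A B).supp.card = A.supp.card + B.supp.card :=
        Finset.card_union_of_disjoint hd
      have e2 : (Net.par A B).rank = A.rank + B.rank - 1 := rfl
      rw [← pow_add]
      congr 1; omega
    · intro A B A' B' hA hB hA' hB' hd hd' iA iA' haA haA' h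
      exact par_unique hA hB hA' hB' hd hd' h iA.not_isPar iA'.not_isPar haA haA'
    · intro D hD sD rD haD
      obtain ⟨A, hA, iA, haA, rfl | ⟨B, hB, hd, rfl⟩⟩ := hD.exists_par_factor haD
      · exact absurd rD.2 iA
      · have h1 := (isSimpleNet_par hA hB hd).1 sD
        have h2 := rD.1
        rw [hasEdge_par, not_or] at h2
        have h3 : IsSer A := by
          rcases hA.cases' with ⟨b, rfl⟩ | h | h
          · exact absurd (hasEdge_leaf b) h2.1
          · exact h
          · exact absurd h iA
        exact ⟨A, B, hA, hB, hd, h1.1, h1.2.1, h3, h2.2, haA, rfl⟩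
  -- The networks that are not parallel compositions are matched with the constant 1 of `genQ` on
  -- the empty set, which occurs only for `B = S`.
  · rw [Finset.sum_eq_single S]
    · rw [if_pos (by simp), mul_one, genS]
      refine Finset.sum_congr (nets_congr (fun D hD => ?_) _) fun _ _ => rfl
      constructor
      · rintro ⟨h1, h2⟩
        rcases hD.cases' with ⟨b, rfl⟩ | h | h
        · exact absurd (hasEdge_leaf b) h1
        · exact h
        · exact absurd h h2
      · exact fun h => ⟨h.not_hasEdge, h.not_isPar⟩
    · intro B hB hBS
      rw [if_neg, mul_zero]
      rw [Finset.sdiff_eq_empty_iff_subset]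
      exact fun h => hBS ((Finset.mem_powerset.1 hB).antisymm h)
    · simp

lemma isSimpleNet_par_leaf {b : β} {C : Net β} (hC : IsNet C)
    (hd : Disjoint (Net.leaf b).supp C.supp) :
    IsSimpleNet (Net.par (Net.leaf b) C) ↔ IsSimpleNet C ∧ ¬ HasEdge C := by
  rw [isSimpleNet_par (.leaf b) hC hd]
  simp [isSimpleNet_leaf, hasEdge_leaf]

/-- In a simple network the terminal edge `b` is unique. Deleting it leaves a network without
terminal edge, or, for a one-element `S`, nothing, counted by the constant term of `genQ`. -/
lemma sum_nets_hasEdge {S : Finset β} (hS : S.Nonempty) :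
    (∑ D ∈ nets HasEdge S, X ^ (2 * D.rank - 1 - D.supp.card) : ℚ[X]) =
      ∑ b ∈ S, genQ (S.erase b) := by
  rcases hS.card_pos.nat_succ_le.eq_or_lt with h1 | h1
  · obtain ⟨b, rfl⟩ := Finset.card_eq_one.1 h1.symm
    have : nets HasEdge {b} = {Net.leaf b} := by
      ext D
      rw [mem_nets, Finset.mem_singleton]
      constructor
      · rintro ⟨hD, hs, -, -⟩
        rcases hD.cases' with ⟨c, rfl⟩ | h | h
        · rw [Finset.singleton_injective (show ({c} : Finset β) = {b} from hs)]
        · have := h.two_le_card; simp [hs] at this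
        · have := h.two_le_card; simp [hs] at this
      · rintro rfl
        exact ⟨.leaf b, rfl, isSimpleNet_leaf b, hasEdge_leaf b⟩
    rw [this]
    simp [genQ_empty, Net.leaf]
  · have h2 : ∀ b ∈ S, S.erase b ≠ ∅ := fun b hb h => by
      have := Finset.card_erase_of_mem hb
      rw [h, Finset.card_empty] at this; omega
    have h3 : ∀ b ∈ S, genQ (S.erase b) =
        ∑ D ∈ nets (fun D => ¬ HasEdge D) (S.erase b), X ^ (2 * D.rank - 2 - D.supp.card) :=
      fun b hb => by rw [genQ, if_neg (h2 b hb), add_zero]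
    rw [Finset.sum_congr rfl h3, Finset.sum_sigma']
    symm
    have hdis {b : β} {C : Net β} (hC : C.supp = S.erase b) :
        Disjoint (Net.leaf b).supp C.supp := by
      rw [hC]; exact Finset.disjoint_singleton_left.2 (Finset.notMem_erase b S)
    refine Finset.sum_nbij (fun x => Net.par (Net.leaf x.1) x.2) ?_ ?_ ?_ ?_
    · rintro ⟨b, C⟩ hx
      simp only [Finset.mem_sigma, mem_nets] at hx ⊢
      obtain ⟨hb, hC, hCs, sC, qC⟩ := hx
      refine ⟨.par _ C (.leaf b) hC (hdis hCs), ?_, (isSimpleNet_par_leaf hC (hdis hCs)).2 ⟨sC, qC⟩,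
        hasEdge_par.2 (Or.inl (hasEdge_leaf b))⟩
      change {b} ∪ C.supp = S
      rw [hCs, ← Finset.insert_eq, Finset.insert_erase hb]
    · rintro ⟨b, C⟩ hx ⟨b', C'⟩ hx' he
      simp only [Finset.mem_coe, Finset.mem_sigma, mem_nets] at hx hx'
      obtain ⟨hb, hC, hCs, sC, qC⟩ := hx
      obtain ⟨hb', hC', hCs', sC', qC'⟩ := hx'
      have h4 : (Net.par (Net.leaf b) C).path {b} := Or.inl rfl
      simp only at he
      rw [he] at h4
      have h5 : b = b' := by
        rcases h4 with h4 | h4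
        · exact Finset.singleton_injective h4
        · exact absurd ⟨b, h4⟩ qC'
      subst h5
      rw [(par_left_cancel (.leaf b) hC (.leaf b) hC' (hdis hCs) (hdis hCs') he rfl).2]
    · intro D hD
      simp only [Finset.mem_coe, mem_nets] at hD
      obtain ⟨hD, hs, sD, b, hb⟩ := hD
      have hbD := hD.path_subset hb (Finset.mem_singleton_self b)
      obtain ⟨A, hA, iA, haA, h⟩ := hD.exists_par_factor hbD
      have hAe : A = Net.leaf b := by
        have hE : HasEdge A := by
          rcases h with rfl | ⟨B, hB, hd, rfl⟩
          · exact ⟨b, hb⟩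
          · rcases hb with hb | hb
            · exact ⟨b, hb⟩
            · exact absurd (hB.path_subset hb (Finset.mem_singleton_self b))
                (Finset.disjoint_left.1 hd haA)
        obtain ⟨c, rfl⟩ := hA.eq_leaf_of_path iA hE
        rw [Finset.mem_singleton.1 (show b ∈ ({c} : Finset β) from haA)]
      subst hAe
      rcases h with rfl | ⟨C, hC, hd, rfl⟩
      · rw [← hs] at h1; simp [Net.leaf] at h1
      · have h4 := (isSimpleNet_par_leaf hC hd).1 sD
        refine ⟨⟨b, C⟩, ?_, rfl⟩
        simp only [Finset.mem_coe, Finset.mem_sigma, mem_nets]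
        refine ⟨hs ▸ hbD, hC, ?_, h4⟩
        rw [← hs]
        change C.supp = ({b} ∪ C.supp).erase b
        rw [← Finset.insert_eq, Finset.erase_insert (Finset.disjoint_singleton_left.1 hd)]
    · rintro ⟨b, C⟩ hx
      simp only [Finset.mem_sigma, mem_nets] at hx
      obtain ⟨hb, hC, hCs, sC, qC⟩ := hx
      have e : (Net.par (Net.leaf b) C).supp.card = 1 + C.supp.card := by
        rw [show (Net.par (Net.leaf b) C).supp = (Net.leaf b).supp ∪ C.supp from rfl,
          Finset.card_union_of_disjoint (hdis hCs)]
        simp [Net.leaf]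
      have e2 : (Net.par (Net.leaf b) C).rank = 1 + C.rank - 1 := rfl
      simp only
      congr 1; omega

lemma genU_add_genS_eq {S : Finset β} (hS : S.Nonempty) :
    genU S + X * genS S = X * genQ S + ∑ b ∈ S, genQ (S.erase b) := by
  rw [genU_add_genS, sum_nets_split _ HasEdge, add_comm, genQ, if_neg hS.ne_empty, add_zero,
    Finset.mul_sum, ← sum_nets_hasEdge hS]
  simp only [true_and]
  congr 1
  refine Finset.sum_congr rfl fun D hD => ?_
  rw [mem_nets] at hD
  have := (hD.1.card_le hD.2.2.1).2 hD.2.2.2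
  rw [← pow_succ']
  congr 1; omega

end SeriesParallel

/-! ### From recursions on sets to exponential generating functions. -/

namespace SeriesParallel

open Polynomial

section Card

/-- The term i = n has an empty second factor and vanishes. Writing it as 0 keeps `f` to sizes at
most n, so `genS` at size n + 1 needs only smaller sizes; `genQ` and then `genU` at size n + 1
follow from it. -/
lemma genS_card_step (f g : ℕ → ℚ[X]) {β : Type} [DecidableEq β] (n : ℕ)
    (hU : ∀ S : Finset β, S.card ≤ n → genU S = f S.card)
    (hS : ∀ S : Finset β, S.card ≤ n → genS S = g S.card) {S : Finset β} (h : S.card = n + 1) :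
    genS S = ∑ i ∈ Finset.range (n + 1), n.choose i •
      if i < n then f (i + 1) * (f (n - i) + X * g (n - i)) else 0 := by
  obtain ⟨a, T, ha, rfl, rfl⟩ := Finset.card_eq_succ.1 h
  rw [genS_insert ha, ← Finset.sum_powerset_apply_card]
  refine Finset.sum_congr rfl fun B hB => ?_
  rw [Finset.mem_powerset] at hB
  have hc := Finset.card_le_card hB
  have hd : (T \ B).card = T.card - B.card := Finset.card_sdiff_of_subset hB
  have hi : (insert a B).card = B.card + 1 := Finset.card_insert_of_notMem fun h => ha (hB h)
  split_ifs with hlt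
  · rw [hU _ (by omega), hU _ (by omega), hS _ (by omega), hd, hi]
  · have : T \ B = ∅ := Finset.card_eq_zero.1 (by omega)
    rw [this, genU_empty, genS_empty]
    simp

lemma genQ_card_step (f g : ℕ → ℚ[X]) {β : Type} [DecidableEq β] (n : ℕ)
    (hS : ∀ S : Finset β, S.card ≤ n + 1 → genS S = f S.card)
    (hQ : ∀ S : Finset β, S.card ≤ n → genQ S = g S.card) {S : Finset β} (h : S.card = n + 1) :
    genQ S = ∑ i ∈ Finset.range (n + 1), n.choose i • (f (i + 1) * g (n - i)) := by
  obtain ⟨a, T, ha, rfl, rfl⟩ := Finset.card_eq_succ.1 h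
  rw [genQ_insert ha, ← Finset.sum_powerset_apply_card (fun i => f (i + 1) * g (T.card - i))]
  refine Finset.sum_congr rfl fun B hB => ?_
  rw [Finset.mem_powerset] at hB
  have hc := Finset.card_le_card hB
  have hd : (T \ B).card = T.card - B.card := Finset.card_sdiff_of_subset hB
  have hi : (insert a B).card = B.card + 1 := Finset.card_insert_of_notMem fun h => ha (hB h)
  rw [hS _ (by omega), hQ _ (by omega), hd, hi]

lemma genU_card_step (f g : ℕ → ℚ[X]) {β : Type} [DecidableEq β] (n : ℕ)
    (hS : ∀ S : Finset β, S.card ≤ n + 1 → genS S = f S.card)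
    (hQ : ∀ S : Finset β, S.card ≤ n + 1 → genQ S = g S.card) {S : Finset β}
    (h : S.card = n + 1) :
    genU S = X * g (n + 1) + ((n : ℚ[X]) + 1) * g n - X * f (n + 1) := by
  have := genU_add_genS_eq (S := S) (Finset.card_pos.1 (by omega))
  rw [hS S h.le, hQ S h.le, h, Finset.sum_congr rfl (g := fun _ => g n), Finset.sum_const, h,
    nsmul_eq_mul] at this
  · push_cast at this
    linear_combination this
  · intro b hb
    have := Finset.card_erase_of_mem hb
    rw [hQ _ (by omega), this, h, Nat.add_sub_cancel]

/-- The generating polynomials depend only on the number of edges. -/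
lemma gen_eq_range {β : Type} [DecidableEq β] (S : Finset β) :
    genS S = genS (Finset.range S.card) ∧ genU S = genU (Finset.range S.card) ∧
      genQ S = genQ (Finset.range S.card) := by
  -- Quantifying over all types lets `S` and `Finset.range S.card` be evaluated by the same
  -- recursions, so no relabelling of networks is needed.
  suffices H : ∀ n, ∀ (β : Type) [DecidableEq β] (S : Finset β), S.card ≤ n →
      genS S = genS (Finset.range S.card) ∧ genU S = genU (Finset.range S.card) ∧
      genQ S = genQ (Finset.range S.card) from H _ β S le_rfl
  intro n
  induction n with
  | zero =>
    intro β _ S hS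
    obtain rfl := Finset.card_eq_zero.1 (Nat.le_zero.1 hS)
    simp [genS_empty, genU_empty, genQ_empty]
  | succ n ih =>
    intro β _ S hS
    rcases hS.lt_or_eq with h | h
    · exact ih β S (by omega)
    · have rc : (Finset.range S.card).card = n + 1 := by rw [Finset.card_range, h]
      have aS (β : Type) [DecidableEq β] {S : Finset β} (hS : S.card = n + 1) := 
        genS_card_step (fun n => genU (Finset.range n)) (fun n => genS (Finset.range n)) n
          (fun S hS => (ih β S hS).2.1) (fun S hS => (ih β S hS).1) hS
      have bS (β : Type) [DecidableEq β] (S : Finset β) (hS : S.card ≤ n + 1) :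
          genS S = genS (Finset.range S.card) := by
        rcases hS.lt_or_eq with h | h
        · exact (ih β S (by omega)).1
        · rw [aS β h, aS ℕ ((Finset.card_range _).trans h)]
      have aQ (β : Type) [DecidableEq β] {S : Finset β} (hS : S.card = n + 1) := 
        genQ_card_step (fun n => genS (Finset.range n)) (fun n => genQ (Finset.range n)) n
          (fun S hS => bS β S hS) (fun S hS => (ih β S hS).2.2) hS
      have bQ (β : Type) [DecidableEq β] (S : Finset β) (hS : S.card ≤ n + 1) :
          genQ S = genQ (Finset.range S.card) := by
        rcases hS.lt_or_eq with h | h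
        · exact (ih β S (by omega)).2.2
        · rw [aQ β h, aQ ℕ ((Finset.card_range _).trans h)]
      have aU (β : Type) [DecidableEq β] {S : Finset β} (hS : S.card = n + 1) := 
        genU_card_step (fun n => genS (Finset.range n)) (fun n => genQ (Finset.range n)) n
          (fun S hS => bS β S hS) (fun S hS => bQ β S hS) hS
      exact ⟨bS β S hS, by rw [aU β h, aU ℕ rc], bQ β S hS⟩

lemma genS_range_succ (n : ℕ) : genS (Finset.range (n + 1)) =
    ∑ i ∈ Finset.range (n + 1), n.choose i • (genU (Finset.range (i + 1)) *
      (genU (Finset.range (n - i)) + X * genS (Finset.range (n - i)))) := by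
  rw [genS_card_step (fun n => genU (Finset.range n)) (fun n => genS (Finset.range n)) n
    (fun S _ => (gen_eq_range S).2.1) (fun S _ => (gen_eq_range S).1) (Finset.card_range _)]
  refine Finset.sum_congr rfl fun i hi => ?_
  split_ifs with h
  · rfl
  · have : n - i = 0 := by omega
    rw [this, Finset.range_zero, genU_empty, genS_empty]
    simp

lemma genQ_range_succ (n : ℕ) : genQ (Finset.range (n + 1)) =
    ∑ i ∈ Finset.range (n + 1), n.choose i • (genS (Finset.range (i + 1)) *
      genQ (Finset.range (n - i))) :=
  genQ_card_step (fun n => genS (Finset.range n)) (fun n => genQ (Finset.range n)) n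
    (fun S _ => (gen_eq_range S).1) (fun S _ => (gen_eq_range S).2.2) (Finset.card_range _)

lemma genU_range_succ (n : ℕ) : genU (Finset.range (n + 1)) + X * genS (Finset.range (n + 1)) =
    X * genQ (Finset.range (n + 1)) + ((n : ℚ[X]) + 1) * genQ (Finset.range n) := by
  rw [genU_card_step (fun n => genS (Finset.range n)) (fun n => genQ (Finset.range n)) n
    (fun S _ => (gen_eq_range S).1) (fun S _ => (gen_eq_range S).2.2) (Finset.card_range _)]
  ring

end Card

section Egf

/-- Exponential generating function of the degree `j` coefficients of a sequence of polynomials. -/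
noncomputable def egf (f : ℕ → ℚ[X]) (j : ℕ) : PowerSeries ℚ :=
  PowerSeries.mk fun n => (f n).coeff j / n.factorial

open PowerSeries in
lemma coeff_egf (f : ℕ → ℚ[X]) (j n : ℕ) :
    PowerSeries.coeff n (egf f j) = (f n).coeff j / n.factorial := coeff_mk _ _

lemma constantCoeff_egf (f : ℕ → ℚ[X]) (j : ℕ) :
    PowerSeries.constantCoeff (egf f j) = (f 0).coeff j := by
  rw [← PowerSeries.coeff_zero_eq_constantCoeff_apply, coeff_egf]; simp

lemma egf_add (f g : ℕ → ℚ[X]) (j : ℕ) : egf (fun n => f n + g n) j = egf f j + egf g j := by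
  ext n; simp [coeff_egf, add_div]

lemma egf_X_mul_zero (f : ℕ → ℚ[X]) : egf (fun n => X * f n) 0 = 0 := by
  ext n; simp [coeff_egf]

lemma egf_X_mul_succ (f : ℕ → ℚ[X]) (j : ℕ) : egf (fun n => X * f n) (j + 1) = egf f j := by
  ext n; simp [coeff_egf]

/-- The derivative of an exponential generating function given by a binomial recursion. -/
lemma derivative_egf {f g h : ℕ → ℚ[X]}
    (H : ∀ n, h (n + 1) = ∑ i ∈ Finset.range (n + 1), n.choose i • (f (i + 1) * g (n - i)))
    (j : ℕ) : PowerSeries.derivative ℚ (egf h j) =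
      ∑ p ∈ Finset.HasAntidiagonal.antidiagonal j,
        PowerSeries.derivative ℚ (egf f p.1) * egf g p.2 := by
  ext n
  rw [PowerSeries.coeff_derivative, coeff_egf, H, map_sum]
  simp only [PowerSeries.coeff_mul, PowerSeries.coeff_derivative, coeff_egf]
  rw [Finset.sum_comm, Finset.Nat.sum_antidiagonal_eq_sum_range_succ_mk, Polynomial.finsetSum_coeff,
    Finset.sum_div, Finset.sum_mul]
  refine Finset.sum_congr rfl fun i hi => ?_
  have hi' : i ≤ n := by rw [Finset.mem_range] at hi; omega
  rw [Polynomial.coeff_smul, Polynomial.coeff_mul, nsmul_eq_mul, Finset.mul_sum, Finset.sum_div,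
    Finset.sum_mul]
  refine Finset.sum_congr rfl fun p _ => ?_
  have h1 := Nat.choose_mul_factorial_mul_factorial hi'
  have h2 : (n.choose i : ℚ) * i.factorial * (n - i).factorial = n.factorial := by
    exact_mod_cast h1
  have e1 : (i.factorial : ℚ) ≠ 0 := by positivity
  have e2 : ((n - i).factorial : ℚ) ≠ 0 := by positivity
  have e3 : (n.factorial : ℚ) ≠ 0 := by positivity
  have e4 : (n : ℚ) + 1 ≠ 0 := by positivity
  have e5 : (i : ℚ) + 1 ≠ 0 := by positivity
  rw [Nat.factorial_succ, Nat.factorial_succ, Nat.cast_mul, Nat.cast_mul, ← h2]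
  have e6 : (n.choose i : ℚ) ≠ 0 := by exact_mod_cast (Nat.choose_pos hi').ne'
  push_cast
  field_simp

/-- The recursions become S' = U'(U + tS), Q' = S'Q and U + tS = t(Q - 1) + xQ, and their
coefficients of t⁰, t¹, t² are the hypotheses of `coeff_of_graded_equations`. -/
theorem coeff_two_genQ {β : Type} [DecidableEq β] (S : Finset β) (l : ℕ) (hl : 1 ≤ l)
    (hS : S.card = 2 * l) (k : ℚ) (hk : k = l + 2) :
    (genQ S).coeff 2 / (Nat.doubleFactorial (2 * l + 1) : ℚ) =
      (1 / 2) * (2 * k - 1) ^ (l : ℤ) - (2 * k - 2) ^ (l : ℤ)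
        + (1 / 2) * (2 * k - 3) ^ (l : ℤ)
        + (2 / 3) * (k - 2) * ((2 * k - 3) ^ ((l : ℤ) - 1) - (2 * k - 2) ^ ((l : ℤ) - 1))
        + (1 / 9) * (4 * k - 7) * (k - 2) * (k - 3) * (2 * k - 3) ^ ((l : ℤ) - 3) := by
  set s : ℕ → ℚ[X] := fun n => genS (Finset.range n) with hs
  set u : ℕ → ℚ[X] := fun n => genU (Finset.range n) with hu
  set q : ℕ → ℚ[X] := fun n => genQ (Finset.range n) with hq
  have s0 : s 0 = 0 := genS_empty
  have u0 : u 0 = 0 := genU_empty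
  have q0 : q 0 = 1 := genQ_empty
  have dS := derivative_egf (f := u) (g := fun n => u n + X * s n) (h := s) genS_range_succ
  have dQ := derivative_egf (f := s) (g := q) (h := q) genQ_range_succ
  -- The correction at j = 1 is the -t in t(Q - 1): the recursion for `genU` holds only on nonempty
  -- sets, while `genQ` is 1 on the empty set.
  have hU (j : ℕ) : egf (fun n => u n + X * s n) j =
      egf (fun n => X * q n) j - (if j = 1 then 1 else 0) + PowerSeries.X * egf q j := by
    ext n
    cases n with
    | zero =>
      rw [PowerSeries.coeff_zero_eq_constantCoeff, map_add, map_sub, constantCoeff_egf,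
        constantCoeff_egf, s0, u0, q0]
      rcases eq_or_ne j 1 with rfl | hj
      · simp
      · simp [Polynomial.coeff_X, hj.symm, hj]
    | succ n =>
      rw [map_add, map_sub, PowerSeries.coeff_succ_X_mul, coeff_egf, coeff_egf, coeff_egf]
      have e : PowerSeries.coeff (R := ℚ) (n + 1) (if j = 1 then 1 else 0) = 0 := by
        split_ifs <;> simp [PowerSeries.coeff_one]
      have := genU_range_succ n
      simp only [hs, hu, hq, this, e]
      rw [Polynomial.coeff_add, Nat.factorial_succ, show ((n : ℚ[X]) + 1) = C ((n : ℚ) + 1) by simp,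
        Polynomial.coeff_C_mul]
      push_cast
      have e3 : (n.factorial : ℚ) ≠ 0 := by positivity
      have e4 : (n : ℚ) + 1 ≠ 0 := by positivity
      field_simp
      ring
  have a0 : Finset.HasAntidiagonal.antidiagonal 0 = {((0 : ℕ), (0 : ℕ))} := rfl
  have a1 : Finset.HasAntidiagonal.antidiagonal 1 = {((0 : ℕ), (1 : ℕ)), (1, 0)} := rfl
  have a2 : Finset.HasAntidiagonal.antidiagonal 2 = {((0 : ℕ), (2 : ℕ)), (1, 1), (2, 0)} := rfl
  have t0 : egf (fun n => u n + X * s n) 0 = egf u 0 := by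
    rw [egf_add, egf_X_mul_zero, add_zero]
  have t (j : ℕ) : egf (fun n => u n + X * s n) (j + 1) = egf u (j + 1) + egf s j := by
    rw [egf_add, egf_X_mul_succ]
  have dS0 := dS 0
  have dS1 := dS 1
  have dS2 := dS 2
  have dQ0 := dQ 0
  have dQ1 := dQ 1
  have dQ2 := dQ 2
  have t1 := t 0
  have t2 := t 1
  have hU0 := hU 0
  have hU1 := hU 1
  have hU2 := hU 2
  rw [egf_X_mul_zero] at hU0
  rw [egf_X_mul_succ] at hU1 hU2
  simp only [zero_add, Nat.reduceAdd] at t1 t2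
  rw [t0] at hU0
  rw [t1] at hU1
  rw [t2] at hU2
  simp [a0, a1, a2, t0, t1, t2] at dS0 dS1 dS2 dQ0 dQ1 dQ2 hU0 hU1 hU2
  have key := coeff_of_graded_equations (egf s 0) (egf s 1) (egf s 2) (egf u 0) (egf u 1) (egf u 2)
    (egf q 0) (egf q 1) (egf q 2) (by simp [constantCoeff_egf, s0]) (by simp [constantCoeff_egf, s0])
    (by simp [constantCoeff_egf, s0]) (by simp [constantCoeff_egf, u0])
    (by simp [constantCoeff_egf, q0]) (by simp [constantCoeff_egf, q0, Polynomial.coeff_one])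
    (by simp [constantCoeff_egf, q0, Polynomial.coeff_one])
    dS0 (by rw [dS1]; ring) (by rw [dS2]; ring) dQ0 dQ1 (by rw [dQ2]; ring)
    hU0 (by rw [hU1]; ring) (by rw [hU2]; ring) l hl k hk
  rw [← key, coeff_egf, (gen_eq_range S).2.2, hS, mul_div_cancel₀]
  positivity

end Egf

end SeriesParallel

/-! ### Cycles in multigraphs and the effect of the two extensions. -/

namespace SeriesParallel

variable {α β : Type*}

/-- A set of edges contains no cycle. -/
def Acyc (G : Graph α β) (I : Set β) : Prop := ∀ C ⊆ I, ¬ IsCycleEdgeSet G C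

/-- Two vertices are joined by a walk with edges in `J`. -/
def Conn (G : Graph α β) (J : Set β) : α → α → Prop :=
  Relation.ReflTransGen fun x y => ∃ g ∈ J, G.IsLink g x y

section Conn

variable {G H : Graph α β} {I J : Set β} {a b x y w : α} {e g : β}

lemma Conn.symm (h : Conn G J x y) : Conn G J y x := by
  induction h with
  | refl => exact .refl
  | tail _ h2 ih =>
    obtain ⟨g, hg, h⟩ := h2
    exact .head ⟨g, hg, h.symm⟩ ih

lemma Conn.mono (h : Conn G J x y) (hJ : J ⊆ I) : Conn G I x y :=
  Relation.ReflTransGen.mono (fun _ _ ⟨g, hg, h⟩ => ⟨g, hJ hg, h⟩) _ _ h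

lemma Conn.single (hg : g ∈ J) (h : G.IsLink g x y) : Conn G J x y :=
  Relation.ReflTransGen.single ⟨g, hg, h⟩

lemma conn_congr (h : ∀ g ∈ J, ∀ x y, G.IsLink g x y ↔ H.IsLink g x y) : Conn G J = Conn H J := by
  unfold Conn
  congr 1
  ext x y
  exact exists_congr fun g => and_congr_right fun hg => h g hg x y

lemma Conn.eq_of_isolated (h : Conn G J w x) (hw : ∀ g ∈ J, ∀ y, ¬ G.IsLink g w y) : x = w := by
  induction h with
  | refl => rfl
  | tail _ h2 ih =>
    obtain ⟨g, hg, h⟩ := h2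
    subst ih
    exact absurd h (hw g hg _)

lemma conn_insert (h : G.IsLink g x y) : Conn G (insert g J) a b ↔
    Conn G J a b ∨ (Conn G J a x ∧ Conn G J y b) ∨ (Conn G J a y ∧ Conn G J x b) := by
  constructor
  · intro hc
    induction hc with
    | refl => exact Or.inl .refl
    | @tail c d _ h2 ih =>
      obtain ⟨k, hk, hl⟩ := h2
      rcases Set.mem_insert_iff.1 hk with rfl | hk
      · rcases h.eq_and_eq_or_eq_and_eq hl with ⟨rfl, rfl⟩ | ⟨rfl, rfl⟩
        · rcases ih with ih | ⟨h1, h2⟩ | ⟨h1, h2⟩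
          · exact Or.inr (Or.inl ⟨ih, .refl⟩)
          · exact Or.inr (Or.inl ⟨h1, .refl⟩)
          · exact Or.inl h1
        · rcases ih with ih | ⟨h1, h2⟩ | ⟨h1, h2⟩
          · exact Or.inr (Or.inr ⟨ih, .refl⟩)
          · exact Or.inl h1
          · exact Or.inr (Or.inr ⟨h1, .refl⟩)
      · have hs : Conn G J c d := .single hk hl
        rcases ih with ih | ⟨h1, h2⟩ | ⟨h1, h2⟩
        · exact Or.inl (ih.trans hs)
        · exact Or.inr (Or.inl ⟨h1, h2.trans hs⟩)
        · exact Or.inr (Or.inr ⟨h1, h2.trans hs⟩)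
  · have hs : Conn G (insert g J) x y := .single (Set.mem_insert _ _) h
    have hJ : J ⊆ insert g J := Set.subset_insert _ _
    rintro (h1 | ⟨h1, h2⟩ | ⟨h1, h2⟩)
    · exact h1.mono hJ
    · exact (h1.mono hJ).trans (hs.trans (h2.mono hJ))
    · exact (h1.mono hJ).trans (hs.symm.trans (h2.mono hJ))

lemma exists_injective_chain {r : α → α → Prop} (h : Relation.ReflTransGen r x y) :
    ∃ (n : ℕ) (v : ℕ → α), v 0 = x ∧ v n = y ∧ (∀ i < n, r (v i) (v (i + 1))) ∧
      ∀ i ≤ n, ∀ j ≤ n, v i = v j → i = j := by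
  induction h with
  | refl => exact ⟨0, fun _ => x, rfl, rfl, by simp, by simp⟩
  | @tail b c _ hbc ih =>
    obtain ⟨n, v, h0, hn, hr, hinj⟩ := ih
    by_cases hc : ∃ i ≤ n, v i = c
    · obtain ⟨i, hi, rfl⟩ := hc
      exact ⟨i, v, h0, rfl, fun j hj => hr j (by omega),
        fun j hj k hk => hinj j (by omega) k (by omega)⟩
    · push Not at hc
      refine ⟨n + 1, fun t => if t ≤ n then v t else c, by simp [h0], by simp, ?_, ?_⟩
      · intro i hi
        rcases (Nat.lt_succ_iff.1 hi).lt_or_eq with h | rfl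
        · simp only [if_pos h.le, if_pos (Nat.succ_le_of_lt h)]
          exact hr i h
        · simpa [hn] using hbc
      · intro i hi j hj hij
        simp only at hij
        split_ifs at hij with h1 h2 h2
        · exact hinj i h1 j h2 hij
        · exact absurd hij (hc i h1)
        · exact absurd hij.symm (hc j h2)
        · omega

/-- A walk avoiding e between its ends can be made free of repeated vertices, and e closes it to a
cycle; conversely a cycle without its last edge is such a walk. Cycles are thereby replaced by
`Conn`, which is easy to follow when an edge is added. -/
lemma acyc_iff : Acyc G I ↔ ∀ e ∈ I, ∀ x y, G.IsLink e x y → ¬ Conn G (I \ {e}) x y := by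
  constructor
  · intro h e he x y hl hc
    obtain ⟨n, v, rfl, rfl, hr, hinj⟩ := exists_injective_chain hc
    have : ∀ i, ∃ g, i < n → g ∈ I \ {e} ∧ G.IsLink g (v i) (v (i + 1)) := fun i => by
      by_cases hi : i < n
      · obtain ⟨g, hg⟩ := hr i hi
        exact ⟨g, fun _ => hg⟩
      · exact ⟨e, fun h => absurd h hi⟩
    choose g hg using this
    -- The cycle consists of the edges `g i` of the walk and, at the last index n, of `e`, which
    -- leads back to `v 0`.
    refine h (Set.range fun i : Fin (n + 1) => if i.val < n then g i else e) ?_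
      ⟨n, fun i => v i, _, ?_, ?_, ?_, rfl⟩
    · rintro _ ⟨i, rfl⟩
      dsimp only
      split_ifs with hi
      · exact (hg i hi).1.1
      · exact he
    · intro i j hij
      exact Fin.ext (hinj i (by omega) j (by omega) hij)
    · intro i j hij
      simp only at hij
      split_ifs at hij with h1 h2 h2
      · have e1 := (hg i h1).2
        have e2 := (hg j h2).2
        rw [hij] at e1
        -- An edge traversed in opposite directions at i and j would give i = j + 1 and i + 1 = j.
        rcases e1.eq_and_eq_or_eq_and_eq e2 with ⟨e3, -⟩ | ⟨e3, e4⟩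
        · exact Fin.ext (hinj _ (by omega) _ (by omega) e3)
        · have := hinj _ (by omega) _ (by omega) e3
          have := hinj _ (by omega) _ (by omega) e4
          omega
      · exact absurd hij (hg i h1).1.2
      · exact absurd hij.symm (hg j h2).1.2
      · exact Fin.ext (by omega)
    · intro i
      dsimp only
      split_ifs with hi
      · rw [Fin.val_add_one_of_lt (by rw [Fin.lt_def]; simpa using hi)]
        exact (hg i hi).2
      · have : i = Fin.last n := Fin.ext (by simp; omega)
        subst this
        simpa using hl.symm
  · rintro h C hC ⟨m, v, e, hv, he, hl, rfl⟩
    refine h (e (Fin.last m)) (hC ⟨_, rfl⟩) (v 0) (v (Fin.last m)) ?_ ?_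
    · simpa using (hl (Fin.last m)).symm
    · have : ∀ i (hi : i < m + 1), Conn G (I \ {e (Fin.last m)}) (v 0) (v ⟨i, hi⟩) := by
        intro i
        induction i with
        | zero => intro _; exact .refl
        | succ i ih =>
          intro hi
          refine (ih (by omega)).tail ⟨e ⟨i, by omega⟩, ⟨hC ⟨_, rfl⟩, fun h => ?_⟩, ?_⟩
          · have := congrArg Fin.val (he h)
            simp only [Fin.val_last] at this
            omega
          · have h1 := hl ⟨i, by omega⟩
            have h2 : (⟨i, by omega⟩ + 1 : Fin (m + 1)) = ⟨i + 1, hi⟩ := by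
              apply Fin.ext
              rw [Fin.val_add_one_of_lt]
              rw [Fin.lt_def]; simp; omega
            rwa [h2] at h1
      exact this m (by omega)

lemma Acyc.mono (h : Acyc G I) (hJ : J ⊆ I) : Acyc G J := fun C hC => h C (hC.trans hJ)

lemma acyc_insert (hg : g ∉ I) (h : G.IsLink g x y) :
    Acyc G (insert g I) ↔ Acyc G I ∧ ¬ Conn G I x y := by
  constructor
  · refine fun hA => ⟨hA.mono (Set.subset_insert _ _), fun hc => ?_⟩
    refine acyc_iff.1 hA g (Set.mem_insert _ _) x y h ?_
    rwa [Set.insert_sdiff_self_of_notMem hg]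
  · rintro ⟨hA, hn⟩
    refine acyc_iff.2 fun k hk a b hl hc => ?_
    rcases Set.mem_insert_iff.1 hk with rfl | hk
    · rw [Set.insert_sdiff_self_of_notMem hg] at hc
      rcases h.eq_and_eq_or_eq_and_eq hl with ⟨rfl, rfl⟩ | ⟨rfl, rfl⟩
      · exact hn hc
      · exact hn hc.symm
    · have hne : g ≠ k := fun h => hg (h ▸ hk)
      rw [Set.insert_sdiff_of_notMem _ (by simpa using hne), conn_insert h] at hc
      have hs : Conn G I a b := .single hk hl
      have hI : I \ {k} ⊆ I := Set.sdiff_subset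
      rcases hc with hc | ⟨h1, h2⟩ | ⟨h1, h2⟩
      · exact acyc_iff.1 hA k hk a b hl hc
      · exact hn ((h1.mono hI).symm.trans (hs.trans (h2.mono hI).symm))
      · exact hn ((h2.mono hI).trans (hs.symm.trans (h1.mono hI)))

lemma acyc_congr (h : ∀ g ∈ J, ∀ x y, G.IsLink g x y ↔ H.IsLink g x y) : Acyc G J ↔ Acyc H J := by
  rw [acyc_iff, acyc_iff]
  refine forall₂_congr fun e he => forall₂_congr fun x y => ?_
  rw [h e he, conn_congr (H := H) fun g hg => h g hg.1]

end Conn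

section Extensions

lemma exists_parallelExtension (G : Graph α β) {e f : β} (hf : f ∉ E(G)) :
    ∃ H : Graph α β, V(H) = V(G) ∧
      ∀ g x y, H.IsLink g x y ↔ G.IsLink g x y ∨ (g = f ∧ G.IsLink e x y) := by
  refine ⟨{ vertexSet := V(G)
            IsLink := fun g x y => G.IsLink g x y ∨ (g = f ∧ G.IsLink e x y)
            isLink_symm := ?_
            eq_or_eq_of_isLink_of_isLink := ?_
            left_mem_of_isLink := ?_ }, rfl, fun _ _ _ => Iff.rfl⟩
  · rintro g -
    exact ⟨fun x y h => h.imp (fun h => h.symm) (fun h => ⟨h.1, h.2.symm⟩)⟩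
  · rintro g x y a b (h | ⟨rfl, h⟩) (h' | ⟨h2, h'⟩)
    · exact h.left_eq_or_eq h'
    · exact absurd (h2 ▸ h.edge_mem) hf
    · exact absurd h'.edge_mem hf
    · exact h.left_eq_or_eq h'
  · rintro g x y (h | ⟨rfl, h⟩)
    exacts [h.left_mem, h.left_mem]

lemma exists_seriesExtension (G : Graph α β) {e f : β} {u v w : α} (he : G.IsLink e u v)
    (hf : f ∉ E(G)) :
    ∃ H : Graph α β, V(H) = insert w V(G) ∧
      ∀ g x y, H.IsLink g x y ↔ (g ≠ e ∧ G.IsLink g x y) ∨ (g = e ∧ s(x, y) = s(u, w)) ∨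
        (g = f ∧ s(x, y) = s(w, v)) := by
  have hef : e ≠ f := fun h => hf (h ▸ he.edge_mem)
  refine ⟨{ vertexSet := insert w V(G)
            IsLink := fun g x y => (g ≠ e ∧ G.IsLink g x y) ∨ (g = e ∧ s(x, y) = s(u, w)) ∨
              (g = f ∧ s(x, y) = s(w, v))
            isLink_symm := ?_
            eq_or_eq_of_isLink_of_isLink := ?_
            left_mem_of_isLink := ?_ }, rfl, fun _ _ _ => Iff.rfl⟩
  · rintro g -
    refine ⟨fun x y h => ?_⟩
    rw [Sym2.eq_swap (a := y)]
    exact h.imp_left fun h => ⟨h.1, h.2.symm⟩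
  · rintro g x y a b (h | ⟨rfl, h⟩ | ⟨rfl, h⟩) (h' | ⟨h2, h'⟩ | ⟨h2, h'⟩)
    · exact h.2.left_eq_or_eq h'.2
    · exact absurd h2 h.1
    · exact absurd (h2 ▸ h.2.edge_mem) hf
    · exact absurd rfl h'.1
    · have := h.trans h'.symm
      rw [Sym2.eq_iff] at this
      tauto
    · exact absurd h2 hef
    · exact absurd h'.2.edge_mem hf
    · exact absurd h2.symm hef
    · have := h.trans h'.symm
      rw [Sym2.eq_iff] at this
      tauto
  · rintro g x y (h | ⟨rfl, h⟩ | ⟨rfl, h⟩)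
    · exact Set.mem_insert_of_mem _ h.2.left_mem
    · rw [Sym2.eq_iff] at h
      rcases h with ⟨rfl, -⟩ | ⟨rfl, -⟩
      exacts [Set.mem_insert_of_mem _ he.left_mem, Set.mem_insert _ _]
    · rw [Sym2.eq_iff] at h
      rcases h with ⟨rfl, -⟩ | ⟨rfl, -⟩
      exacts [Set.mem_insert _ _, Set.mem_insert_of_mem _ he.right_mem]

variable [DecidableEq β]

/-- Independence in the cycle matroid. -/
def GraphIndep (G : Graph α β) (I : Finset β) : Prop := (I : Set β) ⊆ E(G) ∧ Acyc G I

/-- The effect on edge sets of contracting a parallel (`b = true`) or series (`b = false`) class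
`{e, f}` to the single edge `e`. -/
def extMap (b : Bool) (e f : β) (I : Finset β) : Finset β :=
  if f ∈ I then (if b then insert e (I.erase f) else I.erase f)
  else if b then I else I.erase e

/-- Independence after adding `f` in parallel (`b = true`) or in series (`b = false`) with `e`. -/
def ExtIndep (b : Bool) (J : Finset β → Prop) (e f : β) (I : Finset β) : Prop :=
  (b = true → ¬ (e ∈ I ∧ f ∈ I)) ∧ J (extMap b e f I)

lemma extIndep_true {J : Finset β → Prop} {e f : β} {I : Finset β} : ExtIndep true J e f I ↔
    if f ∈ I then e ∉ I ∧ J (insert e (I.erase f)) else J I := by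
  unfold ExtIndep extMap
  split_ifs <;> simp_all

lemma extIndep_false {J : Finset β → Prop} {e f : β} {I : Finset β} : ExtIndep false J e f I ↔
    if f ∈ I then J (I.erase f) else J (I.erase e) := by
  unfold ExtIndep extMap
  split_ifs <;> simp_all

/-- The edges e and f have the same ends, so together they form a cycle, and by `acyc_insert` f
alone behaves as e would. -/
lemma graphIndep_parallel {G H : Graph α β} {e f : β} (he : e ∈ E(G)) (hf : f ∉ E(G))
    (hH : ∀ g x y, H.IsLink g x y ↔ G.IsLink g x y ∨ (g = f ∧ G.IsLink e x y)) (I : Finset β) :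
    E(H) = insert f E(G) ∧ (GraphIndep H I ↔ ExtIndep true (GraphIndep G) e f I) := by
  obtain ⟨x, y, hxy⟩ := G.exists_isLink_of_mem_edgeSet he
  have hE : E(H) = insert f E(G) := by
    ext g
    rw [H.edge_mem_iff_exists_isLink, Set.mem_insert_iff, G.edge_mem_iff_exists_isLink]
    simp only [hH]
    constructor
    · rintro ⟨a, b, h | h⟩
      exacts [Or.inr ⟨a, b, h⟩, Or.inl h.1]
    · rintro (rfl | ⟨a, b, h⟩)
      exacts [⟨x, y, Or.inr ⟨rfl, hxy⟩⟩, ⟨a, b, Or.inl h⟩]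
  refine ⟨hE, ?_⟩
  have hfl : H.IsLink f x y := (hH f x y).2 (Or.inr ⟨rfl, hxy⟩)
  have hcong {J : Set β} (hJ : f ∉ J) : ∀ g ∈ J, ∀ x y, H.IsLink g x y ↔ G.IsLink g x y :=
    fun g hg a b => by
      rw [hH, or_iff_left]
      rintro ⟨rfl, -⟩
      exact hJ hg
  have hef : e ≠ f := fun h => hf (h ▸ he)
  rw [extIndep_true]
  unfold GraphIndep
  rw [hE]
  split_ifs with hfI
  · obtain ⟨J, hJ, rfl⟩ : ∃ J, f ∉ J ∧ insert f J = I := ⟨_, Finset.notMem_erase f I,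
      Finset.insert_erase hfI⟩
    have hJ' : f ∉ (J : Set β) := hJ
    rw [Finset.erase_insert hJ, Finset.coe_insert, Finset.coe_insert]
    by_cases heJ : e ∈ J
    · refine ⟨fun h => ?_, fun h => absurd (Finset.mem_insert_of_mem heJ) h.1⟩
      have := (acyc_insert hJ' hfl).1 h.2
      exact absurd (.single heJ ((hH e x y).2 (Or.inl hxy))) this.2
    · have heJ' : e ∉ (J : Set β) := heJ
      rw [acyc_insert hJ' hfl, acyc_insert heJ' hxy, acyc_congr (hcong hJ'),
        conn_congr (hcong hJ')]
      have h1 : (insert f (J : Set β) ⊆ insert f E(G)) ↔ (insert e (J : Set β) ⊆ E(G)) := by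
        constructor
        · intro h
          refine Set.insert_subset he fun g hg => ?_
          exact ((h (Set.mem_insert_of_mem _ hg)).resolve_left fun h => hJ (h ▸ hg))
        · exact fun h => Set.insert_subset_insert ((Set.subset_insert _ _).trans h)
      simp [h1, hef, heJ]
  · have hJ' : f ∉ (I : Set β) := hfI
    rw [acyc_congr (hcong hJ'), Set.subset_insert_iff_of_notMem hJ']

/-- Only e and f meet the new vertex w. If one of them is absent, the other is pendant and
irrelevant for cycles; if both are present, they act together as the old edge e. -/
lemma graphIndep_series {G H : Graph α β} {e f : β} {u v w : α} (he : G.IsLink e u v)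
    (hf : f ∉ E(G)) (hw : w ∉ V(G))
    (hH : ∀ g x y, H.IsLink g x y ↔ (g ≠ e ∧ G.IsLink g x y) ∨ (g = e ∧ s(x, y) = s(u, w)) ∨
      (g = f ∧ s(x, y) = s(w, v))) (I : Finset β) :
    E(H) = insert f E(G) ∧ (GraphIndep H I ↔ ExtIndep false (GraphIndep G) e f I) := by
  have heG := he.edge_mem
  have hef : e ≠ f := fun h => hf (h ▸ heG)
  have hel : H.IsLink e u w := (hH e u w).2 (Or.inr (Or.inl ⟨rfl, rfl⟩))
  have hfl : H.IsLink f w v := (hH f w v).2 (Or.inr (Or.inr ⟨rfl, rfl⟩))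
  have hE : E(H) = insert f E(G) := by
    ext g
    rw [H.edge_mem_iff_exists_isLink, Set.mem_insert_iff, G.edge_mem_iff_exists_isLink]
    constructor
    · rintro ⟨a, b, h⟩
      rcases (hH g a b).1 h with h | h | h
      exacts [Or.inr ⟨a, b, h.2⟩, Or.inr ⟨u, v, h.1 ▸ he⟩, Or.inl h.1]
    · rintro (rfl | ⟨a, b, h⟩)
      · exact ⟨_, _, hfl⟩
      · by_cases hg : g = e
        · subst hg; exact ⟨_, _, hel⟩
        · exact ⟨a, b, (hH g a b).2 (Or.inl ⟨hg, h⟩)⟩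
  refine ⟨hE, ?_⟩
  have hcong {J : Set β} (heJ : e ∉ J) (hJ : f ∉ J) :
      ∀ g ∈ J, ∀ x y, H.IsLink g x y ↔ G.IsLink g x y := fun g hg a b => by
    have h1 : g ≠ e := fun h => heJ (h ▸ hg)
    have h2 : g ≠ f := fun h => hJ (h ▸ hg)
    rw [hH]; simp [h1, h2]
  have hiso {J : Set β} (heJ : e ∉ J) (hJ : f ∉ J) : ∀ g ∈ J, ∀ y, ¬ H.IsLink g w y :=
    fun g hg y h => hw ((hcong heJ hJ g hg w y).1 h).left_mem
  have huw : u ≠ w := fun h => hw (h ▸ he.left_mem)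
  have hvw : v ≠ w := fun h => hw (h ▸ he.right_mem)
  rw [extIndep_false]
  unfold GraphIndep
  rw [hE]
  obtain ⟨J, heJ, hfJ, hI⟩ : ∃ J : Finset β, e ∉ J ∧ f ∉ J ∧
      (I = J ∨ I = insert e J ∨ I = insert f J ∨ I = insert f (insert e J)) := by
    refine ⟨(I.erase e).erase f, by simp, by simp, ?_⟩
    by_cases h1 : e ∈ I <;> by_cases h2 : f ∈ I
    · refine Or.inr (Or.inr (Or.inr ?_)); ext x; grind
    · refine Or.inr (Or.inl ?_); ext x; grind
    · refine Or.inr (Or.inr (Or.inl ?_)); ext x; grind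
    · refine Or.inl ?_; ext x; grind
  have heJ' : e ∉ (J : Set β) := heJ
  have hfJ' : f ∉ (J : Set β) := hfJ
  have hA := acyc_congr (hcong heJ' hfJ')
  have hC := conn_congr (hcong heJ' hfJ')
  have hsub : ((J : Set β) ⊆ insert f E(G)) ↔ (J : Set β) ⊆ E(G) :=
    Set.subset_insert_iff_of_notMem hfJ'
  have n1 : ¬ Conn H J u w := fun h => huw (h.symm.eq_of_isolated (hiso heJ' hfJ'))
  have n2 : ¬ Conn H J w v := fun h => hvw (h.eq_of_isolated (hiso heJ' hfJ'))
  have n3 : ¬ Conn H J w u := fun h => n1 h.symm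
  rcases hI with rfl | rfl | rfl | rfl
  · rw [if_neg hfJ, Finset.erase_eq_of_notMem heJ, hA, hsub]
  · rw [if_neg (by simp [hef.symm, hfJ]), Finset.erase_insert heJ, Finset.coe_insert,
      acyc_insert heJ' hel, hA, Set.insert_subset_iff, hsub]
    simp [n1, heG]
  · rw [if_pos (Finset.mem_insert_self _ _), Finset.erase_insert hfJ, Finset.coe_insert,
      acyc_insert hfJ' hfl, hA, Set.insert_subset_iff, hsub]
    simp [n2]
  · have hf2 : f ∉ insert e J := by simp [hef.symm, hfJ]
    have hf3 : f ∉ insert e (J : Set β) := by simpa [hef.symm] using hfJ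
    rw [if_pos (Finset.mem_insert_self _ _), Finset.erase_insert hf2, Finset.coe_insert,
      Finset.coe_insert, acyc_insert hf3 hfl, acyc_insert heJ' hel, acyc_insert heJ' he, hA,
      conn_insert hel, Set.insert_subset_iff, Set.insert_subset_iff, Set.insert_subset_iff, hsub, hC]
    rw [hC] at n1 n2 n3
    have : Conn G J w w := .refl
    simp [n1, n2, n3, heG, this]

end Extensions

end SeriesParallel

/-! ### Extensions inside a network, and the augmentation property. -/

namespace SeriesParallel

variable {β : Type*}

lemma Net.con_leaf {a : β} {I : Finset β} : (Net.leaf a).con I ↔ a ∈ I := by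
  simp [Net.con, Net.leaf]

variable [DecidableEq β]

section ExtMap

variable {b : Bool} {e f : β} {I S T : Finset β}

lemma extMap_inter (he : e ∈ S) :
    extMap b e f (I ∩ insert f S) = extMap b e f I ∩ S := by
  unfold extMap; ext x; cases b <;> grind

lemma extMap_inter_of_notMem (he : e ∉ T) (hf : f ∉ T) : extMap b e f I ∩ T = I ∩ T := by
  unfold extMap; ext x; cases b <;> grind

lemma extMap_subset_iff (he : e ∈ S) : extMap b e f I ⊆ S ↔ I ⊆ insert f S := by
  unfold extMap; simp only [Finset.subset_iff]; cases b <;> grind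

lemma extMap_erase {a : β} (he : a ≠ e) (hf : a ≠ f) :
    extMap b e f (I.erase a) = (extMap b e f I).erase a := by
  unfold extMap; ext x; cases b <;> grind

lemma mem_extMap {a : β} (he : a ≠ e) (hf : a ≠ f) : a ∈ extMap b e f I ↔ a ∈ I := by
  unfold extMap; cases b <;> grind

end ExtMap

/-- `D'` is obtained from `D` by adding `f` in parallel or in series with `e`. -/
structure NetExt (b : Bool) (e f : β) (D D' : Net β) : Prop where
  mem : e ∈ D.supp
  notMem : f ∉ D.supp
  supp_eq : D'.supp = insert f D.supp
  ind_iff : ∀ I, D'.ind I ↔ ExtIndep b D.ind e f I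
  con_iff : ∀ I, D'.con I ↔ D.con (extMap b e f I)

namespace Net

/-- Composition in parallel or in series. -/
def comp (b : Bool) (D E : Net β) : Net β := if b then par D E else ser D E

lemma comp_comm (b : Bool) (D E : Net β) : comp b D E = comp b E D := by
  cases b
  exacts [ser_comm D E, par_comm D E]

lemma supp_comp (b : Bool) (D E : Net β) : (comp b D E).supp = D.supp ∪ E.supp := by
  cases b <;> rfl

lemma ind_comp {b : Bool} {D E : Net β} {I : Finset β} : (comp b D E).ind I ↔
    I ⊆ D.supp ∪ E.supp ∧ D.ind (I ∩ D.supp) ∧ E.ind (I ∩ E.supp) ∧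
      (b = true → ¬ (D.con (I ∩ D.supp) ∧ E.con (I ∩ E.supp))) := by
  cases b <;> simp [comp, ser, par]

lemma con_comp {b : Bool} {D E : Net β} {I : Finset β} (hD : IsNet D) (hE : IsNet E)
    (h : Disjoint D.supp E.supp) :
    (comp b D E).con I ↔ if b then D.con I ∨ E.con I else D.con I ∧ E.con I := by
  cases b
  · simp [comp, hD.con_ser hE h]
  · simp [comp, con_par]

end Net

lemma IsNet.comp {D E : Net β} (b : Bool) (hD : IsNet D) (hE : IsNet E)
    (h : Disjoint D.supp E.supp) : IsNet (Net.comp b D E) := by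
  cases b
  exacts [.ser D E hD hE h, .par D E hD hE h]

/-- An extension inside one factor is an extension of the whole composite, so extensions can be
made, and undone, at any depth of a network. -/
lemma NetExt.comp {b c : Bool} {e f : β} {D D' E : Net β} (h : NetExt b e f D D') (hD : IsNet D)
    (hD' : IsNet D') (hE : IsNet E) (hd : Disjoint D'.supp E.supp) :
    NetExt b e f (Net.comp c D E) (Net.comp c D' E) := by
  have hs := h.supp_eq
  have hd0 : Disjoint D.supp E.supp := hd.mono_left (hs ▸ Finset.subset_insert _ _)
  have heE : e ∉ E.supp := Finset.disjoint_left.1 hd0 h.mem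
  have hfE : f ∉ E.supp := Finset.disjoint_left.1 hd (hs ▸ Finset.mem_insert_self _ _)
  have hf : f ∉ D.supp ∪ E.supp := by simp [h.notMem, hfE]
  have he : e ∈ D.supp ∪ E.supp := Finset.mem_union_left _ h.mem
  have h1 (I : Finset β) := extMap_inter (b := b) (f := f) (I := I) h.mem
  have h2 (I : Finset β) := extMap_inter_of_notMem (b := b) (I := I) heE hfE
  have h3 (I : Finset β) : I ⊆ D'.supp ∪ E.supp ↔ extMap b e f I ⊆ D.supp ∪ E.supp := by
    rw [extMap_subset_iff he, hs, Finset.insert_union]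
  have h4 (I : Finset β) : D'.ind (I ∩ D'.supp) ↔
      (b = true → ¬ (e ∈ I ∧ f ∈ I)) ∧ D.ind (extMap b e f I ∩ D.supp) := by
    rw [h.ind_iff, ExtIndep, hs, h1]
    simp [h.mem]
  have h5 (I : Finset β) : D'.con (I ∩ D'.supp) ↔ D.con (extMap b e f I ∩ D.supp) := by
    rw [h.con_iff, hs, h1]
  have h6 (I : Finset β) : D'.con I ↔ D.con (extMap b e f I) := h.con_iff I
  have h7 (I : Finset β) : E.con I ↔ E.con (extMap b e f I) := by
    rw [← hE.con_inter, ← h2, hE.con_inter]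
  refine ⟨?_, ?_, ?_, ?_, ?_⟩
  · rwa [Net.supp_comp]
  · rwa [Net.supp_comp]
  · rw [Net.supp_comp, Net.supp_comp, hs, Finset.insert_union]
  · intro I
    simp only [Net.ind_comp, ExtIndep]
    rw [h3, h4, h5, h2]
    tauto
  · intro I
    rw [Net.con_comp hD' hE hd, Net.con_comp hD hE hd0, h6, h7]

lemma netExt_leaf {b : Bool} {e f : β} (h : e ≠ f) :
    NetExt b e f (Net.leaf e) (Net.comp b (Net.leaf e) (Net.leaf f)) := by
  have hd : Disjoint (Net.leaf e).supp (Net.leaf f).supp := by simpa [Net.leaf] using h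
  refine ⟨by simp [Net.leaf], by simp [Net.leaf, h.symm], ?_, ?_, ?_⟩
  · rw [Net.supp_comp]; ext x; simp [Net.leaf, or_comm]
  · intro I
    simp only [Net.ind_comp, Net.con_leaf, ExtIndep, extMap]
    simp only [Net.leaf, Finset.subset_iff]
    cases b <;> grind
  · intro I
    rw [Net.con_comp (.leaf e) (.leaf f) hd]
    simp only [Net.con_leaf, extMap]
    cases b <;> grind

/-- An edge of a network can be replaced by two edges in parallel or in series. -/
lemma IsNet.exists_ext {D : Net β} (hD : IsNet D) (b : Bool) {e f : β} (he : e ∈ D.supp)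
    (hf : f ∉ D.supp) : ∃ D', IsNet D' ∧ NetExt b e f D D' := by
  have step (c : Bool) (D E : Net β) (hD : IsNet D) (hE : IsNet E) (hd : Disjoint D.supp E.supp)
      (hf : f ∉ D.supp ∪ E.supp) (ih : ∃ D', IsNet D' ∧ NetExt b e f D D') :
      ∃ D', IsNet D' ∧ NetExt b e f (Net.comp c D E) D' := by
    obtain ⟨D', hD', h⟩ := ih
    have hd' : Disjoint D'.supp E.supp := by
      rw [h.supp_eq, Finset.disjoint_insert_left]
      exact ⟨fun h => hf (Finset.mem_union_right _ h), hd⟩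
    exact ⟨_, hD'.comp c hE hd', h.comp hD hD' hE hd'⟩
  have step' (c : Bool) (D E : Net β) (hD : IsNet D) (hE : IsNet E) (hd : Disjoint D.supp E.supp)
      (ihD : e ∈ D.supp → f ∉ D.supp → ∃ D', IsNet D' ∧ NetExt b e f D D')
      (ihE : e ∈ E.supp → f ∉ E.supp → ∃ D', IsNet D' ∧ NetExt b e f E D')
      (he : e ∈ D.supp ∪ E.supp) (hf : f ∉ D.supp ∪ E.supp) :
      ∃ D', IsNet D' ∧ NetExt b e f (Net.comp c D E) D' := by
    have hf' := hf
    rw [Finset.mem_union, not_or] at hf'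
    rcases Finset.mem_union.1 he with he | he
    · exact step c D E hD hE hd hf (ihD he hf'.1)
    · rw [Net.comp_comm]
      exact step c E D hE hD hd.symm (by rwa [Finset.union_comm]) (ihE he hf'.2)
  induction hD with
  | leaf a =>
    obtain rfl : e = a := Finset.mem_singleton.1 he
    have hne : e ≠ f := fun h => hf (h ▸ he)
    exact ⟨_, (IsNet.leaf e).comp b (.leaf f) (by simpa [Net.leaf] using hne), netExt_leaf hne⟩
  | ser D E hD hE hd h1 h2 => exact step' false D E hD hE hd h1 h2 he hf
  | par D E hD hE hd h1 h2 => exact step' true D E hD hE hd h1 h2 he hf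

/-- A network with at least two edges has two edges in parallel or in series. -/
lemma IsNet.eq_leaf_or_exists_ext {D : Net β} (hD : IsNet D) : (∃ a, D = Net.leaf a) ∨
    ∃ b e f D₀, IsNet D₀ ∧ NetExt b e f D₀ D := by
  have step (c : Bool) (D E : Net β) (hD : IsNet D) (hE : IsNet E) (hd : Disjoint D.supp E.supp)
      (ih : ∃ b e f D₀, IsNet D₀ ∧ NetExt b e f D₀ D) :
      ∃ b e f D₀, IsNet D₀ ∧ NetExt b e f D₀ (Net.comp c D E) := by
    obtain ⟨b, e, f, D₀, h0, h⟩ := ih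
    exact ⟨b, e, f, _, h0.comp c hE (hd.mono_left (h.supp_eq ▸ Finset.subset_insert _ _)),
      h.comp h0 hD hE hd⟩
  have step' (c : Bool) (D E : Net β) (hD : IsNet D) (hE : IsNet E) (hd : Disjoint D.supp E.supp)
      (ihD : (∃ a, D = Net.leaf a) ∨ ∃ b e f D₀, IsNet D₀ ∧ NetExt b e f D₀ D)
      (ihE : (∃ a, E = Net.leaf a) ∨ ∃ b e f D₀, IsNet D₀ ∧ NetExt b e f D₀ E) :
      ∃ b e f D₀, IsNet D₀ ∧ NetExt b e f D₀ (Net.comp c D E) := by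
    rcases ihD with ⟨x, rfl⟩ | ihD
    · rcases ihE with ⟨y, rfl⟩ | ihE
      · exact ⟨c, x, y, _, .leaf x, netExt_leaf (by simpa [Net.leaf] using hd)⟩
      · rw [Net.comp_comm]
        exact step c E _ hE hD hd.symm ihE
    · exact step c D E hD hE hd ihD
  induction hD with
  | leaf a => exact Or.inl ⟨a, rfl⟩
  | ser D E hD hE hd h1 h2 => exact Or.inr (step' false D E hD hE hd h1 h2)
  | par D E hD hE hd h1 h2 => exact Or.inr (step' true D E hD hE hd h1 h2)

/-- Independence in the cycle matroid of the graph obtained from a network by joining its terminals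
by the edge `e₀`. -/
def NetIndep (D : Net β) (e₀ : β) (I : Finset β) : Prop :=
  D.ind (I.erase e₀) ∧ (e₀ ∈ I → ¬ D.con (I.erase e₀))

lemma NetExt.netIndep {b : Bool} {e f e₀ : β} {D D' : Net β} (h : NetExt b e f D D')
    (h0 : e₀ ∉ D'.supp) (I : Finset β) :
    NetIndep D' e₀ I ↔ ExtIndep b (NetIndep D e₀) e f I := by
  have h1 : e₀ ≠ e := fun he => h0 (by rw [h.supp_eq, he]; exact Finset.mem_insert_of_mem h.mem)
  have h2 : e₀ ≠ f := fun he => h0 (by rw [h.supp_eq, he]; exact Finset.mem_insert_self _ _)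
  simp only [NetIndep, ExtIndep, h.ind_iff, h.con_iff, extMap_erase h1 h2, mem_extMap h1 h2,
    Finset.mem_erase, h1.symm, h2.symm, ne_eq, not_false_eq_true, true_and, and_assoc]

lemma IsNet.con_erase {D : Net β} (hD : IsNet D) {a : β} (ha : a ∉ D.supp) (I : Finset β) :
    D.con (I.erase a) ↔ D.con I := by
  rw [← hD.con_inter, Finset.erase_inter, Finset.erase_eq_of_notMem (by simp [ha]), hD.con_inter]

/-- Extending the closing edge `e` itself amounts to composing the network with the new edge. This
lemma and `extIndep_netIndep_iff` arrive at one normal form; as it is symmetric in `e` and `f`,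
either of the two can serve as the closing edge afterwards. -/
lemma netIndep_comp_leaf_iff {b : Bool} {e f : β} {D : Net β} (hD : IsNet D) (he : e ∉ D.supp)
    (hf : f ∉ D.supp) (hne : e ≠ f) (I : Finset β) :
    NetIndep (Net.comp b D (Net.leaf f)) e I ↔ D.ind ((I.erase e).erase f) ∧
      (b = true → ¬ (e ∈ I ∧ f ∈ I)) ∧
      ((if b then e ∈ I ∨ f ∈ I else e ∈ I ∧ f ∈ I) → ¬ D.con I) := by
  have hd : Disjoint D.supp (Net.leaf f).supp := by simpa [Net.leaf] using hf
  have h1 : I.erase e ⊆ D.supp ∪ (Net.leaf f).supp ∧ D.ind (I.erase e ∩ D.supp) ↔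
      D.ind ((I.erase e).erase f) := by
    constructor
    · rintro ⟨h, h'⟩
      convert h' using 1
      ext x
      have := @h x
      simp only [Net.leaf] at this
      grind
    · intro h
      have hs := hD.ind_subset h
      have : I.erase e ∩ D.supp = (I.erase e).erase f := by
        ext x
        have := @hs x
        grind
      refine ⟨fun x hx => ?_, this ▸ h⟩
      have := @hs x
      simp only [Net.leaf]
      grind
  have h2 : (Net.leaf f).ind (I.erase e ∩ (Net.leaf f).supp) := Finset.inter_subset_right
  have h3 : f ∈ I.erase e ↔ f ∈ I := by simp [hne.symm]
  rw [NetIndep, Net.ind_comp, Net.con_comp hD (.leaf f) hd, ← and_assoc, ← and_assoc, h1,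
    hD.con_inter, (IsNet.leaf f).con_inter, hD.con_erase he, Net.con_leaf, h3]
  cases b <;> simp only [h2] <;> grind

lemma extIndep_netIndep_iff {b : Bool} {e f : β} {D : Net β} (hD : IsNet D) (he : e ∉ D.supp)
    (hf : f ∉ D.supp) (hne : e ≠ f) (I : Finset β) :
    ExtIndep b (NetIndep D e) e f I ↔ D.ind ((I.erase e).erase f) ∧
      (b = true → ¬ (e ∈ I ∧ f ∈ I)) ∧
      ((if b then e ∈ I ∨ f ∈ I else e ∈ I ∧ f ∈ I) → ¬ D.con I) := by
  have h1 : (extMap b e f I).erase e = (I.erase e).erase f := by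
    unfold extMap; ext x; cases b <;> grind
  have h2 : e ∈ extMap b e f I ↔ if b then e ∈ I ∨ f ∈ I else e ∈ I ∧ f ∈ I := by
    unfold extMap; cases b <;> grind
  rw [ExtIndep, NetIndep, h1, h2, hD.con_erase hf, hD.con_erase he]
  tauto

lemma netIndep_comp_leaf {b : Bool} {e f : β} {D : Net β} (hD : IsNet D) (he : e ∉ D.supp)
    (hf : f ∉ D.supp) (hne : e ≠ f) (I : Finset β) :
    NetIndep (Net.comp b D (Net.leaf f)) e I ↔ ExtIndep b (NetIndep D e) e f I := by
  rw [netIndep_comp_leaf_iff hD he hf hne, extIndep_netIndep_iff hD he hf hne]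

lemma netIndep_comp_leaf_swap {b : Bool} {e f : β} {D : Net β} (hD : IsNet D) (he : e ∉ D.supp)
    (hf : f ∉ D.supp) (hne : e ≠ f) (I : Finset β) :
    NetIndep (Net.comp b D (Net.leaf e)) f I ↔ ExtIndep b (NetIndep D e) e f I := by
  rw [netIndep_comp_leaf_iff hD hf he hne.symm, extIndep_netIndep_iff hD he hf hne,
    Finset.erase_right_comm, and_comm (a := f ∈ I), or_comm (a := f ∈ I)]

/-- The augmentation property of independent sets. -/
def Aug (J : Finset β → Prop) : Prop :=
  ∀ ⦃I K⦄, J I → J K → I.card < K.card → ∃ x ∈ K, x ∉ I ∧ J (insert x I)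

/-- Augmentation is pulled back along `extMap`. In the parallel case this map preserves the size of
admissible sets; in the series case it loses one element exactly on the sets meeting {e, f}. -/
lemma Aug.extIndep {J : Finset β → Prop} (h : Aug J) (b : Bool) {e f : β} (hne : e ≠ f) :
    Aug (ExtIndep b J e f) := by
  rintro I K ⟨gI, hI⟩ ⟨gK, hK⟩ hc
  have lift {x : β} (hx : x ≠ e) (hxI : x ∈ extMap b e f K) (hxI' : x ∉ extMap b e f I)
      (hJ : J (insert x (extMap b e f I))) : ∃ x ∈ K, x ∉ I ∧ ExtIndep b J e f (insert x I) := by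
    have hxf : x ≠ f := by
      rintro rfl
      unfold extMap at hxI; cases b <;> grind
    have e1 : extMap b e f (insert x I) = insert x (extMap b e f I) := by
      unfold extMap; ext y; cases b <;> grind
    refine ⟨x, (mem_extMap hx hxf).1 hxI, fun h => hxI' ((mem_extMap hx hxf).2 h), ?_, e1 ▸ hJ⟩
    simpa [hx.symm, hxf.symm] using gI
  cases b
  -- Here the element of {e, f} in `K` can be added at once: one edge of a series pair does not
  -- change the image under `extMap`. In the other case `I` meets {e, f} whenever `K` does, and the
  -- inequality of sizes passes to the images.
  · by_cases h0 : e ∉ I ∧ f ∉ I ∧ (e ∈ K ∨ f ∈ K)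
    · obtain ⟨h1, h2, h3⟩ := h0
      have e1 : extMap false e f I = I := by unfold extMap; ext y; grind
      rcases h3 with h3 | h3
      · refine ⟨e, h3, h1, by simp, ?_⟩
        convert hI using 1
        unfold extMap; ext y; grind
      · refine ⟨f, h3, h2, by simp, ?_⟩
        convert hI using 1
        unfold extMap; ext y; grind
    · have card (I : Finset β) : (extMap false e f I).card + 1 = I.card ∧ (e ∈ I ∨ f ∈ I) ∨
          (extMap false e f I).card = I.card ∧ e ∉ I ∧ f ∉ I := by
        unfold extMap
        by_cases hf : f ∈ I
        · simpa [hf] using Finset.card_erase_add_one hf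
        · by_cases he : e ∈ I
          · simpa [hf, he] using Finset.card_erase_add_one he
          · simp [hf, he]
      have hlt : (extMap false e f I).card < (extMap false e f K).card := by
        have hI' := card I
        have hK' := card K
        generalize (extMap false e f I).card = i at *
        generalize (extMap false e f K).card = k at *
        rcases hI' with hI' | hI'
        · omega
        · have : e ∉ K ∧ f ∉ K := by tauto
          rcases hK' with hK' | hK'
          · exact absurd hK'.2 (by tauto)
          · omega
      obtain ⟨x, hx, hx', hJ⟩ := h hI hK hlt
      by_cases hxe : x = e
      · subst hxe
        have hcase : (x ∈ I ∧ f ∉ I) ∨ (x ∉ I ∧ f ∈ I) := by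
          unfold extMap at hx hx'; grind
        rcases hcase with ⟨h1, h2⟩ | ⟨h1, h2⟩
        · refine ⟨f, by unfold extMap at hx; grind, h2, by simp, ?_⟩
          convert hJ using 1
          unfold extMap; ext y; grind
        · refine ⟨x, by unfold extMap at hx; grind, h1, by simp, ?_⟩
          convert hJ using 1
          unfold extMap; ext y; grind
      · exact lift hxe hx hx' hJ
  · have card (I : Finset β) (h : ¬ (e ∈ I ∧ f ∈ I)) : (extMap true e f I).card = I.card := by
      unfold extMap
      by_cases hf : f ∈ I
      · have := Finset.card_pos.2 ⟨f, hf⟩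
        have he : e ∉ I.erase f := by simp; tauto
        simp only [hf, if_true]
        rw [Finset.card_insert_of_notMem he, Finset.card_erase_of_mem hf]; omega
      · simp [hf]
    have gI' := gI rfl
    have gK' := gK rfl
    obtain ⟨x, hx, hx', hJ⟩ := h hI hK (by rwa [card I gI', card K gK'])
    by_cases hxe : x = e
    · subst hxe
      have h1 : x ∉ I := by unfold extMap at hx'; grind
      have h2 : f ∉ I := by unfold extMap at hx'; grind
      by_cases h3 : x ∈ K
      · refine ⟨x, h3, h1, by grind, ?_⟩
        convert hJ using 1
        unfold extMap; ext y; grind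
      · refine ⟨f, by unfold extMap at hx; grind, h2, by grind, ?_⟩
        convert hJ using 1
        unfold extMap; ext y; grind
    · exact lift hxe hx hx' hJ

lemma netIndep_leaf {a e₀ : β} (h : a ≠ e₀) (I : Finset β) :
    NetIndep (Net.leaf a) e₀ I ↔ I ⊆ {e₀, a} ∧ ¬ (e₀ ∈ I ∧ a ∈ I) := by
  rw [NetIndep, Net.con_leaf]
  simp only [Net.leaf, Finset.subset_iff]
  grind

/-- Induction by undoing one extension, down to a 2-cycle. This is the exchange axiom from which
`exists_isSeriesParallelMatroid` builds a matroid. -/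
lemma IsNet.aug_netIndep {D : Net β} (hD : IsNet D) {e₀ : β} (h0 : e₀ ∉ D.supp) :
    Aug (NetIndep D e₀) := by
  induction hc : D.supp.card generalizing D with
  | zero => exact absurd hD.supp_nonempty (by simpa using hc)
  | succ n ih =>
    rcases hD.eq_leaf_or_exists_ext with ⟨a, rfl⟩ | ⟨b, e, f, E, hE, h⟩
    · have hne : a ≠ e₀ := by rintro rfl; simp [Net.leaf] at h0
      intro I K hI hK hlt
      rw [netIndep_leaf hne] at hI hK
      have hK1 : K.card ≤ 1 := by
        rw [Finset.card_le_one]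
        intro x hx y hy
        have := hK.1 hx
        have := hK.1 hy
        grind
      obtain rfl : I = ∅ := by rw [← Finset.card_eq_zero]; omega
      obtain ⟨x, hx⟩ := Finset.card_pos.1 (by omega : 0 < K.card)
      refine ⟨x, hx, by simp, (netIndep_leaf hne _).2 ⟨?_, ?_⟩⟩
      · simpa using hK.1 hx
      · simp only [Finset.insert_empty, Finset.mem_singleton]
        grind
    · have hs := h.supp_eq
      have he0 : e₀ ∉ E.supp := fun hh => h0 (hs ▸ Finset.mem_insert_of_mem hh)
      have hcE : E.supp.card = n := by
        rw [hs, Finset.card_insert_of_notMem h.notMem] at hc; omega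
      have := (ih hE he0 hcE).extIndep b (fun hh => h.notMem (hh ▸ h.mem) : e ≠ f)
      rwa [show NetIndep D e₀ = ExtIndep b (NetIndep E e₀) e f from
        funext fun I => propext (h.netIndep h0 I)]

end SeriesParallel

/-! ### Correspondence between series-parallel graphs and networks. -/

namespace SeriesParallel

section Correspondence

variable {α β : Type*} [DecidableEq β]

/-- The network `D`, with its terminals joined by the edge `e₀`, has the same cycle matroid
as `G`. -/
structure Represents (G : Graph α β) (D : Net β) (e₀ : β) : Prop where
  edgeSet_eq : E(G) = insert e₀ (D.supp : Set β)
  notMem : e₀ ∉ D.supp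
  isNet : IsNet D
  indep_iff : ∀ I, GraphIndep G I ↔ NetIndep D e₀ I

lemma represents_banana {u v : α} (huv : u ≠ v) {e f : β} (hef : e ≠ f) :
    Represents (Graph.banana u v {e, f}) (Net.leaf e) f := by
  refine ⟨?_, by simpa [Net.leaf] using hef.symm, .leaf e, fun I => ?_⟩
  · simp [Net.leaf, Set.pair_comm]
  · have he : (Graph.banana u v {e, f}).IsLink e u v := by simp
    have hf : (Graph.banana u v {e, f}).IsLink f u v := by simp
    have h0 : Acyc (Graph.banana u v {e, f}) ∅ := acyc_iff.2 (by simp)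
    have n0 : ¬ Conn (Graph.banana u v {e, f}) ∅ u v := fun h =>
      huv (h.eq_of_isolated (by simp)).symm
    have h1 : Acyc (Graph.banana u v {e, f}) {e} := by
      simpa using (acyc_insert (Set.notMem_empty e) he).2 ⟨h0, n0⟩
    have h2 : Acyc (Graph.banana u v {e, f}) {f} := by
      simpa using (acyc_insert (Set.notMem_empty f) hf).2 ⟨h0, n0⟩
    have h3 : ¬ Acyc (Graph.banana u v {e, f}) {e, f} := by
      rw [acyc_insert (by simpa using hef) he]
      exact fun h => h.2 (.single rfl hf)
    rw [netIndep_leaf hef, GraphIndep, Finset.pair_comm f e, and_comm (a := f ∈ I)]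
    have hE : (I : Set β) ⊆ E(Graph.banana u v {e, f}) ↔ I ⊆ {e, f} := by
      rw [← Finset.coe_subset]; simp
    rw [hE]
    refine and_congr_right fun hI => ?_
    by_cases he' : e ∈ I <;> by_cases hf' : f ∈ I
    · obtain rfl : I = {e, f} := by ext x; have := @hI x; grind
      simpa using h3
    · obtain rfl : I = {e} := by ext x; have := @hI x; grind
      simpa [hf'] using h1
    · obtain rfl : I = {f} := by ext x; have := @hI x; grind
      simpa [he'] using h2
    · obtain rfl : I = ∅ := by ext x; have := @hI x; grind
      simpa using h0

/-- All closing edges must be treated at once: if `e₀` is neither e nor f the extension takes place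
inside its network, but if `e₀` is e or f the network of G closed by e is composed with the other
edge. -/
lemma exists_represents_ext {G H : Graph α β} {b : Bool} {e f : β}
    (hG : ∀ e₀ ∈ E(G), ∃ D, Represents G D e₀) (he : e ∈ E(G)) (hf : f ∉ E(G))
    (hE : E(H) = insert f E(G))
    (hI : ∀ I, GraphIndep H I ↔ ExtIndep b (GraphIndep G) e f I) :
    ∀ e₀ ∈ E(H), ∃ D, Represents H D e₀ := by
  intro e₀ h0
  have hef : e ≠ f := fun h => hf (h ▸ he)
  have hJ {D : Net β} {a : β} (h : Represents G D a) :
      GraphIndep G = NetIndep D a := funext fun I => propext (h.indep_iff I)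
  have hs {D : Net β} {a : β} (h : Represents G D a) : f ≠ a ∧ f ∉ D.supp := by
    rw [h.edgeSet_eq] at hf; simpa using hf
  by_cases hne : e₀ ≠ e ∧ e₀ ≠ f
  · have h0G : e₀ ∈ E(G) := by
      rw [hE] at h0; exact h0.resolve_left hne.2
    obtain ⟨D, h⟩ := hG e₀ h0G
    have heD : e ∈ D.supp := by
      rw [h.edgeSet_eq] at he; exact he.resolve_left hne.1.symm
    obtain ⟨D', hD', hx⟩ := h.isNet.exists_ext b heD (hs h).2
    have h0' : e₀ ∉ D'.supp := by rw [hx.supp_eq]; simp [hne.2, h.notMem]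
    refine ⟨D', ?_, h0', hD', fun I => ?_⟩
    · rw [hE, h.edgeSet_eq, hx.supp_eq, Finset.coe_insert, Set.insert_comm]
    · rw [hI, hx.netIndep h0', hJ h]
  · obtain ⟨D, h⟩ := hG e he
    have hfD := (hs h).2
    by_cases h1 : e₀ = e
    · subst h1
      refine ⟨Net.comp b D (Net.leaf f), ?_, ?_, h.isNet.comp b (.leaf f) ?_, fun I => ?_⟩
      · rw [hE, h.edgeSet_eq, Net.supp_comp]
        ext x; simp [Net.leaf]; tauto
      · rw [Net.supp_comp]; simp [Net.leaf, h.notMem, hef]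
      · simpa [Net.leaf] using hfD
      · rw [hI, netIndep_comp_leaf h.isNet h.notMem hfD hef, hJ h]
    · obtain rfl : e₀ = f := by tauto
      refine ⟨Net.comp b D (Net.leaf e), ?_, ?_, h.isNet.comp b (.leaf e) ?_, fun I => ?_⟩
      · rw [hE, h.edgeSet_eq, Net.supp_comp]
        ext x; simp [Net.leaf]
      · rw [Net.supp_comp]; simp [Net.leaf, hfD, hef.symm]
      · simpa [Net.leaf] using h.notMem
      · rw [hI, netIndep_comp_leaf_swap h.isNet h.notMem hfD hef, hJ h]

lemma FromTwoCycle.exists_represents {G : Graph α β} (hG : FromTwoCycle G) :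
    ∀ e₀ ∈ E(G), ∃ D, Represents G D e₀ := by
  induction hG with
  | twoCycle u v e f huv hef =>
    intro e₀ h0
    have : e₀ = e ∨ e₀ = f := by simpa using h0
    rcases this with rfl | rfl
    · rw [Set.pair_comm]
      exact ⟨_, represents_banana huv hef.symm⟩
    · exact ⟨_, represents_banana huv hef⟩
  | parallel G H hG h ih =>
    obtain ⟨e, f, he, hf, -, hH⟩ := h
    exact exists_represents_ext ih he hf (graphIndep_parallel he hf hH ∅).1
      fun I => (graphIndep_parallel he hf hH I).2
  | series G H hG h ih =>
    obtain ⟨e, f, u, v, w, he, hf, hw, -, hH⟩ := h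
    exact exists_represents_ext ih he.edge_mem hf (graphIndep_series he hf hw hH ∅).1
      fun I => (graphIndep_series he hf hw hH I).2

/-- Finiteness of the vertex set is carried along to provide a fresh vertex at each subdivision. -/
lemma IsNet.exists_graph {D : Net β} (hD : IsNet D) {e₀ : β} (h0 : e₀ ∉ D.supp) :
    ∃ G : Graph ℕ β, FromTwoCycle G ∧ V(G).Finite ∧ Represents G D e₀ := by
  induction hc : D.supp.card generalizing D with
  | zero => exact absurd hD.supp_nonempty (by simpa using hc)
  | succ n ih =>
    rcases hD.eq_leaf_or_exists_ext with ⟨a, rfl⟩ | ⟨b, e, f, E, hE, h⟩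
    · have hne : a ≠ e₀ := by rintro rfl; simp [Net.leaf] at h0
      exact ⟨_, .twoCycle 0 1 a e₀ zero_ne_one hne, by simp, represents_banana zero_ne_one hne⟩
    · have hs := h.supp_eq
      have he0 : e₀ ∉ E.supp := fun hh => h0 (hs ▸ Finset.mem_insert_of_mem hh)
      have hcE : E.supp.card = n := by
        rw [hs, Finset.card_insert_of_notMem h.notMem] at hc; omega
      obtain ⟨G, hG, hV, hR⟩ := ih hE he0 hcE
      have he : e ∈ E(G) := by rw [hR.edgeSet_eq]; exact Or.inr h.mem
      have hf : f ∉ E(G) := by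
        rw [hR.edgeSet_eq]
        rintro (rfl | hf)
        · exact h0 (hs ▸ Finset.mem_insert_self _ _)
        · exact h.notMem hf
      have fin {H : Graph ℕ β} (hE' : E(H) = insert f E(G))
          (hI : ∀ I, GraphIndep H I ↔ ExtIndep b (GraphIndep G) e f I) : Represents H D e₀ := by
        refine ⟨?_, h0, hD, fun I => ?_⟩
        · rw [hE', hR.edgeSet_eq, hs, Finset.coe_insert, Set.insert_comm]
        · rw [hI, h.netIndep h0,
            show GraphIndep G = NetIndep E e₀ from funext fun I => propext (hR.indep_iff I)]
      cases b
      · obtain ⟨u, v, huv⟩ := G.exists_isLink_of_mem_edgeSet he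
        obtain ⟨w, hw⟩ := hV.exists_notMem
        obtain ⟨H, hVH, hH⟩ := exists_seriesExtension G (w := w) huv hf
        exact ⟨H, .series G H hG ⟨e, f, u, v, w, huv, hf, hw, hVH, hH⟩, hVH ▸ hV.insert w,
          fin (graphIndep_series huv hf hw hH ∅).1 fun I => (graphIndep_series huv hf hw hH I).2⟩
      · obtain ⟨H, hVH, hH⟩ := exists_parallelExtension G (e := e) hf
        exact ⟨H, .parallel G H hG ⟨e, f, he, hf, hVH, hH⟩, hVH ▸ hV,
          fin (graphIndep_parallel he hf hH ∅).1 fun I => (graphIndep_parallel he hf hH I).2⟩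

end Correspondence

section NetIndep

variable {β : Type*} [DecidableEq β] {D D' : Net β} {e₀ : β} {I J : Finset β}

lemma netIndep_of_notMem (h : e₀ ∉ I) : NetIndep D e₀ I ↔ D.ind I := by
  simp [NetIndep, h]

lemma netIndep_insert (h : e₀ ∉ I) : NetIndep D e₀ (insert e₀ I) ↔ D.ind I ∧ ¬ D.con I := by
  simp [NetIndep, h]

lemma IsNet.netIndep_mono (hD : IsNet D) (hI : NetIndep D e₀ I) (hJ : J ⊆ I) :
    NetIndep D e₀ J :=
  ⟨hD.ind_mono hI.1 (Finset.erase_subset_erase _ hJ), fun h hc =>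
    hI.2 (hJ h) (Net.con_mono hc (Finset.erase_subset_erase _ hJ))⟩

/-- The independent sets without `e₀` give `ind`, and those with `e₀` decide which of them connect
the terminals, so `IsNet.eq_of_ind_con` applies. -/
lemma eq_of_netIndep (hD : IsNet D) (hD' : IsNet D') (hs : D.supp = D'.supp) (h0 : e₀ ∉ D.supp)
    (h : ∀ I, NetIndep D e₀ I ↔ NetIndep D' e₀ I) : D = D' := by
  have hi (I : Finset β) : D.ind I ↔ D'.ind I := by
    by_cases hI : e₀ ∈ I
    · exact ⟨fun h => absurd (hD.ind_subset h hI) h0,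
        fun h => absurd (hs ▸ hD'.ind_subset h hI) h0⟩
    · rw [← netIndep_of_notMem hI, h, netIndep_of_notMem hI]
  refine hD.eq_of_ind_con hD' hs hi fun I hI => ?_
  have hn : e₀ ∉ I := fun hh => h0 (hD.ind_subset hI hh)
  have := h (insert e₀ I)
  rw [netIndep_insert hn, netIndep_insert hn, ← hi] at this
  tauto

lemma IsNet.con_singleton (hD : IsNet D) {a : β} : D.con {a} ↔ D.path {a} := by
  refine ⟨?_, fun h => ⟨_, h, subset_rfl⟩⟩
  rintro ⟨P, hP, h⟩
  rcases Finset.subset_singleton_iff.1 h with rfl | rfl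
  · exact absurd rfl (hD.path_nonempty hP).ne_empty
  · exact hP

/-- An edge a is parallel to `e₀` exactly when {a} is a path; pairs avoiding `e₀` are tested in the
network. -/
lemma netIndep_pair_iff (hD : IsNet D) (h0 : e₀ ∉ D.supp) :
    (∀ e ∈ insert e₀ D.supp, ∀ f ∈ insert e₀ D.supp, NetIndep D e₀ {e, f}) ↔
      IsSimpleNet D ∧ ¬ HasEdge D := by
  have hne {e : β} (he : e ∈ D.supp) : e₀ ≠ e := fun h => h0 (h ▸ he)
  constructor
  · intro h
    refine ⟨fun e he f hf => ?_, ?_⟩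
    · rw [← netIndep_of_notMem (e₀ := e₀) (by simp [hne he, hne hf])]
      exact h e (by simp [he]) f (by simp [hf])
    · rintro ⟨a, ha⟩
      have haD := hD.path_subset ha (Finset.mem_singleton_self a)
      have := h e₀ (by simp) a (by simp [haD])
      rw [netIndep_insert (by simpa using hne haD)] at this
      exact this.2 (hD.con_singleton.2 ha)
  · rintro ⟨hs, hp⟩
    have key {f : β} (hf : f ∈ insert e₀ D.supp) : NetIndep D e₀ {e₀, f} := by
      rcases Finset.mem_insert.1 hf with rfl | hf
      · simp [NetIndep, hD.ind_empty, hD.not_con_empty]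
      · rw [netIndep_insert (by simpa using hne hf)]
        exact ⟨by simpa using hs f hf f hf, fun hc => hp ⟨f, hD.con_singleton.1 hc⟩⟩
    intro e he f hf
    rcases Finset.mem_insert.1 he with rfl | he'
    · exact key hf
    rcases Finset.mem_insert.1 hf with rfl | hf'
    · rw [Finset.pair_comm]; exact key he
    · rw [netIndep_of_notMem (by simp [hne he', hne hf'])]
      exact hs e he' f hf'

/-- A base containing `e₀` loses one element on deleting it, but what is left does not connect the
terminals, and `IsNet.rank_spec` bounds such sets by one less. -/
lemma eRank_eq {M : Matroid β} [M.Finite] (hD : IsNet D) (h0 : e₀ ∉ D.supp)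
    (hM : ∀ I : Finset β, M.Indep I ↔ NetIndep D e₀ I) : M.eRank = D.rank := by
  obtain ⟨⟨I, hI, -, hc⟩, -, h1, h2⟩ := hD.rank_spec
  have hIM : M.Indep I := by
    rw [hM, netIndep_of_notMem fun h => h0 (hD.ind_subset hI h)]; exact hI
  apply le_antisymm
  · obtain ⟨B, hB⟩ := M.exists_isBase
    have hBf : B.Finite := hB.finite
    rw [← hB.encard_eq_eRank, ← hBf.coe_toFinset, Set.encard_coe_eq_coe_finsetCard]
    have hBN : NetIndep D e₀ hBf.toFinset := by
      rw [← hM, hBf.coe_toFinset]; exact hB.indep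
    norm_cast
    by_cases he : e₀ ∈ hBf.toFinset
    · rw [← Finset.card_erase_add_one he]
      exact h2 _ hBN.1 (hBN.2 he)
    · exact h1 _ ((netIndep_of_notMem he).1 hBN)
  · have := hIM.encard_le_eRank
    rwa [Set.encard_coe_eq_coe_finsetCard, hc] at this

end NetIndep

end SeriesParallel

/-! ### Counting matroids through networks. -/

namespace SeriesParallel

section Counting

variable {n : ℕ} {e₀ : Fin n}

lemma edgeSet_eq_of_univ {D : Net (Fin n)} (hs : D.supp = Finset.univ.erase e₀) :
    insert e₀ (D.supp : Set (Fin n)) = Set.univ := by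
  rw [hs, ← Finset.coe_insert, Finset.insert_erase (Finset.mem_univ _), Finset.coe_univ]

lemma isSimpleMatroid_iff {M : Matroid (Fin n)} {D : Net (Fin n)} (hE : M.E = Set.univ)
    (hD : IsNet D) (hs : D.supp = Finset.univ.erase e₀)
    (hM : ∀ I : Finset (Fin n), M.Indep I ↔ NetIndep D e₀ I) :
    IsSimpleMatroid M ↔ IsSimpleNet D ∧ ¬ HasEdge D := by
  rw [← netIndep_pair_iff hD (by rw [hs]; exact Finset.notMem_erase _ _), hs,
    Finset.insert_erase (Finset.mem_univ _), IsSimpleMatroid, hE]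
  simp only [Set.mem_univ, Finset.mem_univ, true_imp_iff, ← hM, Finset.coe_pair]

lemma exists_net_of_isSeriesParallelMatroid {M : Matroid (Fin n)} (hn : 2 ≤ n) (e₀ : Fin n)
    (hE : M.E = Set.univ) (hM : IsSeriesParallelMatroid M) :
    ∃ D, IsNet D ∧ D.supp = Finset.univ.erase e₀ ∧
      ∀ I : Finset (Fin n), M.Indep I ↔ NetIndep D e₀ I := by
  obtain ⟨G, hG, hME, hMI⟩ := hM
  have not_single (e : Fin n) : E(G) ≠ {e} := fun h => by
    have h1 : (Set.univ : Set (Fin n)).ncard = 1 := by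
      rw [← hE, hME, h, Set.ncard_singleton]
    rw [Set.ncard_univ, Nat.card_fin] at h1
    omega
  rcases hG with hG | ⟨u, v, e, -, rfl⟩ | ⟨v, e, rfl⟩
  · obtain ⟨D, h⟩ := hG.exists_represents e₀ (by rw [← hME, hE]; trivial)
    refine ⟨D, h.isNet, ?_, fun I => (hMI I).trans (h.indep_iff I)⟩
    have h1 : insert e₀ D.supp = Finset.univ := by
      rw [← Finset.coe_inj, Finset.coe_insert, ← h.edgeSet_eq, ← hME, hE, Finset.coe_univ]
    rw [← h1, Finset.erase_insert h.notMem]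
  · exact absurd (by simp) (not_single e)
  · exact absurd (by simp) (not_single e)

lemma exists_isSeriesParallelMatroid {D : Net (Fin n)} (hD : IsNet D)
    (hs : D.supp = Finset.univ.erase e₀) :
    ∃ M : Matroid (Fin n), M.E = Set.univ ∧ IsSeriesParallelMatroid M ∧
      ∀ I : Finset (Fin n), M.Indep I ↔ NetIndep D e₀ I := by
  have h0 : e₀ ∉ D.supp := by rw [hs]; exact Finset.notMem_erase _ _
  obtain ⟨G, hG, -, hR⟩ := hD.exists_graph h0
  have h1 : NetIndep D e₀ ∅ := ⟨by simpa using hD.ind_empty, by simp⟩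
  have h2 ⦃I J : Finset (Fin n)⦄ (hJ : NetIndep D e₀ J) (h : I ⊆ J) : NetIndep D e₀ I :=
    hD.netIndep_mono hJ h
  have h3 ⦃I : Finset (Fin n)⦄ (_ : NetIndep D e₀ I) : (I : Set (Fin n)) ⊆ Set.univ :=
    Set.subset_univ _
  let M := (IndepMatroid.ofFinset Set.univ (NetIndep D e₀) h1 h2 (hD.aug_netIndep h0) h3).matroid
  have hM (I : Finset (Fin n)) : M.Indep I ↔ NetIndep D e₀ I :=
    IndepMatroid.ofFinset_indep Set.univ (NetIndep D e₀) h1 h2 (hD.aug_netIndep h0) h3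
  refine ⟨M, rfl, ⟨G, Or.inl hG, ?_, fun I => ?_⟩, hM⟩
  · rw [hR.edgeSet_eq, edgeSet_eq_of_univ hs]; rfl
  · rw [← I.toFinite.coe_toFinset, hM, ← hR.indep_iff]; rfl

/-- Closing a network by `e₀` is a bijection onto the matroids: injective by `eq_of_netIndep`,
surjective by `exists_net_of_isSeriesParallelMatroid`, where n ≥ 2 excludes the single edge and the
loop. -/
lemma numSimple_eq (hn : 2 ≤ n) (e₀ : Fin n) (k : ℕ) : numSimple n k =
    (nets (fun D => ¬ HasEdge D ∧ D.rank = k) (Finset.univ.erase e₀)).card := by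
  have h0 {D : Net (Fin n)} (hs : D.supp = Finset.univ.erase e₀) : e₀ ∉ D.supp := by
    rw [hs]; exact Finset.notMem_erase _ _
  have hrank {M : Matroid (Fin n)} {D : Net (Fin n)} (hD : IsNet D)
      (hs : D.supp = Finset.univ.erase e₀)
      (hM : ∀ I : Finset (Fin n), M.Indep I ↔ NetIndep D e₀ I) : M.eRank = k ↔ D.rank = k := by
    rw [eRank_eq hD (h0 hs) hM]; norm_cast
  have ex (D : Net (Fin n))
      (h : D ∈ (nets (fun D => ¬ HasEdge D ∧ D.rank = k) (Finset.univ.erase e₀) : Set _)) :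
      ∃ M : Matroid (Fin n), M.E = Set.univ ∧ IsSeriesParallelMatroid M ∧
      ∀ I : Finset (Fin n), M.Indep I ↔ NetIndep D e₀ I := by
    obtain ⟨hD, hs, -⟩ := mem_nets.1 (Finset.mem_coe.1 h)
    exact exists_isSeriesParallelMatroid hD hs
  choose F hFE hFS hFI using ex
  rw [← Set.ncard_coe_finset]
  refine (Set.ncard_congr F (fun D h => ?_) (fun D D' h h' hF => ?_) fun M hM => ?_).symm
  · obtain ⟨hD, hs, hsim, hp, hr⟩ := mem_nets.1 (Finset.mem_coe.1 h)
    exact ⟨hFE D h, hFS D h, (isSimpleMatroid_iff (hFE D h) hD hs (hFI D h)).2 ⟨hsim, hp⟩,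
      (hrank hD hs (hFI D h)).2 hr⟩
  · obtain ⟨hD, hs, -⟩ := mem_nets.1 (Finset.mem_coe.1 h)
    obtain ⟨hD', hs', -⟩ := mem_nets.1 (Finset.mem_coe.1 h')
    exact eq_of_netIndep hD hD' (hs.trans hs'.symm) (h0 hs) fun I => by
      rw [← hFI D h, ← hFI D' h', hF]
  · obtain ⟨hE, hSP, hsim, hr⟩ := hM
    obtain ⟨D, hD, hs, hI⟩ := exists_net_of_isSeriesParallelMatroid hn e₀ hE hSP
    obtain ⟨hsim', hp⟩ := (isSimpleMatroid_iff hE hD hs hI).1 hsim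
    have hmem : D ∈ nets (fun D => ¬ HasEdge D ∧ D.rank = k) (Finset.univ.erase e₀) :=
      mem_nets.2 ⟨hD, hs, hsim', hp, (hrank hD hs hI).1 hr⟩
    refine ⟨D, Finset.mem_coe.2 hmem, Matroid.ext_indep ((hFE _ _).trans hE.symm) fun I _ => ?_⟩
    rw [← I.toFinite.coe_toFinset, hFI, hI]

/-- For a fixed number of edges the deficit and the rank determine each other. -/
lemma coeff_genQ {β : Type} [DecidableEq β] {S : Finset β} (hS : S.Nonempty) (d k : ℕ)
    (hk : S.card + 2 + d = 2 * k) :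
    (genQ S).coeff d = (nets (fun D => ¬ HasEdge D ∧ D.rank = k) S).card := by
  classical
  have : nets (fun D => ¬ HasEdge D ∧ D.rank = k) S =
      (nets (fun D => ¬ HasEdge D) S).filter fun D => D.rank = k := by
    ext D; simp [mem_nets, and_assoc]
  rw [genQ, if_neg hS.ne_empty, add_zero, Polynomial.finsetSum_coeff, this,
    Finset.card_filter, Nat.cast_sum]
  refine Finset.sum_congr rfl fun D hD => ?_
  obtain ⟨hN, rfl, hs, hp⟩ := mem_nets.1 hD
  have := (hN.card_le hs).2 hp
  rw [Polynomial.coeff_X_pow, Nat.cast_ite, Nat.cast_one, Nat.cast_zero]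
  exact if_congr (by omega) rfl rfl

end Counting

end SeriesParallel

theorem mainTheorem5 (k : ℕ) (hk : 3 ≤ k) :
    (SeriesParallel.numSimple (2 * k - 3) k : ℚ) / (Nat.doubleFactorial (2 * k - 3) : ℚ) =
      (1 / 2) * (2 * (k : ℚ) - 1) ^ ((k : ℤ) - 2) - (2 * (k : ℚ) - 2) ^ ((k : ℤ) - 2)
        + (1 / 2) * (2 * (k : ℚ) - 3) ^ ((k : ℤ) - 2)
        + (2 / 3) * ((k : ℚ) - 2) *
            ((2 * (k : ℚ) - 3) ^ ((k : ℤ) - 3) - (2 * (k : ℚ) - 2) ^ ((k : ℤ) - 3))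
        + (1 / 9) * (4 * (k : ℚ) - 7) * ((k : ℚ) - 2) * ((k : ℚ) - 3) *
            (2 * (k : ℚ) - 3) ^ ((k : ℤ) - 5) := by
  obtain ⟨l, rfl⟩ : ∃ l, k = l + 2 := ⟨k - 2, by omega⟩
  have hn : 2 * (l + 2) - 3 = 2 * l + 1 := by omega
  rw [hn]
  set S : Finset (Fin (2 * l + 1)) := Finset.univ.erase 0 with hS
  have hc : S.card = 2 * l := by simp [hS]
  have hne : S.Nonempty := Finset.card_pos.1 (by omega)
  -- Besides the closing element 0 there are 2l edges, so rank l + 2 means deficit 2(l + 2) - 2 - 2l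
  -- = 2.
  rw [SeriesParallel.numSimple_eq (by omega) 0, ← hS,
    ← SeriesParallel.coeff_genQ hne 2 (l + 2) (by omega),
    SeriesParallel.coeff_two_genQ S l (by omega) hc ((l + 2 : ℕ) : ℚ) (by push_cast; ring)]
  have h2 : ((l + 2 : ℕ) : ℤ) - 2 = l := by push_cast; ring
  have h3 : ((l + 2 : ℕ) : ℤ) - 3 = l - 1 := by push_cast; ring
  have h5 : ((l + 2 : ℕ) : ℤ) - 5 = l - 3 := by push_cast; ring
  rw [h2, h3, h5]
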